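/- **Setting.** Let $\sigma\in L_2((0,\pi);\mathbb C)$, and let $r_1,r_2\in\mathbb C[\lambda]$ be relatively prime with $r_1$ monic and $\deg r_2\le\deg r_1=:M_1$. For a function $y$ put $y^{[1]}=y'-\sigma y$, and consider, with $y,y^{[1]}$ absolutely continuous on $[0,\pi]$, the equation $$-(y^{[1]})'-\sigma y^{[1]}-\sigma^2y=\lambda y\quad\text{on }(0,\pi).\tag{1}$$ Let $\mathcal L$ be the problem (1) with $y^{[1]}(0)=0$, $r_1(\lambda)y^{[1]}(\pi)+r_2(\lambda)y(\pi)=0$. Let $\varphi(x,\lambda)$, $\psi(x,\lambda)$ be the solutions of (1) with $\varphi(0)=1$, $\varphi^{[1]}(0)=0$, $\psi(\pi)=r_1(\lambda)$, $\psi^{[1]}(\pi)=-r_2(\lambda)$. Put $$\Delta(\lambda)=r_1(\lambda)\varphi^{[1]}(\pi,\lambda)+r_2(\lambda)\varphi(\pi,\lambda),\qquad M(\lambda)=\frac{\psi(0,\lambda)}{\psi^{[1]}(0,\lambda)}$$ (characteristic function and Weyl function). Let $\sqrt{\cdot}$ be the square root with argument in $[-\pi/2,\pi/2)$, with $\sqrt0=0$.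 Let $\{\lambda_n\}_{n\ge1}$ be the zeros of $\Delta$, each repeated according to its multiplicity, with equal ones consecutive, and numbered so that $\sqrt{\lambda_n}=n-M_1-1+o(1)$ as $n\to\infty$. For $n\ge 1$ let $m_n$ be the multiplicity of $\lambda_n$, and let $\nu_n\in\{0,\dots,m_n-1\}$ be the position of $n$ in its block of equal eigenvalues (so $\lambda_{n-\nu_n}$ is the first of the block). Let $\alpha_n$ be the numbers such that $\sum_{j=0}^{m_k-1}\alpha_{k+j}(\lambda-\lambda_k)^{-j-1}$ is the principal part of $M$ at $\lambda_k$ whenever $\nu_k=0$. The model problem is the one with $\sigma=0$, $r_1=\lambda^{M_1}$, $r_2=0$. Its spectral data are $\tilde\lambda_n=0$ for $n\le M_1+1$, $\tilde\lambda_n=(n-M_1-1)^2$ for $n>M_1+1$, and $\tilde\alpha_1=\frac1\pi$, $\tilde\alpha_n=0$ for $2\le n\le M_1+1$, $\tilde\alpha_n=\frac2\pi$ for $n>M_1+1$; its solution is $\tilde\varphi(x,\lambda)=\cos(\sqrt\lambda\,x)$. Write $\lambda_{n0}=\lambda_n$, $\lambda_{n1}=\tilde\lambda_n$, $\alpha_{n0}=\alpha_n$,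 $\alpha_{n1}=\tilde\alpha_n$. Let $m_{ni}$ and $\nu_{ni}$ be the multiplicity and the position of $n$ in its block for the sequence $\{\lambda_{ni}\}_{n\ge1}$. With $\langle y,z\rangle=yz'-y'z$ put $\tilde D(x,\lambda,\mu)=\dfrac{\langle\tilde\varphi(x,\lambda),\tilde\varphi(x,\mu)\rangle}{\lambda-\mu}$ (extended continuously to $\lambda=\mu$), and $$\tilde\varphi_{n,i}(x)=\frac1{\nu_{ni}!}\frac{\partial^{\nu_{ni}}\tilde\varphi}{\partial\lambda^{\nu_{ni}}}(x,\lambda_{ni}),\qquad \tilde A_{k,j}(x,\lambda)=\sum_{p=k}^{k-\nu_{kj}+m_{kj}-1}\frac{\alpha_{pj}}{(p-k)!}\frac{\partial^{p-k}\tilde D}{\partial\mu^{p-k}}(x,\lambda,\mu)\Big|_{\mu=\lambda_{kj}},$$ $$\tilde Q_{n,i;k,j}(x)=\frac1{\nu_{ni}!}\frac{\partial^{\nu_{ni}}\tilde A_{k,j}}{\partial\lambda^{\nu_{ni}}}(x,\lambda)\Big|_{\lambda=\lambda_{ni}} .$$ Thus $\tilde A_{k,0}$ and $\tilde A_{k,1}$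 are the coefficients of $(\mu-\lambda_{k0})^{-\nu_{k0}-1}$ and $(\mu-\lambda_{k1})^{-\nu_{k1}-1}$ in the principal parts of $\tilde D(x,\lambda,\mu)M(\mu)$ at $\lambda_{k0}$ and of $\tilde D(x,\lambda,\mu)\tilde M(\mu)$ at $\lambda_{k1}$, where $\tilde M$ is the Weyl function of the model problem. Let $\xi_n=|\sqrt{\lambda_n}-\sqrt{\tilde\lambda_n}|+|\alpha_n-\tilde\alpha_n|$, and let $\chi_n=\xi_n^{-1}$ if $\xi_n\ne0$, $\chi_n=0$ if $\xi_n=0$. Assume that the numbering of the eigenvalues is such that $\nu_{n0}=\nu_{n1}$ for every $n$ with $\xi_n=0$ (this is automatic if all eigenvalues of $\mathcal L$ are simple and $M_1=0$). Put $$\begin{pmatrix}\tilde\psi_{n0}\\ \tilde\psi_{n1}\end{pmatrix}=\begin{pmatrix}\chi_n&-\chi_n\\0&1\end{pmatrix}\begin{pmatrix}\tilde\varphi_{n,0}\\ \tilde\varphi_{n,1}\end{pmatrix},$$ $$\begin{pmatrix}\tilde H_{n0,k0}&\tilde H_{n0,k1}\\ \tilde H_{n1,k0}&\tilde H_{n1,k1}\end{pmatrix}=\begin{pmatrix}\chi_n&-\chi_n\\0&1\end{pmatrix}\begin{pmatrix}\tilde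 Q_{n,0;k,0}&\tilde Q_{n,0;k,1}\\ \tilde Q_{n,1;k,0}&\tilde Q_{n,1;k,1}\end{pmatrix}\begin{pmatrix}\xi_k&1\\0&-1\end{pmatrix}.$$ Let $m$ be the Banach space of bounded complex sequences $f=(f_v)_{v\in V}$, $V=\{(n,i):n\ge1,\ i\in\{0,1\}\}$, with the supremum norm, and let $E$ be the identity operator of $m$. **Theorem.** For each fixed $x\in[0,\pi]$ the matrix $\tilde H(x)$ defines a bounded linear operator on $m$, $(\tilde H(x)f)_u=\sum_{v\in V}\tilde H_{u,v}(x)f_v$ with absolutely convergent series, and the operator $E+\tilde H(x)$ has a bounded inverse on $m$. Hence $\tilde\psi(x)\in m$, and the main equation $\tilde\psi(x)=(E+\tilde H(x))f$ has exactly one solution $f\in m$. -/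

import Mathlib

open Set Filter Topology MeasureTheory Polynomial
open scoped ENNReal ComplexConjugate

namespace SturmLiouville

noncomputable section

/-! ### The boundary value problem with a singular potential -/

/-- `y` is a solution on `[0, π]` of `-(y^{[1]})' - σ y^{[1]} - σ² y = lam y` with the
quasi-derivative `yq = y^{[1]} = y' - σ y`: both functions are continuous on `[0, π]` and satisfy
the integrated first order system (for `σ ∈ L₂(0, π)` this is the same as absolute continuity of
`y` and `yq` together with the equations almost everywhere). -/
structure IsSolution (σ : ℝ → ℂ) (lam : ℂ) (y yq : ℝ → ℂ) : Prop where
  continuousOn : ContinuousOn y (Icc 0 Real.pi)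
  continuousOn_quasi : ContinuousOn yq (Icc 0 Real.pi)
  eq_integral : ∀ x ∈ Icc (0 : ℝ) Real.pi, y x = y 0 + ∫ t in (0 : ℝ)..x, (yq t + σ t * y t)
  quasi_eq_integral : ∀ x ∈ Icc (0 : ℝ) Real.pi,
    yq x = yq 0 - ∫ t in (0 : ℝ)..x, (σ t * yq t + σ t ^ 2 * y t + lam * y t)

/-- The pair `(y, y^{[1]})` on `[0, π]` for the solution with initial data
`y(a) = c`, `y^{[1]}(a) = d`. -/
def initialSolution (σ : ℝ → ℂ) (lam : ℂ) (a : ℝ) (c d : ℂ) : (ℝ → ℂ) × (ℝ → ℂ) :=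
  Classical.epsilon fun Y : (ℝ → ℂ) × (ℝ → ℂ) =>
    IsSolution σ lam Y.1 Y.2 ∧ Y.1 a = c ∧ Y.2 a = d

/-- `φ(·, lam)` and its quasi-derivative: `φ(0) = 1`, `φ^{[1]}(0) = 0`. -/
def phi (σ : ℝ → ℂ) (lam : ℂ) : (ℝ → ℂ) × (ℝ → ℂ) :=
  initialSolution σ lam 0 1 0

/-- `ψ(·, lam)` and its quasi-derivative: `ψ(π) = r₁(lam)`, `ψ^{[1]}(π) = -r₂(lam)`. -/
def psi (σ : ℝ → ℂ) (r₁ r₂ : ℂ[X]) (lam : ℂ) : (ℝ → ℂ) × (ℝ → ℂ) :=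
  initialSolution σ lam Real.pi (r₁.eval lam) (-(r₂.eval lam))

/-- The characteristic function `Δ(lam) = r₁(lam) φ^{[1]}(π, lam) + r₂(lam) φ(π, lam)`, whose zeros
(with their orders) are the eigenvalues (with their multiplicities). -/
def charFun (σ : ℝ → ℂ) (r₁ r₂ : ℂ[X]) (lam : ℂ) : ℂ :=
  r₁.eval lam * (phi σ lam).2 Real.pi + r₂.eval lam * (phi σ lam).1 Real.pi

/-- The Weyl function `M(lam) = ψ(0, lam) / ψ^{[1]}(0, lam)`; this is the value at `x = 0` of the
solution `Φ` with `Φ^{[1]}(0) = 1` and `r₁ Φ^{[1]}(π) + r₂ Φ(π) = 0`. -/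
def weyl (σ : ℝ → ℂ) (r₁ r₂ : ℂ[X]) (lam : ℂ) : ℂ :=
  (psi σ r₁ r₂ lam).1 0 / (psi σ r₁ r₂ lam).2 0

/-- The normalisation of the polynomials in the case `deg r₂ ≤ deg r₁`. -/
structure IsAdmissible (r₁ r₂ : ℂ[X]) : Prop where
  monic : r₁.Monic
  natDegree_le : r₂.natDegree ≤ r₁.natDegree
  coprime : IsCoprime r₁ r₂

/-! ### Spectral data

All sequences are indexed by `ℕ`, starting from `0`: the entry with index `n` is the one that is
numbered `n + 1` when the count starts from `1`. -/

/-- The square root with argument in `[-π/2, π/2)`. -/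
def rho (lam : ℂ) : ℂ := conj ((conj lam) ^ ((2 : ℂ)⁻¹))

/-- The first index at which the value `lam n` occurs. -/
def blockStart (lam : ℕ → ℂ) (n : ℕ) : ℕ := sInf {k | lam k = lam n}

/-- The place `0, 1, …, m - 1` of the index `n` in the block of equal values around it. -/
def pos (lam : ℕ → ℂ) (n : ℕ) : ℕ := n - blockStart lam n

/-- The multiplicity of the value `lam n`. -/
def mult (lam : ℕ → ℂ) (n : ℕ) : ℕ := {k | lam k = lam n}.ncard

/-- `(lam n, α n)` are spectral data of the problem given by `σ, r₁, r₂`, `deg r₂ ≤ deg r₁`. -/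
structure IsSpectralData (σ : ℝ → ℂ) (r₁ r₂ : ℂ[X]) (lam α : ℕ → ℂ) : Prop where
  /-- every eigenvalue occurs according to its multiplicity, and nothing else occurs -/
  count : ∀ z : ℂ, {n | lam n = z}.encard = analyticOrderAt (charFun σ r₁ r₂) z
  /-- equal eigenvalues are consecutive -/
  consecutive : ∀ i j k : ℕ, i ≤ j → j ≤ k → lam i = lam k → lam j = lam i
  /-- the numbering follows the asymptotics of the eigenvalues -/
  asymptotics : Tendsto (fun n : ℕ => rho (lam n) - ((n : ℂ) - (r₁.natDegree : ℂ))) atTop (𝓝 0)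
  /-- `α k, …, α (k + m - 1)` are the coefficients of the principal part of the Weyl function at
  an eigenvalue `lam k = … = lam (k + m - 1)` of multiplicity `m` -/
  principalPart : ∀ k : ℕ, pos lam k = 0 → ∃ g : ℂ → ℂ, AnalyticAt ℂ g (lam k) ∧
    ∀ᶠ z in 𝓝[≠] (lam k), weyl σ r₁ r₂ z =
      ∑ j ∈ Finset.range (mult lam k), α (k + j) / (z - lam k) ^ (j + 1) + g z

/-! ### The model problem `σ = 0`, `r₁ = lam ^ M`, `r₂ = 0` -/

/-- The eigenvalues `0` (`M + 1` times), `1, 4, 9, …` of the model problem. -/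
def modelLam (M : ℕ) (n : ℕ) : ℂ := if n ≤ M then 0 else ((n : ℂ) - (M : ℂ)) ^ 2

/-- The coefficients of the principal parts of the model Weyl function
`cos (ρ π) / (ρ sin (ρ π))`, `ρ ^ 2 = lam`. -/
def modelAlpha (M : ℕ) (n : ℕ) : ℂ :=
  if n = 0 then 1 / (Real.pi : ℂ) else if n ≤ M then 0 else 2 / (Real.pi : ℂ)

/-- The solution `φ̃(x, lam) = cos (ρ x)`, `ρ ^ 2 = lam`, of `-y'' = lam y`, `y(0) = 1`,
`y'(0) = 0`. -/
def phiT (x : ℝ) (lam : ℂ) : ℂ := Complex.cos (rho lam * (x : ℂ))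

/-- `D̃(x, lam, μ) = ⟨φ̃(x, lam), φ̃(x, μ)⟩ / (lam - μ)`, where `⟨y, z⟩ = y z' - y' z`, extended by
continuity to `lam = μ`. It is written as an integral, which covers both cases; the theorem
`DT_eq` below is the formula with the quotient. -/
def DT (x : ℝ) (lam μ : ℂ) : ℂ := ∫ t in (0 : ℝ)..x, phiT t lam * phiT t μ

theorem rho_sq (lam : ℂ) : rho lam ^ 2 = lam := by
  have h := Complex.cpow_nat_inv_pow (conj lam) (n := 2) two_ne_zero
  unfold rho
  rw [← map_pow]
  push_cast at h
  rw [h, Complex.conj_conj]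

theorem hasDerivAt_phiT (x : ℝ) (lam : ℂ) :
    HasDerivAt (fun t => phiT t lam) (-(rho lam) * Complex.sin (rho lam * (x : ℂ))) x := by
  have h1 : HasDerivAt (fun t : ℝ => rho lam * (t : ℂ)) (rho lam) x := by
    simpa using (Complex.ofRealCLM.hasDerivAt (x := x)).const_mul (rho lam)
  have h2 := (Complex.hasDerivAt_cos (rho lam * (x : ℂ))).comp x h1
  refine h2.congr_deriv ?_
  ring

theorem DT_eq (x : ℝ) (lam μ : ℂ) (h : lam ≠ μ) :
    DT x lam μ = (phiT x lam * deriv (fun t => phiT t μ) x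
      - deriv (fun t => phiT t lam) x * phiT x μ) / (lam - μ) := by
  have hd : ∀ t : ℝ, HasDerivAt (fun t : ℝ =>
      phiT t lam * (-(rho μ) * Complex.sin (rho μ * (t : ℂ)))
        - (-(rho lam) * Complex.sin (rho lam * (t : ℂ))) * phiT t μ)
      ((lam - μ) * (phiT t lam * phiT t μ)) t := by
    intro t
    have hs : ∀ z : ℂ, HasDerivAt (fun t : ℝ => -(rho z) * Complex.sin (rho z * (t : ℂ)))
        (-(z * phiT t z)) t := by
      intro z
      have h1 : HasDerivAt (fun t : ℝ => rho z * (t : ℂ)) (rho z) t := by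
        simpa using (Complex.ofRealCLM.hasDerivAt (x := t)).const_mul (rho z)
      have h2 := ((Complex.hasDerivAt_sin (rho z * (t : ℂ))).comp t h1).const_mul (-(rho z))
      refine h2.congr_deriv ?_
      have h3 := rho_sq z
      unfold phiT
      linear_combination (-Complex.cos (rho z * (t : ℂ))) * h3
    refine (((hasDerivAt_phiT t lam).mul (hs μ)).sub
      ((hs lam).mul (hasDerivAt_phiT t μ))).congr_deriv ?_
    ring
  have hc : ∀ z : ℂ, Continuous fun t : ℝ => phiT t z := fun z =>
    Complex.continuous_cos.comp (continuous_const.mul Complex.continuous_ofReal)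
  have hi := intervalIntegral.integral_eq_sub_of_hasDerivAt (a := 0) (b := x)
    (fun t _ => hd t) (Continuous.intervalIntegrable
      (continuous_const.mul ((hc lam).mul (hc μ))) 0 x)
  rw [intervalIntegral.integral_const_mul] at hi
  rw [eq_div_iff (sub_ne_zero.mpr h), (hasDerivAt_phiT x lam).deriv, (hasDerivAt_phiT x μ).deriv,
    mul_comm]
  unfold DT
  rw [hi]
  simp

/-! ### The main equation

The data of the problem (`i = 0`) and of the model problem (`i = 1`) are combined into families
`lam i n`, `α i n` with `i : Fin 2`. -/

/-- `Ã_{k,i}(x, z)`: for `k = s + j` at the place `j` of a block `s, …, s + m - 1`, the coefficient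
of `(μ - lam k)^{-(j+1)}` in the principal part at `μ = lam k` of
`D̃(x, z, μ) ∑_{p < m} α (s + p) / (μ - lam k)^{p+1}`. -/
def AT (lam α : ℕ → ℂ) (x : ℝ) (k : ℕ) (z : ℂ) : ℂ :=
  ∑ p ∈ Finset.Ico k (blockStart lam k + mult lam k),
    α p * ((1 / ((p - k).factorial : ℂ)) * iteratedDeriv (p - k) (fun μ => DT x z μ) (lam k))

/-- `Q̃_{n,i;k,j}(x)`: the coefficient of order `ν` in the Taylor expansion of `Ã_{k,j}(x, ·)` at
`lam i n`, where `ν` is the place of `n` in its block. -/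
def QT (lam α : Fin 2 → ℕ → ℂ) (x : ℝ) (n : ℕ) (i : Fin 2) (k : ℕ) (j : Fin 2) : ℂ :=
  (1 / ((pos (lam i) n).factorial : ℂ)) *
    iteratedDeriv (pos (lam i) n) (AT (lam j) (α j) x k) (lam i n)

/-- `φ̃_{n,i}(x)`: the Taylor coefficient of order `ν` of `φ̃(x, ·)` at `lam i n`, where `ν` is the
place of `n` in its block. -/
def phiTSeq (lam : Fin 2 → ℕ → ℂ) (x : ℝ) (n : ℕ) (i : Fin 2) : ℂ :=
  (1 / ((pos (lam i) n).factorial : ℂ)) *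
    iteratedDeriv (pos (lam i) n) (fun z => phiT x z) (lam i n)

/-- `ξ_n = |ρ_n - ρ̃_n| + |α_n - α̃_n|`. -/
def xi (lam α : Fin 2 → ℕ → ℂ) (n : ℕ) : ℝ :=
  ‖rho (lam 0 n) - rho (lam 1 n)‖ + ‖α 0 n - α 1 n‖

/-- `χ_n = 1 / ξ_n` if `ξ_n ≠ 0`, and `χ_n = 0` if `ξ_n = 0`. -/
def chi (lam α : Fin 2 → ℕ → ℂ) (n : ℕ) : ℝ := if xi lam α n = 0 then 0 else (xi lam α n)⁻¹

/-- The matrix that carries the pair `(φ_{n,0}, φ_{n,1})` to `(ψ_{n,0}, ψ_{n,1})`. -/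
def transMatrix (lam α : Fin 2 → ℕ → ℂ) (n : ℕ) : Matrix (Fin 2) (Fin 2) ℂ :=
  !![(chi lam α n : ℂ), -(chi lam α n : ℂ); 0, 1]

/-- The entries of the infinite matrix `H̃(x)`. -/
def HT (lam α : Fin 2 → ℕ → ℂ) (x : ℝ) (u v : ℕ × Fin 2) : ℂ :=
  (transMatrix lam α u.1 *
    !![QT lam α x u.1 0 v.1 0, QT lam α x u.1 0 v.1 1;
       QT lam α x u.1 1 v.1 0, QT lam α x u.1 1 v.1 1] *
    !![(xi lam α v.1 : ℂ), 1; 0, -1]) u.2 v.2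

/-- The entries of the vector `ψ̃(x)`. -/
def psiT (lam α : Fin 2 → ℕ → ℂ) (x : ℝ) (u : ℕ × Fin 2) : ℂ :=
  (transMatrix lam α u.1).mulVec ![phiTSeq lam x u.1 0, phiTSeq lam x u.1 1] u.2

end

/-- The Banach space `m` of bounded sequences indexed by the pairs `(n, i)`. -/
abbrev BddSeq : Type := lp (fun _ : ℕ × Fin 2 => ℂ) ∞

end SturmLiouville

open Set Filter Topology MeasureTheory Polynomial
open scoped ENNReal ComplexConjugate

namespace SturmLiouville

noncomputable section

/-! Write `⟨F, G⟩` for the bilinear pairing of `L²(0, x)` and `cos_z` for the function `cos(√z t)`.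
Since `D̃(x, λ, μ) = ⟨cos_λ, cos_μ⟩`, every entry of `H̃(x)` is the pairing of a row vector with a
column vector (`HT_eq_pair`). Hence `H̃(x) = A B`: the operator `B` combines the column functionals
with the coefficients of a bounded sequence, and `A` evaluates the resulting functional on `L²(0,
x)` along the row vectors. Both are bounded because `ξ` is square summable and the cosine pairings
obey a Bessel inequality (`exists_norm_rowVec_le`, `exists_sum_norm_pair_colVec_le`). As `1 + A B`
is invertible as soon as `1 + B A` is, the question moves to the dual of `L²(0, x)`.

There `1 + B A` can be computed. Applied to `⟨F, ·⟩` and evaluated at `G`, the operator `B A` gives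
a difference of two series (`row_mul_col`, `IsBlocked.sum_residues`): the residues of `M(z) ⟨F,
cos_z⟩ ⟨G, cos_z⟩`, minus the same with the model Weyl function. The model series is Parseval's
identity for cosines and has the sum `⟨F, G⟩` (`tendsto_sum_model`). So `1 + B A` corresponds to the
series of `M` alone.

Let `K` be the invertible transmutation operator, `K cos_z = φ_z` (`exists_transmutation`), and `K'`
its transpose. For `F = K' φ_μ` and `G = K' φ_μ'` the series consists of the residues of `M(z) ⟨φ_z,
φ_μ⟩ ⟨φ_z, φ_μ'⟩`, and a contour integral over growing circles shows that its sum is `⟨φ_μ, φ_μ'⟩`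
(`tendsto_sum_residues`). The `φ_μ` span a dense subspace, so `1 + B A` sends `⟨K' F, ·⟩` to the
functional `K' G ↦ ⟨F, G⟩` for all `F`, which displays it as a composition of isomorphisms
(`exists_equiv_add_dualSum`).

The analytic input is a representation of the solutions for `σ ∈ L₂` as a trigonometric function
plus the Fourier integral of a square integrable function on `[-x, x]` (`exists_transformation`). It
yields the exponential bounds, the kernel of `K`, and the asymptotics of the characteristic
function, from which the square summability of `ξ` follows (`IsSpectralData.summable_xi_sq`). -/

/-! ### Primitives of integrable functions -/

/-- `f` is on `[0, π]` the primitive of the integrable function `f'`. -/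
structure IsPrimitive (f f' : ℝ → ℂ) : Prop where
  integrable : IntervalIntegrable f' volume 0 Real.pi
  eq : ∀ x ∈ Icc 0 Real.pi, f x = f 0 + ∫ t in (0 : ℝ)..x, f' t

theorem intervalIntegrable_ofReal {f : ℝ → ℝ} {a b : ℝ} (h : IntervalIntegrable f volume a b) :
    IntervalIntegrable (fun t => (f t : ℂ)) volume a b :=
  ⟨h.1.ofReal, h.2.ofReal⟩

/-- Real and imaginary parts are primitives of real functions; multiplying them by the constants `1`
and `I` and adding recovers the complex primitive. -/
theorem absolutelyContinuousOnInterval_primitive {f : ℝ → ℂ} {b : ℝ}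
    (h : IntervalIntegrable f volume 0 b) :
    AbsolutelyContinuousOnInterval (fun x => ∫ t in (0 : ℝ)..x, f t) 0 b := by
  have hre : IntervalIntegrable (fun t => (f t).re) volume 0 b :=
    ⟨h.1.re, h.2.re⟩
  have him : IntervalIntegrable (fun t => (f t).im) volume 0 b :=
    ⟨h.1.im, h.2.im⟩
  have hc : ∀ c : ℂ, AbsolutelyContinuousOnInterval (fun _ : ℝ => c) 0 b := fun c =>
    (LipschitzWith.const c).lipschitzOnWith.absolutelyContinuousOnInterval
  have h1 := (hre.absolutelyContinuousOnInterval_intervalIntegral left_mem_uIcc).smul (hc 1)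
  have h2 := (him.absolutelyContinuousOnInterval_intervalIntegral left_mem_uIcc).smul
    (hc Complex.I)
  have h3 := h1.add h2
  have key : ∀ x ∈ uIcc 0 b, (∫ t in (0 : ℝ)..x, f t) =
      ((∫ t in (0 : ℝ)..x, (f t).re : ℝ) : ℂ) + ((∫ t in (0 : ℝ)..x, (f t).im : ℝ) : ℂ) *
        Complex.I := by
    intro x hx
    have hs : uIcc 0 x ⊆ uIcc 0 b := uIcc_subset_uIcc left_mem_uIcc hx
    rw [← intervalIntegral.integral_ofReal, ← intervalIntegral.integral_ofReal,
      ← intervalIntegral.integral_mul_const, ← intervalIntegral.integral_add]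
    · simp only [Complex.re_add_im]
    · exact intervalIntegrable_ofReal (hre.mono_set hs)
    · exact IntervalIntegrable.mul_const (intervalIntegrable_ofReal (him.mono_set hs)) _
  have h4 : (((fun x => ∫ t in (0 : ℝ)..x, (f t).re) • fun _ => (1 : ℂ)) +
      (fun x => ∫ t in (0 : ℝ)..x, (f t).im) • fun _ => Complex.I) = fun x =>
      ((∫ t in (0 : ℝ)..x, (f t).re : ℝ) : ℂ) + ((∫ t in (0 : ℝ)..x, (f t).im : ℝ) : ℂ) *
        Complex.I := by
    funext x
    simp only [Pi.add_apply, Pi.smul_apply', Complex.real_smul, mul_one]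
  rw [h4] at h3
  -- The decomposition `key` holds only on the interval. The ε–δ form evaluates functions at points
  -- of the interval only, so it can be transferred.
  rw [absolutelyContinuousOnInterval_iff] at h3 ⊢
  intro ε hε
  obtain ⟨δ, hδ, H⟩ := h3 ε hε
  refine ⟨δ, hδ, fun E hE hlt => ?_⟩
  refine lt_of_eq_of_lt (Finset.sum_congr rfl fun i hi => ?_) (H E hE hlt)
  have hm := hE.1 i hi
  rw [key _ hm.1, key _ hm.2]

namespace IsPrimitive

variable {f f' g g' : ℝ → ℂ}

theorem continuousOn (h : IsPrimitive f f') : ContinuousOn f (Icc 0 Real.pi) := by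
  have h1 := intervalIntegral.continuousOn_primitive_interval' h.integrable left_mem_uIcc
  rw [uIcc_of_le Real.pi_pos.le] at h1
  exact (continuousOn_const.add h1).congr fun x hx => h.eq x hx

theorem of_continuousOn_deriv {f f' : ℝ → ℂ} (hf : ∀ x, HasDerivAt f (f' x) x)
    (hc : Continuous f') : IsPrimitive f f' where
  integrable := hc.intervalIntegrable _ _
  eq x _ := by
    rw [intervalIntegral.integral_eq_sub_of_hasDerivAt (fun t _ => hf t)
      (hc.intervalIntegrable _ _)]
    ring

theorem const (c : ℂ) : IsPrimitive (fun _ => c) (fun _ => 0) :=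
  of_continuousOn_deriv (fun x => hasDerivAt_const x c) continuous_const

theorem subset {x : ℝ} (hx : x ∈ Icc 0 Real.pi) : uIcc 0 x ⊆ uIcc 0 Real.pi := by
  rw [uIcc_of_le hx.1, uIcc_of_le (hx.1.trans hx.2)]
  exact Icc_subset_Icc_right hx.2

theorem add (hf : IsPrimitive f f') (hg : IsPrimitive g g') :
    IsPrimitive (fun x => f x + g x) (fun x => f' x + g' x) where
  integrable := hf.integrable.add hg.integrable
  eq x hx := by
    rw [intervalIntegral.integral_add (hf.integrable.mono_set (subset hx))
      (hg.integrable.mono_set (subset hx)), hf.eq x hx, hg.eq x hx]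
    ring

theorem const_mul (c : ℂ) (hf : IsPrimitive f f') :
    IsPrimitive (fun x => c * f x) (fun x => c * f' x) where
  integrable := hf.integrable.const_mul c
  eq x hx := by
    rw [intervalIntegral.integral_const_mul, hf.eq x hx]
    ring

theorem sub (hf : IsPrimitive f f') (hg : IsPrimitive g g') :
    IsPrimitive (fun x => f x - g x) (fun x => f' x - g' x) := by
  simpa [sub_eq_add_neg] using hf.add (hg.const_mul (-1))

theorem congr_deriv (hf : IsPrimitive f f') (h : ∀ x ∈ Icc 0 Real.pi, f' x = g' x) :
    IsPrimitive f g' where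
  integrable := by
    refine hf.integrable.congr fun x hx => h x ?_
    rw [uIoc_of_le Real.pi_pos.le] at hx
    exact Ioc_subset_Icc_self hx
  eq x hx := by
    rw [hf.eq x hx]
    congr 1
    refine intervalIntegral.integral_congr fun t ht => h t ?_
    rw [uIcc_of_le hx.1] at ht
    exact ⟨ht.1, ht.2.trans hx.2⟩

/-- Integration by parts for absolutely continuous functions: `F • G - P` is absolutely continuous
with derivative zero almost everywhere, hence constant. `F` and `G` replace `f` and `g`, about which
nothing is known outside `[0, π]`. -/
theorem mul (hf : IsPrimitive f f') (hg : IsPrimitive g g') :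
    IsPrimitive (fun x => f x * g x) (fun x => f' x * g x + f x * g' x) := by
  have hpi : uIcc 0 Real.pi = Icc 0 Real.pi := uIcc_of_le Real.pi_pos.le
  have hint : IntervalIntegrable (fun x => f' x * g x + f x * g' x) volume 0 Real.pi :=
    (hf.integrable.mul_continuousOn (by rw [hpi]; exact hg.continuousOn)).add
      (hg.integrable.continuousOn_mul (by rw [hpi]; exact hf.continuousOn))
  refine ⟨hint, fun x hx => ?_⟩
  set F : ℝ → ℂ := fun x => f 0 + ∫ t in (0 : ℝ)..x, f' t
  set G : ℝ → ℂ := fun x => g 0 + ∫ t in (0 : ℝ)..x, g' t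
  set P : ℝ → ℂ := fun x => ∫ t in (0 : ℝ)..x, (f' t * g t + f t * g' t)
  have hc : ∀ c : ℂ, AbsolutelyContinuousOnInterval (fun _ : ℝ => c) 0 Real.pi := fun c =>
    (LipschitzWith.const c).lipschitzOnWith.absolutelyContinuousOnInterval
  have hF : AbsolutelyContinuousOnInterval F 0 Real.pi :=
    (hc (f 0)).add (absolutelyContinuousOnInterval_primitive hf.integrable)
  have hG : AbsolutelyContinuousOnInterval G 0 Real.pi :=
    (hc (g 0)).add (absolutelyContinuousOnInterval_primitive hg.integrable)
  have hP : AbsolutelyContinuousOnInterval P 0 Real.pi :=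
    absolutelyContinuousOnInterval_primitive hint
  have hH : AbsolutelyContinuousOnInterval (F • G - P) 0 Real.pi := (hF.smul hG).sub hP
  obtain ⟨C, hC⟩ := hH.const_of_ae_hasDerivAt_zero (by
    filter_upwards [hf.integrable.ae_hasDerivAt_integral, hg.integrable.ae_hasDerivAt_integral,
      hint.ae_hasDerivAt_integral] with y h1 h2 h3 hy
    have d1 : HasDerivAt F (f' y) y := (h1 hy 0 left_mem_uIcc).const_add (f 0)
    have d2 : HasDerivAt G (g' y) y := (h2 hy 0 left_mem_uIcc).const_add (g 0)
    have d3 := h3 hy 0 left_mem_uIcc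
    rw [hpi] at hy
    refine ((d1.mul d2).sub d3).congr_deriv ?_
    rw [← show f y = F y from hf.eq y hy, ← show g y = G y from hg.eq y hy]
    ring)
  have e0 := hC 0 left_mem_uIcc
  have e1 := hC x (by rwa [hpi])
  change F 0 * G 0 - P 0 = C at e0
  change F x * G x - P x = C at e1
  rw [← show f x = F x from hf.eq x hx, ← show g x = G x from hg.eq x hx] at e1
  have hF0 : F 0 = f 0 := by simp [F]
  have hG0 : G 0 = g 0 := by simp [G]
  have hP0 : P 0 = 0 := by simp [P]
  rw [hF0, hG0, hP0] at e0
  change f x * g x = f 0 * g 0 + P x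
  linear_combination e1 - e0

theorem congr_fun (hf : IsPrimitive f f') (h : ∀ x ∈ Icc 0 Real.pi, f x = g x) :
    IsPrimitive g f' where
  integrable := hf.integrable
  eq x hx := by
    rw [← h x hx, ← h 0 (left_mem_Icc.2 Real.pi_pos.le)]
    exact hf.eq x hx

theorem pow (hf : IsPrimitive f f') (n : ℕ) :
    IsPrimitive (fun x => f x ^ (n + 1)) (fun x => (n + 1) * f x ^ n * f' x) := by
  induction n with
  | zero => simpa using hf
  | succ n ih =>
    refine ((ih.mul hf).congr_fun fun x _ => ?_).congr_deriv fun x _ => ?_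
    · ring
    · push_cast
      ring

end IsPrimitive

/-! ### Linear Volterra equations in Banach spaces -/

section Volterra

variable {E : Type*} [NormedAddCommGroup E]

/-- The Banach space of continuous functions on `[0, π]` with values in `E`. -/
abbrev Curve (E : Type*) [NormedAddCommGroup E] : Type _ := C(Icc (0 : ℝ) Real.pi, E)

/-- The constant continuation of a function on `[0, π]` to the real line. -/
abbrev extend (Y : Curve E) : ℝ → E := IccExtend Real.pi_pos.le Y

theorem continuous_extend (Y : Curve E) : Continuous (extend Y) := Y.continuous.Icc_extend'

theorem norm_extend_le (Y : Curve E) (t : ℝ) : ‖extend Y t‖ ≤ ‖Y‖ := Y.norm_coe_le_norm _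

variable [NormedSpace ℂ E]

/-- A measurable family of bounded operators, with an integrable bound for their norms. -/
structure IsKernel (A : ℝ → E →L[ℂ] E) (a : ℝ → ℝ) : Prop where
  measurable : ∀ Y : Curve E,
    AEStronglyMeasurable (fun t => A t (extend Y t)) (volume.restrict (Ioc 0 Real.pi))
  bound : ∀ t, ‖A t‖ ≤ a t
  integrable : IntervalIntegrable a volume 0 Real.pi

namespace IsKernel

variable {A : ℝ → E →L[ℂ] E} {a : ℝ → ℝ}

theorem nonneg (h : IsKernel A a) (t : ℝ) : 0 ≤ a t := (norm_nonneg _).trans (h.bound t)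

theorem intervalIntegrable (h : IsKernel A a) (Y : Curve E) :
    IntervalIntegrable (fun t => A t (extend Y t)) volume 0 Real.pi := by
  rw [intervalIntegrable_iff_integrableOn_Ioc_of_le Real.pi_pos.le]
  have ha := (intervalIntegrable_iff_integrableOn_Ioc_of_le Real.pi_pos.le).1 h.integrable
  refine Integrable.mono' (ha.mul_const ‖Y‖) (h.measurable Y) (Eventually.of_forall fun t => ?_)
  exact (ContinuousLinearMap.le_opNorm _ _).trans
    (mul_le_mul (h.bound t) (norm_extend_le Y t) (norm_nonneg _) (h.nonneg t))

/-- The Volterra operator `(K Y)(x) = ∫_0^x A(t) Y(t) dt`. -/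
def volterra (h : IsKernel A a) : Curve E →L[ℂ] Curve E :=
  LinearMap.mkContinuous
    { toFun := fun Y => ⟨fun x => ∫ t in (0 : ℝ)..x, A t (extend Y t), by
        have h1 := intervalIntegral.continuousOn_primitive_interval' (h.intervalIntegrable Y)
          left_mem_uIcc
        rw [uIcc_of_le Real.pi_pos.le] at h1
        exact continuousOn_iff_continuous_domRestrict.1 h1⟩
      map_add' := fun Y Z => by
        ext x
        have hs := IsPrimitive.subset x.2
        change (∫ t in (0 : ℝ)..x, A t (extend (Y + Z) t)) =
          (∫ t in (0 : ℝ)..x, A t (extend Y t)) + ∫ t in (0 : ℝ)..x, A t (extend Z t)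
        rw [← intervalIntegral.integral_add ((h.intervalIntegrable Y).mono_set hs)
          ((h.intervalIntegrable Z).mono_set hs)]
        simp [extend, IccExtend]
      map_smul' := fun c Y => by
        ext x
        change (∫ t in (0 : ℝ)..x, A t (extend (c • Y) t)) =
          c • ∫ t in (0 : ℝ)..x, A t (extend Y t)
        rw [← intervalIntegral.integral_smul]
        simp [extend, IccExtend] }
    (∫ t in (0 : ℝ)..Real.pi, a t) (fun Y => by
      have ha0 : 0 ≤ ∫ t in (0 : ℝ)..Real.pi, a t :=
        intervalIntegral.integral_nonneg Real.pi_pos.le fun t _ => h.nonneg t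
      refine (ContinuousMap.norm_le _ (mul_nonneg ha0 (norm_nonneg _))).2 fun x => ?_
      change ‖∫ t in (0 : ℝ)..x, A t (extend Y t)‖ ≤ _
      have hs := IsPrimitive.subset x.2
      calc _ ≤ ∫ t in (0 : ℝ)..x, a t * ‖Y‖ :=
            intervalIntegral.norm_integral_le_of_norm_le x.2.1
              (Eventually.of_forall fun t _ => (ContinuousLinearMap.le_opNorm _ _).trans
                (mul_le_mul (h.bound t) (norm_extend_le Y t) (norm_nonneg _) (h.nonneg t)))
              ((h.integrable.mono_set hs).mul_const _)
        _ = (∫ t in (0 : ℝ)..x, a t) * ‖Y‖ := intervalIntegral.integral_mul_const _ _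
        _ ≤ _ := by
            gcongr
            exact intervalIntegral.integral_mono_interval le_rfl x.2.1 x.2.2
              (Eventually.of_forall h.nonneg) h.integrable)

theorem volterra_apply (h : IsKernel A a) (Y : Curve E) (x : Icc (0 : ℝ) Real.pi) :
    h.volterra Y x = ∫ t in (0 : ℝ)..x, A t (extend Y t) := rfl

theorem extend_volterra (h : IsKernel A a) (Y : Curve E) {x : ℝ} (hx : x ∈ Icc 0 Real.pi) :
    extend (h.volterra Y) x = ∫ t in (0 : ℝ)..x, A t (extend Y t) := by
  rw [extend, IccExtend_of_mem _ _ hx, volterra_apply]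

/-- The power rule for the primitive of `a`. It is the source of the factorial in the bounds for
iterated Volterra operators. -/
theorem integral_mul_pow (ha : IntervalIntegrable a volume 0 Real.pi) (n : ℕ) {x : ℝ}
    (hx : x ∈ Icc 0 Real.pi) :
    ∫ t in (0 : ℝ)..x, a t * (∫ s in (0 : ℝ)..t, a s) ^ n =
      (∫ s in (0 : ℝ)..x, a s) ^ (n + 1) / (n + 1) := by
  have h1 : IsPrimitive (fun x => ((∫ s in (0 : ℝ)..x, a s : ℝ) : ℂ)) (fun x => (a x : ℂ)) :=
    ⟨intervalIntegrable_ofReal ha, fun x _ => by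
      rw [intervalIntegral.integral_ofReal]; simp⟩
  have h2 := (h1.pow n).eq x hx
  simp only [intervalIntegral.integral_same, Complex.ofReal_zero, ne_eq, Nat.succ_ne_zero,
    not_false_eq_true, zero_pow, zero_add] at h2
  have h3 : (∫ t in (0 : ℝ)..x, ((n : ℂ) + 1) * ((∫ s in (0 : ℝ)..t, a s : ℝ) : ℂ) ^ n * (a t : ℂ))
      = ((n + 1) * ∫ t in (0 : ℝ)..x, a t * (∫ s in (0 : ℝ)..t, a s) ^ n : ℝ) := by
    rw [Complex.ofReal_mul, ← intervalIntegral.integral_ofReal,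
      ← intervalIntegral.integral_const_mul]
    congr 1
    funext t
    push_cast
    ring
  rw [h3] at h2
  have h4 : (∫ s in (0 : ℝ)..x, a s) ^ (n + 1) =
      (n + 1) * ∫ t in (0 : ℝ)..x, a t * (∫ s in (0 : ℝ)..t, a s) ^ n := by exact_mod_cast h2
  rw [h4]
  field_simp

/-- Each application of the operator integrates the previous bound against `a`, and
`integral_mul_pow` evaluates the integral. The induction needs the bound pointwise in `x`; a bound
by the norm over `[0, π]` would lose the factorial. -/
theorem norm_volterra_pow_apply_le (h : IsKernel A a) (n : ℕ) (Y : Curve E)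
    (x : Icc (0 : ℝ) Real.pi) :
    ‖(h.volterra ^ n) Y x‖ ≤ ‖Y‖ * ((∫ t in (0 : ℝ)..x, a t) ^ n / n.factorial) := by
  induction n generalizing x with
  | zero => simpa using Y.norm_coe_le_norm x
  | succ n ih =>
    rw [pow_succ']
    change ‖∫ t in (0 : ℝ)..x, A t (extend ((h.volterra ^ n) Y) t)‖ ≤ _
    have hs := IsPrimitive.subset x.2
    have hc : ContinuousOn (fun t => ∫ s in (0 : ℝ)..t, a s) (uIcc 0 (x : ℝ)) :=
      intervalIntegral.continuousOn_primitive_interval' (h.integrable.mono_set hs) left_mem_uIcc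
    calc _ ≤ ∫ t in (0 : ℝ)..x, (‖Y‖ / n.factorial) * (a t * (∫ s in (0 : ℝ)..t, a s) ^ n) := by
          refine intervalIntegral.norm_integral_le_of_norm_le x.2.1
            (Eventually.of_forall fun t ht => ?_)
            (((h.integrable.mono_set hs).mul_continuousOn (hc.pow n)).const_mul _)
          have ht' : t ∈ Icc 0 Real.pi := ⟨ht.1.le, ht.2.trans x.2.2⟩
          refine (ContinuousLinearMap.le_opNorm _ _).trans ?_
          rw [extend, IccExtend_of_mem _ _ ht']
          calc _ ≤ a t * (‖Y‖ * ((∫ s in (0 : ℝ)..t, a s) ^ n / n.factorial)) :=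
                mul_le_mul (h.bound t) (ih ⟨t, ht'⟩) (norm_nonneg _) (h.nonneg t)
            _ = _ := by ring
      _ = ‖Y‖ / n.factorial * ((∫ s in (0 : ℝ)..x, a s) ^ (n + 1) / (n + 1)) := by
          rw [intervalIntegral.integral_const_mul, integral_mul_pow h.integrable n x.2]
      _ = _ := by
          rw [Nat.factorial_succ]
          push_cast
          field_simp

theorem norm_volterra_pow_le (h : IsKernel A a) (n : ℕ) :
    ‖h.volterra ^ n‖ ≤ (∫ t in (0 : ℝ)..Real.pi, a t) ^ n / n.factorial := by
  have ha0 : 0 ≤ ∫ t in (0 : ℝ)..Real.pi, a t :=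
    intervalIntegral.integral_nonneg Real.pi_pos.le fun t _ => h.nonneg t
  refine ContinuousLinearMap.opNorm_le_bound _ (by positivity) fun Y => ?_
  refine (ContinuousMap.norm_le _ (by positivity)).2 fun x => ?_
  refine (h.norm_volterra_pow_apply_le n Y x).trans ?_
  rw [mul_comm]
  have h0 : 0 ≤ ∫ t in (0 : ℝ)..x, a t :=
    intervalIntegral.integral_nonneg x.2.1 fun t _ => h.nonneg t
  have h1 : ∫ t in (0 : ℝ)..x, a t ≤ ∫ t in (0 : ℝ)..Real.pi, a t :=
    intervalIntegral.integral_mono_interval le_rfl x.2.1 x.2.2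
      (Eventually.of_forall h.nonneg) h.integrable
  gcongr

theorem summable_volterra_pow (h : IsKernel A a) : Summable fun n => ‖h.volterra ^ n‖ :=
  Summable.of_nonneg_of_le (fun n => norm_nonneg (h.volterra ^ n)) h.norm_volterra_pow_le
    (Real.summable_pow_div_factorial _)

end IsKernel

namespace IsKernel

variable {A : ℝ → E →L[ℂ] E} {a : ℝ → ℝ}

theorem extend_zero (h : IsKernel A a) {Y : Curve E} {Y₀ : Curve E} (hY : Y = Y₀ + h.volterra Y) :
    extend Y 0 = extend Y₀ 0 := by
  have h0 : (0 : ℝ) ∈ Icc 0 Real.pi := left_mem_Icc.2 Real.pi_pos.le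
  have h1 := congrArg (fun Z : Curve E => Z ⟨0, h0⟩) hY
  rw [extend, extend, IccExtend_of_mem _ _ h0, IccExtend_of_mem _ _ h0]
  refine h1.trans ?_
  simp [volterra_apply]

theorem extend_eq (h : IsKernel A a) {Y : Curve E} {Y₀ : Curve E} (hY : Y = Y₀ + h.volterra Y)
    {x : ℝ} (hx : x ∈ Icc 0 Real.pi) :
    extend Y x = extend Y₀ x + ∫ t in (0 : ℝ)..x, A t (extend Y t) := by
  rw [← extend_volterra h Y hx, extend, extend, extend, IccExtend_of_mem _ _ hx,
    IccExtend_of_mem _ _ hx, IccExtend_of_mem _ _ hx]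
  exact congrArg (fun Z : Curve E => Z ⟨x, hx⟩) hY

end IsKernel

variable [CompleteSpace E]

/-- `1 - a ^ n` is the product of `1 - a` and a geometric sum commuting with it, and commuting
factors of a unit are units. A single small power is therefore enough. -/
theorem isUnit_one_sub_of_norm_pow_lt_one {R : Type*} [NormedRing R] [HasSummableGeomSeries R]
    (a : R) (n : ℕ) (h : ‖a ^ n‖ < 1) : IsUnit (1 - a) := by
  have h1 : IsUnit (1 - a ^ n) := isUnit_one_sub_of_norm_lt_one h
  have h2 : (1 - a) * ∑ i ∈ Finset.range n, a ^ i = 1 - a ^ n := mul_neg_geom_sum a n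
  have h3 : Commute (1 - a) (∑ i ∈ Finset.range n, a ^ i) :=
    Commute.sum_right _ _ _ fun i _ => ((Commute.one_left _).sub_left ((Commute.refl a).pow_right i))
  rw [← h2] at h1
  exact (h3.isUnit_mul_iff.1 h1).1

theorem IsKernel.isUnit_one_sub_volterra {A : ℝ → E →L[ℂ] E} {a : ℝ → ℝ} (h : IsKernel A a) :
    IsUnit (1 - h.volterra) := by
  have h1 := h.summable_volterra_pow.tendsto_atTop_zero
  obtain ⟨n, hn⟩ := (h1.eventually_lt_const one_pos).exists
  exact isUnit_one_sub_of_norm_pow_lt_one (R := Curve E →L[ℂ] Curve E) h.volterra n hn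

/-- The solution of `Y = Y₀ + K Y` is the sum of the Neumann series. -/
theorem IsKernel.exists_solution {A : ℝ → E →L[ℂ] E} {a : ℝ → ℝ} (h : IsKernel A a)
    (Y₀ : Curve E) :
    ∃ Y : Curve E, Y = Y₀ + h.volterra Y ∧ HasSum (fun n => (h.volterra ^ n) Y₀) Y := by
  have hs : Summable fun n => (h.volterra ^ n) Y₀ :=
    Summable.of_norm_bounded (h.summable_volterra_pow.mul_right ‖Y₀‖)
      fun n => ContinuousLinearMap.le_opNorm _ _
  refine ⟨_, ?_, hs.hasSum⟩
  have h1 := hs.tsum_eq_zero_add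
  rw [h.volterra.map_tsum hs]
  simpa [pow_succ'] using h1

namespace IsKernel

variable {A : ℝ → E →L[ℂ] E} {a : ℝ → ℝ}

theorem eq_of_eq (h : IsKernel A a) {Y Z Y₀ : Curve E} (hY : Y = Y₀ + h.volterra Y)
    (hZ : Z = Y₀ + h.volterra Z) : Y = Z := by
  obtain ⟨u, hu⟩ := h.isUnit_one_sub_volterra
  have h1 : (1 - h.volterra) Y = (1 - h.volterra) Z :=
    (sub_eq_of_eq_add hY).trans (sub_eq_of_eq_add hZ).symm
  rw [← hu] at h1
  have h2 := congrArg (fun W => ((u⁻¹ : (Curve E →L[ℂ] Curve E)ˣ) : Curve E →L[ℂ] Curve E) W) h1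
  simp only [← mul_apply_eq_comp, Units.inv_mul] at h2
  exact h2

/-- A functional passes under the Bochner integral, so a vector equation yields scalar ones to which
the calculus of `IsPrimitive` applies. The functionals used are the coordinates of `ℂ × ℂ` and
Fourier integrals of the components of an `L₂`-valued curve. -/
theorem isPrimitive_volterra (h : IsKernel A a) (Y : Curve E) (L : E →L[ℂ] ℂ) :
    IsPrimitive (fun t => L (extend (h.volterra Y) t)) (fun t => L (A t (extend Y t))) := by
  have hi := h.intervalIntegrable Y
  refine ⟨⟨L.integrable_comp hi.1, L.integrable_comp hi.2⟩, fun x hx => ?_⟩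
  rw [L.intervalIntegral_comp_comm (hi.mono_set (IsPrimitive.subset hx)),
    extend_volterra h Y hx, extend_volterra h Y (left_mem_Icc.2 Real.pi_pos.le)]
  simp

theorem isPrimitive (h : IsKernel A a) {Y : Curve E} {c : E}
    (hY : Y = ContinuousMap.const _ c + h.volterra Y) (L : E →L[ℂ] ℂ) :
    IsPrimitive (fun t => L (extend Y t)) (fun t => L (A t (extend Y t))) := by
  have h1 := ((IsPrimitive.const (L c)).add (h.isPrimitive_volterra Y L)).congr_deriv
    (g' := fun t => L (A t (extend Y t))) fun t _ => zero_add _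
  refine h1.congr_fun fun x hx => ?_
  rw [h.extend_eq hY hx, extend_volterra h Y hx, map_add]
  rfl

end IsKernel

end Volterra

/-! ### Solutions of the first order system -/

section Solutions

variable {σ : ℝ → ℂ}

theorem memLp_Ioc (hσ : MemLp σ 2 (volume.restrict (Ioo 0 Real.pi))) :
    MemLp σ 2 (volume.restrict (Ioc 0 Real.pi)) := by
  rwa [restrict_Ioo_eq_restrict_Ioc] at hσ

theorem intervalIntegrable_potential (hσ : MemLp σ 2 (volume.restrict (Ioo 0 Real.pi))) :
    IntervalIntegrable σ volume 0 Real.pi := by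
  rw [intervalIntegrable_iff_integrableOn_Ioc_of_le Real.pi_pos.le]
  exact (memLp_Ioc hσ).integrable one_le_two

theorem intervalIntegrable_potential_sq (hσ : MemLp σ 2 (volume.restrict (Ioo 0 Real.pi))) :
    IntervalIntegrable (fun t => σ t ^ 2) volume 0 Real.pi := by
  rw [intervalIntegrable_iff_integrableOn_Ioc_of_le Real.pi_pos.le]
  have h := (memLp_Ioc hσ).integrable_norm_pow (p := 2) (by norm_num)
  refine (integrable_norm_iff (((memLp_Ioc hσ).1.pow 2))).1 ?_
  simpa using h

theorem IntervalIntegrable.mul_continuousOn_Icc {f g : ℝ → ℂ}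
    (hf : IntervalIntegrable f volume 0 Real.pi) (hg : ContinuousOn g (Icc 0 Real.pi)) :
    IntervalIntegrable (fun t => f t * g t) volume 0 Real.pi :=
  hf.mul_continuousOn (by rwa [uIcc_of_le Real.pi_pos.le])

theorem intervalIntegrable_of_continuousOn_Icc {g : ℝ → ℂ} (hg : ContinuousOn g (Icc 0 Real.pi)) :
    IntervalIntegrable g volume 0 Real.pi :=
  ContinuousOn.intervalIntegrable (by rwa [uIcc_of_le Real.pi_pos.le])

/-- The integrability required by `IsPrimitive` is automatic: `σ` and `σ ^ 2` are integrable because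
`σ ∈ L₂`, and the two solution components are continuous. -/
theorem isSolution_iff (hσ : MemLp σ 2 (volume.restrict (Ioo 0 Real.pi))) {lam : ℂ}
    {y yq : ℝ → ℂ} : IsSolution σ lam y yq ↔
      IsPrimitive y (fun t => yq t + σ t * y t) ∧
      IsPrimitive yq (fun t => -(σ t * yq t + σ t ^ 2 * y t + lam * y t)) := by
  constructor
  · intro h
    have h1 := IntervalIntegrable.mul_continuousOn_Icc (intervalIntegrable_potential hσ)
      h.continuousOn
    have h2 := IntervalIntegrable.mul_continuousOn_Icc (intervalIntegrable_potential hσ)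
      h.continuousOn_quasi
    have h3 := IntervalIntegrable.mul_continuousOn_Icc (intervalIntegrable_potential_sq hσ)
      h.continuousOn
    refine ⟨⟨(intervalIntegrable_of_continuousOn_Icc h.continuousOn_quasi).add h1,
      h.eq_integral⟩, ⟨((h2.add h3).add
        ((intervalIntegrable_of_continuousOn_Icc h.continuousOn).const_mul lam)).neg,
      fun x hx => ?_⟩⟩
    rw [intervalIntegral.integral_neg, ← sub_eq_add_neg]
    exact h.quasi_eq_integral x hx
  · rintro ⟨h1, h2⟩
    refine ⟨h1.continuousOn, h2.continuousOn, h1.eq, fun x hx => ?_⟩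
    rw [h2.eq x hx, intervalIntegral.integral_neg, ← sub_eq_add_neg]

theorem IsSolution.linear_combination (hσ : MemLp σ 2 (volume.restrict (Ioo 0 Real.pi)))
    {lam : ℂ} {y yq z zq : ℝ → ℂ} (hy : IsSolution σ lam y yq) (hz : IsSolution σ lam z zq)
    (a b : ℂ) :
    IsSolution σ lam (fun x => a * y x + b * z x) (fun x => a * yq x + b * zq x) := by
  rw [isSolution_iff hσ] at *
  refine ⟨((hy.1.const_mul a).add (hz.1.const_mul b)).congr_deriv fun x _ => by ring,
    ((hy.2.const_mul a).add (hz.2.const_mul b)).congr_deriv fun x _ => by ring⟩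

/-- The Lagrange identity. -/
theorem IsSolution.wronskian (hσ : MemLp σ 2 (volume.restrict (Ioo 0 Real.pi)))
    {lam mu : ℂ} {y yq z zq : ℝ → ℂ} (hy : IsSolution σ lam y yq) (hz : IsSolution σ mu z zq)
    {x : ℝ} (hx : x ∈ Icc 0 Real.pi) :
    y x * zq x - yq x * z x = y 0 * zq 0 - yq 0 * z 0 +
      (lam - mu) * ∫ t in (0 : ℝ)..x, y t * z t := by
  rw [isSolution_iff hσ] at hy hz
  have h := (((hy.1.mul hz.2).sub (hy.2.mul hz.1)).congr_deriv
    (g' := fun t => (lam - mu) * (y t * z t)) fun t _ => by ring).eq x hx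
  rw [intervalIntegral.integral_const_mul] at h
  exact h

/-- The coefficients of the first order system. -/
def systemMatrix (σ : ℝ → ℂ) (lam : ℂ) (t : ℝ) : ℂ × ℂ →L[ℂ] ℂ × ℂ :=
  (σ t • ContinuousLinearMap.fst ℂ ℂ ℂ + ContinuousLinearMap.snd ℂ ℂ ℂ).prod
    (-(σ t • ContinuousLinearMap.snd ℂ ℂ ℂ + (σ t ^ 2 + lam) • ContinuousLinearMap.fst ℂ ℂ ℂ))

theorem systemMatrix_apply (lam : ℂ) (t : ℝ) (c : ℂ × ℂ) : systemMatrix σ lam t c =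
    (σ t * c.1 + c.2, -(σ t * c.2 + (σ t ^ 2 + lam) * c.1)) := rfl

/-- The derivative of the coefficients with respect to the spectral parameter. -/
def parameterMatrix : ℂ × ℂ →L[ℂ] ℂ × ℂ :=
  (0 : ℂ × ℂ →L[ℂ] ℂ).prod (-ContinuousLinearMap.fst ℂ ℂ ℂ)

theorem isKernel_systemMatrix (hσ : MemLp σ 2 (volume.restrict (Ioo 0 Real.pi))) (lam : ℂ) :
    IsKernel (systemMatrix σ lam) (fun t => 1 + ‖σ t‖ + (‖σ t ^ 2‖ + ‖lam‖)) where
  measurable Y := by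
    have hm := (memLp_Ioc hσ).1
    have h1 : AEStronglyMeasurable (fun t => (extend Y t).1) (volume.restrict (Ioc 0 Real.pi)) :=
      (continuous_fst.comp (continuous_extend Y)).aestronglyMeasurable
    have h2 : AEStronglyMeasurable (fun t => (extend Y t).2) (volume.restrict (Ioc 0 Real.pi)) :=
      (continuous_snd.comp (continuous_extend Y)).aestronglyMeasurable
    simp only [systemMatrix_apply]
    exact ((hm.mul h1).add h2).prodMk
      (((hm.mul h2).add (((hm.pow 2).add aestronglyMeasurable_const).mul h1)).neg)
  bound t := by
    refine ContinuousLinearMap.opNorm_le_bound _ (by positivity) fun c => ?_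
    have h1 : ‖c.1‖ ≤ ‖c‖ := norm_fst_le c
    have h2 : ‖c.2‖ ≤ ‖c‖ := norm_snd_le c
    rw [systemMatrix_apply]
    refine max_le ?_ ?_
    · calc ‖σ t * c.1 + c.2‖ ≤ ‖σ t‖ * ‖c.1‖ + ‖c.2‖ := (norm_add_le _ _).trans (by rw [norm_mul])
        _ ≤ ‖σ t‖ * ‖c‖ + ‖c‖ + (‖σ t ^ 2‖ + ‖lam‖) * ‖c‖ :=
            (by gcongr : _ ≤ ‖σ t‖ * ‖c‖ + ‖c‖).trans (le_add_of_nonneg_right (by positivity))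
        _ = _ := by ring
    · calc ‖-(σ t * c.2 + (σ t ^ 2 + lam) * c.1)‖
          ≤ ‖σ t‖ * ‖c.2‖ + (‖σ t ^ 2‖ + ‖lam‖) * ‖c.1‖ := by
            rw [norm_neg]
            refine (norm_add_le _ _).trans ?_
            rw [norm_mul, norm_mul]
            gcongr
            exact norm_add_le _ _
        _ ≤ ‖σ t‖ * ‖c‖ + (‖σ t ^ 2‖ + ‖lam‖) * ‖c‖ + ‖c‖ :=
            (by gcongr : _ ≤ ‖σ t‖ * ‖c‖ + (‖σ t ^ 2‖ + ‖lam‖) * ‖c‖).trans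
              (le_add_of_nonneg_right (norm_nonneg _))
        _ = _ := by ring
  integrable := by
    exact (intervalIntegrable_const.add (intervalIntegrable_potential hσ).norm).add
      ((intervalIntegrable_potential_sq hσ).norm.add intervalIntegrable_const)

theorem isKernel_parameterMatrix :
    IsKernel (fun _ => parameterMatrix) (fun _ => ‖parameterMatrix‖) where
  measurable Y := (parameterMatrix.continuous.comp (continuous_extend Y)).aestronglyMeasurable
  bound _ := le_rfl
  integrable := intervalIntegrable_const

/-- The spectral parameter enters the system affinely. Therefore `1 - K` is a holomorphic family of
invertible operators, and so is its inverse. -/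
theorem volterra_systemMatrix (hσ : MemLp σ 2 (volume.restrict (Ioo 0 Real.pi))) (lam : ℂ) :
    (isKernel_systemMatrix hσ lam).volterra = (isKernel_systemMatrix hσ 0).volterra +
      lam • isKernel_parameterMatrix.volterra := by
  ext1 Y
  refine ContinuousMap.ext fun x => ?_
  have hs := IsPrimitive.subset x.2
  change (∫ t in (0 : ℝ)..x, systemMatrix σ lam t (extend Y t)) =
    (∫ t in (0 : ℝ)..x, systemMatrix σ 0 t (extend Y t)) +
      lam • ∫ t in (0 : ℝ)..x, parameterMatrix (extend Y t)
  have hp : IntervalIntegrable (fun t => lam • parameterMatrix (extend Y t)) volume 0 x :=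
    ((isKernel_parameterMatrix.intervalIntegrable Y).mono_set hs).smul lam
  rw [← intervalIntegral.integral_smul, ← intervalIntegral.integral_add
    (((isKernel_systemMatrix hσ 0).intervalIntegrable Y).mono_set hs) hp]
  congr 1
  funext t
  ext
  · simp [systemMatrix_apply, parameterMatrix]
  · simp [systemMatrix_apply, parameterMatrix]
    ring

theorem isSolution_of_eq (hσ : MemLp σ 2 (volume.restrict (Ioo 0 Real.pi))) {lam : ℂ}
    {Y : Curve (ℂ × ℂ)} {c : ℂ × ℂ}
    (h : Y = ContinuousMap.const _ c + (isKernel_systemMatrix hσ lam).volterra Y) :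
    IsSolution σ lam (fun t => (extend Y t).1) (fun t => (extend Y t).2) ∧ extend Y 0 = c := by
  have h1 := IsKernel.isPrimitive (isKernel_systemMatrix hσ lam) h
  have h0 := IsKernel.extend_zero (isKernel_systemMatrix hσ lam) h
  exact ⟨(isSolution_iff hσ).2
    ⟨(h1 (ContinuousLinearMap.fst ℂ ℂ ℂ)).congr_deriv fun t _ => by
        simp [systemMatrix_apply]; ring,
      (h1 (ContinuousLinearMap.snd ℂ ℂ ℂ)).congr_deriv fun t _ => by
        simp [systemMatrix_apply]; ring⟩, h0⟩

/-- Converse to `isSolution_of_eq`; it reduces uniqueness for the initial value problem to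
uniqueness for the Volterra equation. -/
theorem IsSolution.exists_curve (hσ : MemLp σ 2 (volume.restrict (Ioo 0 Real.pi))) {lam : ℂ}
    {y yq : ℝ → ℂ} (h : IsSolution σ lam y yq) :
    ∃ Y : Curve (ℂ × ℂ), (∀ x ∈ Icc 0 Real.pi, extend Y x = (y x, yq x)) ∧
      Y = ContinuousMap.const _ (y 0, yq 0) + (isKernel_systemMatrix hσ lam).volterra Y := by
  let Y : Curve (ℂ × ℂ) := ⟨fun x => (y x, yq x), by
    exact (continuousOn_iff_continuous_domRestrict.1 h.continuousOn).prodMk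
      (continuousOn_iff_continuous_domRestrict.1 h.continuousOn_quasi)⟩
  have hY : ∀ x ∈ Icc 0 Real.pi, extend Y x = (y x, yq x) := fun x hx => by
    rw [extend, IccExtend_of_mem _ _ hx]; rfl
  refine ⟨Y, hY, ContinuousMap.ext fun x => ?_⟩
  have hi := ((isKernel_systemMatrix hσ lam).intervalIntegrable Y).mono_set
    (IsPrimitive.subset x.2)
  obtain ⟨h1, h2⟩ := (isSolution_iff hσ).1 h
  change (y x, yq x) = (y 0, yq 0) + ∫ t in (0 : ℝ)..x, systemMatrix σ lam t (extend Y t)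
  have e : ∀ t ∈ uIcc 0 (x : ℝ), extend Y t = (y t, yq t) := fun t ht => by
    rw [uIcc_of_le x.2.1] at ht
    exact hY t ⟨ht.1, ht.2.trans x.2.2⟩
  ext
  · have h3 := (ContinuousLinearMap.fst ℂ ℂ ℂ).intervalIntegral_comp_comm hi
    change y x = y 0 + (∫ t in (0 : ℝ)..x, systemMatrix σ lam t (extend Y t)).1
    rw [h1.eq x x.2]
    congr 1
    refine Eq.trans ?_ h3
    refine intervalIntegral.integral_congr fun t ht => ?_
    simp only [e t ht, systemMatrix_apply, ContinuousLinearMap.coe_fst']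
    ring
  · have h3 := (ContinuousLinearMap.snd ℂ ℂ ℂ).intervalIntegral_comp_comm hi
    change yq x = yq 0 + (∫ t in (0 : ℝ)..x, systemMatrix σ lam t (extend Y t)).2
    rw [h2.eq x x.2]
    congr 1
    refine Eq.trans ?_ h3
    refine intervalIntegral.integral_congr fun t ht => ?_
    simp only [e t ht, systemMatrix_apply, ContinuousLinearMap.coe_snd']
    ring

theorem IsSolution.unique (hσ : MemLp σ 2 (volume.restrict (Ioo 0 Real.pi))) {lam : ℂ}
    {y yq z zq : ℝ → ℂ} (hy : IsSolution σ lam y yq) (hz : IsSolution σ lam z zq)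
    (h0 : y 0 = z 0) (h1 : yq 0 = zq 0) {x : ℝ} (hx : x ∈ Icc 0 Real.pi) :
    y x = z x ∧ yq x = zq x := by
  obtain ⟨Y, hY, eY⟩ := hy.exists_curve hσ
  obtain ⟨Z, hZ, eZ⟩ := hz.exists_curve hσ
  rw [h0, h1] at eY
  have h := IsKernel.eq_of_eq _ eY eZ
  have h2 := hY x hx
  rw [h, hZ x hx] at h2
  exact ⟨congrArg Prod.fst h2.symm, congrArg Prod.snd h2.symm⟩

theorem differentiable_inverse_one_sub {V : Type*} [NormedAddCommGroup V] [NormedSpace ℂ V]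
    [CompleteSpace V] (K₀ K₁ : V →L[ℂ] V) (h : ∀ lam : ℂ, IsUnit (1 - (K₀ + lam • K₁))) (Y : V) :
    Differentiable ℂ fun lam : ℂ => Ring.inverse (1 - (K₀ + lam • K₁)) Y := by
  intro lam
  have h1 : DifferentiableAt ℂ (fun lam : ℂ => 1 - (K₀ + lam • K₁)) lam := by fun_prop
  have h2 := differentiableAt_inverse (𝕜 := ℂ) (h lam)
  exact (DifferentiableAt.comp lam h2 h1).clm_apply (differentiableAt_const Y)

/-- The solutions with fixed initial data at `0` are entire functions of the spectral
parameter. -/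
theorem exists_entire_solution (hσ : MemLp σ 2 (volume.restrict (Ioo 0 Real.pi))) (c : ℂ × ℂ) :
    ∃ Y : ℂ → Curve (ℂ × ℂ), Differentiable ℂ Y ∧ ∀ lam,
      IsSolution σ lam (fun t => (extend (Y lam) t).1) (fun t => (extend (Y lam) t).2) ∧
        extend (Y lam) 0 = c := by
  let K : ℂ → (Curve (ℂ × ℂ) →L[ℂ] Curve (ℂ × ℂ)) := fun lam =>
    1 - (isKernel_systemMatrix hσ lam).volterra
  have hK : ∀ lam, IsUnit (K lam) := fun lam => (isKernel_systemMatrix hσ lam).isUnit_one_sub_volterra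
  have hd2 : ∀ Y, Differentiable ℂ fun lam => Ring.inverse (K lam) Y := by
    have h1 : K = fun lam => 1 - ((isKernel_systemMatrix hσ 0).volterra +
        lam • isKernel_parameterMatrix.volterra) := by
      funext lam
      simp only [K, volterra_systemMatrix hσ lam]
    rw [h1] at hK ⊢
    exact differentiable_inverse_one_sub _ _ hK
  refine ⟨fun lam => Ring.inverse (K lam) (ContinuousMap.const _ c),
    hd2 _, fun lam => isSolution_of_eq hσ ?_⟩
  have h1 : K lam (Ring.inverse (K lam) (ContinuousMap.const _ c)) = ContinuousMap.const _ c := by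
    rw [← mul_apply_eq_comp, Ring.mul_inverse_cancel _ (hK lam)]
    rfl
  exact eq_add_of_sub_eq h1

/-! ### The fundamental system -/

/-- The solution `S(·, lam)` with `S(0) = 0`, `S^{[1]}(0) = 1` and its quasi-derivative. -/
def sinSol (σ : ℝ → ℂ) (lam : ℂ) : (ℝ → ℂ) × (ℝ → ℂ) := initialSolution σ lam 0 0 1

theorem initialSolution_spec {lam : ℂ} {a : ℝ} {c d : ℂ}
    (h : ∃ y yq, IsSolution σ lam y yq ∧ y a = c ∧ yq a = d) :
    IsSolution σ lam (initialSolution σ lam a c d).1 (initialSolution σ lam a c d).2 ∧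
      (initialSolution σ lam a c d).1 a = c ∧ (initialSolution σ lam a c d).2 a = d := by
  obtain ⟨y, yq, h⟩ := h
  exact Classical.epsilon_spec (p := fun Y : (ℝ → ℂ) × (ℝ → ℂ) =>
    IsSolution σ lam Y.1 Y.2 ∧ Y.1 a = c ∧ Y.2 a = d) ⟨(y, yq), h⟩

theorem initialSolution_zero_spec (hσ : MemLp σ 2 (volume.restrict (Ioo 0 Real.pi))) (lam c d : ℂ) :
    IsSolution σ lam (initialSolution σ lam 0 c d).1 (initialSolution σ lam 0 c d).2 ∧
      (initialSolution σ lam 0 c d).1 0 = c ∧ (initialSolution σ lam 0 c d).2 0 = d := by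
  obtain ⟨Y, -, hY⟩ := exists_entire_solution hσ (c, d)
  refine initialSolution_spec ⟨_, _, (hY lam).1, ?_, ?_⟩
  · exact congrArg Prod.fst (hY lam).2
  · exact congrArg Prod.snd (hY lam).2

theorem phi_spec (hσ : MemLp σ 2 (volume.restrict (Ioo 0 Real.pi))) (lam : ℂ) :
    IsSolution σ lam (phi σ lam).1 (phi σ lam).2 ∧ (phi σ lam).1 0 = 1 ∧ (phi σ lam).2 0 = 0 :=
  initialSolution_zero_spec hσ lam 1 0

theorem sinSol_spec (hσ : MemLp σ 2 (volume.restrict (Ioo 0 Real.pi))) (lam : ℂ) :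
    IsSolution σ lam (sinSol σ lam).1 (sinSol σ lam).2 ∧
      (sinSol σ lam).1 0 = 0 ∧ (sinSol σ lam).2 0 = 1 :=
  initialSolution_zero_spec hσ lam 0 1

/-- `initialSolution` is chosen separately for each parameter, so holomorphy is not built in.
Uniqueness forces the chosen functions to agree on `[0, π]` with the entire family of
`exists_entire_solution`. -/
theorem exists_entire_initialSolution (hσ : MemLp σ 2 (volume.restrict (Ioo 0 Real.pi))) (c d : ℂ) :
    ∃ Y : ℂ → Curve (ℂ × ℂ), Differentiable ℂ Y ∧ ∀ lam, ∀ x ∈ Icc 0 Real.pi,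
      extend (Y lam) x = ((initialSolution σ lam 0 c d).1 x, (initialSolution σ lam 0 c d).2 x) := by
  obtain ⟨Y, hd, hY⟩ := exists_entire_solution hσ (c, d)
  refine ⟨Y, hd, fun lam x hx => ?_⟩
  obtain ⟨h1, h2, h3⟩ := initialSolution_zero_spec hσ lam c d
  have h := (hY lam).1.unique hσ h1 (by rw [(hY lam).2, h2]) (by rw [(hY lam).2, h3]) hx
  exact Prod.ext h.1 h.2

theorem differentiable_extend_apply {Y : ℂ → Curve (ℂ × ℂ)} (hY : Differentiable ℂ Y) (x : ℝ) :
    Differentiable ℂ fun lam => extend (Y lam) x :=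
  (ContinuousMap.evalCLM ℂ (M := ℂ × ℂ)
    (projIcc 0 Real.pi Real.pi_pos.le x)).differentiable.comp hY

theorem differentiable_initialSolution (hσ : MemLp σ 2 (volume.restrict (Ioo 0 Real.pi)))
    (c d : ℂ) {x : ℝ} (hx : x ∈ Icc 0 Real.pi) :
    Differentiable ℂ (fun lam => (initialSolution σ lam 0 c d).1 x) ∧
      Differentiable ℂ fun lam => (initialSolution σ lam 0 c d).2 x := by
  obtain ⟨Y, hd, hY⟩ := exists_entire_initialSolution hσ c d
  have h := differentiable_extend_apply hd x
  have e1 : (fun lam => (initialSolution σ lam 0 c d).1 x) = fun lam => (extend (Y lam) x).1 := by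
    funext lam; rw [hY lam x hx]
  have e2 : (fun lam => (initialSolution σ lam 0 c d).2 x) = fun lam => (extend (Y lam) x).2 := by
    funext lam; rw [hY lam x hx]
  rw [e1, e2]
  exact ⟨h.fst, h.snd⟩

theorem wronskian_phi_sinSol (hσ : MemLp σ 2 (volume.restrict (Ioo 0 Real.pi))) (lam : ℂ) {x : ℝ}
    (hx : x ∈ Icc 0 Real.pi) :
    (phi σ lam).1 x * (sinSol σ lam).2 x - (phi σ lam).2 x * (sinSol σ lam).1 x = 1 := by
  have h := (phi_spec hσ lam).1.wronskian hσ (sinSol_spec hσ lam).1 hx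
  rw [(phi_spec hσ lam).2.1, (phi_spec hσ lam).2.2, (sinSol_spec hσ lam).2.1,
    (sinSol_spec hσ lam).2.2] at h
  simpa using h

theorem IsSolution.eq_fundamental (hσ : MemLp σ 2 (volume.restrict (Ioo 0 Real.pi))) {lam : ℂ}
    {y yq : ℝ → ℂ} (hy : IsSolution σ lam y yq) {x : ℝ} (hx : x ∈ Icc 0 Real.pi) :
    y x = y 0 * (phi σ lam).1 x + yq 0 * (sinSol σ lam).1 x ∧
      yq x = y 0 * (phi σ lam).2 x + yq 0 * (sinSol σ lam).2 x := by
  have h := (phi_spec hσ lam).1.linear_combination hσ (sinSol_spec hσ lam).1 (y 0) (yq 0)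
  refine hy.unique hσ h ?_ ?_ hx
  · simp [(phi_spec hσ lam).2.1, (sinSol_spec hσ lam).2.1]
  · simp [(phi_spec hσ lam).2.2, (sinSol_spec hσ lam).2.2]

theorem pi_mem : Real.pi ∈ Icc 0 Real.pi := right_mem_Icc.2 Real.pi_pos.le

/-- Initial data at `0` of a solution in terms of the data at `π`. -/
theorem IsSolution.initial_of_terminal (hσ : MemLp σ 2 (volume.restrict (Ioo 0 Real.pi))) {lam : ℂ}
    {y yq : ℝ → ℂ} (hy : IsSolution σ lam y yq) :
    y 0 = y Real.pi * (sinSol σ lam).2 Real.pi - yq Real.pi * (sinSol σ lam).1 Real.pi ∧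
      yq 0 = yq Real.pi * (phi σ lam).1 Real.pi - y Real.pi * (phi σ lam).2 Real.pi := by
  obtain ⟨h1, h2⟩ := hy.eq_fundamental hσ pi_mem
  have h3 := wronskian_phi_sinSol hσ lam pi_mem
  rw [h1, h2]
  constructor
  · linear_combination (-y 0) * h3
  · linear_combination (-yq 0) * h3

theorem psi_spec (hσ : MemLp σ 2 (volume.restrict (Ioo 0 Real.pi))) (r₁ r₂ : ℂ[X]) (lam : ℂ) :
    IsSolution σ lam (psi σ r₁ r₂ lam).1 (psi σ r₁ r₂ lam).2 ∧
      (psi σ r₁ r₂ lam).1 Real.pi = r₁.eval lam ∧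
      (psi σ r₁ r₂ lam).2 Real.pi = -(r₂.eval lam) := by
  have h3 := wronskian_phi_sinSol hσ lam pi_mem
  refine initialSolution_spec ⟨_, _, (phi_spec hσ lam).1.linear_combination hσ (sinSol_spec hσ lam).1
    (r₁.eval lam * (sinSol σ lam).2 Real.pi + r₂.eval lam * (sinSol σ lam).1 Real.pi)
    (-(r₂.eval lam) * (phi σ lam).1 Real.pi - r₁.eval lam * (phi σ lam).2 Real.pi), ?_, ?_⟩
  · linear_combination (r₁.eval lam) * h3
  · linear_combination (-r₂.eval lam) * h3

/-- The value `ψ(0, lam)`, the numerator of the Weyl function. -/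
def weylNum (σ : ℝ → ℂ) (r₁ r₂ : ℂ[X]) (lam : ℂ) : ℂ :=
  r₁.eval lam * (sinSol σ lam).2 Real.pi + r₂.eval lam * (sinSol σ lam).1 Real.pi

theorem psi_zero (hσ : MemLp σ 2 (volume.restrict (Ioo 0 Real.pi))) (r₁ r₂ : ℂ[X]) (lam : ℂ) :
    (psi σ r₁ r₂ lam).1 0 = weylNum σ r₁ r₂ lam ∧
      (psi σ r₁ r₂ lam).2 0 = -charFun σ r₁ r₂ lam := by
  obtain ⟨h, h1, h2⟩ := psi_spec hσ r₁ r₂ lam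
  obtain ⟨h3, h4⟩ := h.initial_of_terminal hσ
  rw [h3, h4, h1, h2, weylNum, charFun]
  constructor <;> ring

theorem weyl_eq (hσ : MemLp σ 2 (volume.restrict (Ioo 0 Real.pi))) (r₁ r₂ : ℂ[X]) (lam : ℂ) :
    weyl σ r₁ r₂ lam = -(weylNum σ r₁ r₂ lam / charFun σ r₁ r₂ lam) := by
  rw [weyl, (psi_zero hσ r₁ r₂ lam).1, (psi_zero hσ r₁ r₂ lam).2, div_neg]

theorem differentiable_charFun (hσ : MemLp σ 2 (volume.restrict (Ioo 0 Real.pi))) (r₁ r₂ : ℂ[X]) :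
    Differentiable ℂ (charFun σ r₁ r₂) := by
  have h := differentiable_initialSolution hσ 1 0 pi_mem
  exact (r₁.differentiable.mul h.2).add (r₂.differentiable.mul h.1)

theorem differentiable_weylNum (hσ : MemLp σ 2 (volume.restrict (Ioo 0 Real.pi))) (r₁ r₂ : ℂ[X]) :
    Differentiable ℂ (weylNum σ r₁ r₂) := by
  have h := differentiable_initialSolution hσ 0 1 pi_mem
  exact (r₁.differentiable.mul h.2).add (r₂.differentiable.mul h.1)

/-- A form of the Wronskian identity at `π`. At a zero of `charFun` the last term drops out and the
numerator of the Weyl function is determined by `φ(π)`; the asymptotics of the `α n` rest on this.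
-/
theorem weylNum_mul_phi (hσ : MemLp σ 2 (volume.restrict (Ioo 0 Real.pi))) (r₁ r₂ : ℂ[X]) (lam : ℂ) :
    weylNum σ r₁ r₂ lam * (phi σ lam).1 Real.pi =
      r₁.eval lam + (sinSol σ lam).1 Real.pi * charFun σ r₁ r₂ lam := by
  have h3 := wronskian_phi_sinSol hσ lam pi_mem
  rw [weylNum, charFun]
  linear_combination (r₁.eval lam) * h3

/-! ### Reflection of the interval. -/

theorem reflect_integral (f : ℝ → ℂ) (hf : IntervalIntegrable f volume 0 Real.pi) {x : ℝ}
    (hx : x ∈ Icc 0 Real.pi) : ∫ t in (0 : ℝ)..x, f (Real.pi - t) =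
      (∫ t in (0 : ℝ)..Real.pi, f t) - ∫ t in (0 : ℝ)..(Real.pi - x), f t := by
  rw [intervalIntegral.integral_comp_sub_left, sub_zero]
  have hx' : Real.pi - x ∈ Icc 0 Real.pi := ⟨by linarith [hx.2], by linarith [hx.1]⟩
  rw [intervalIntegral.integral_interval_sub_left hf (hf.mono_set (IsPrimitive.subset hx'))]

theorem IsPrimitive.reflect {f f' : ℝ → ℂ} (h : IsPrimitive f f') :
    IsPrimitive (fun t => f (Real.pi - t)) (fun t => -f' (Real.pi - t)) where
  integrable := by
    have h1 := (h.integrable.comp_sub_left Real.pi).symm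
    simp only [sub_zero, sub_self] at h1
    exact h1.neg
  eq x hx := by
    have hx' : Real.pi - x ∈ Icc 0 Real.pi := ⟨by linarith [hx.2], by linarith [hx.1]⟩
    rw [intervalIntegral.integral_neg, reflect_integral f' h.integrable hx, h.eq _ hx', sub_zero,
      h.eq _ pi_mem]
    ring

/-- The potential of the reflected equation. -/
def reflectPotential (σ : ℝ → ℂ) (t : ℝ) : ℂ := -σ (Real.pi - t)

theorem memLp_reflectPotential (hσ : MemLp σ 2 (volume.restrict (Ioo 0 Real.pi))) :
    MemLp (reflectPotential σ) 2 (volume.restrict (Ioo 0 Real.pi)) := by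
  have h1 : MeasurePreserving (fun t : ℝ => Real.pi - t) (volume.restrict (Ioo 0 Real.pi))
      (volume.restrict (Ioo 0 Real.pi)) := by
    have h2 := (Measure.measurePreserving_sub_left (volume : Measure ℝ) Real.pi).restrict_preimage
      (s := Ioo 0 Real.pi) measurableSet_Ioo
    simpa using h2
  exact (hσ.comp_measurePreserving h1).neg

theorem IsSolution.reflect (hσ : MemLp σ 2 (volume.restrict (Ioo 0 Real.pi))) {lam : ℂ}
    {y yq : ℝ → ℂ} (h : IsSolution σ lam y yq) :
    IsSolution (reflectPotential σ) lam (fun t => y (Real.pi - t)) (fun t => -yq (Real.pi - t)) := by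
  rw [isSolution_iff hσ] at h
  rw [isSolution_iff (memLp_reflectPotential hσ)]
  refine ⟨h.1.reflect.congr_deriv fun t _ => ?_,
    ((h.2.reflect.const_mul (-1)).congr_deriv fun t _ => ?_).congr_fun fun t _ => ?_⟩
  · simp only [reflectPotential]; ring
  · simp only [reflectPotential]; ring
  · ring

/-- The reflection `t ↦ π - t` changes the sign of the quasi-derivative and turns the data of `ψ` at
`π` into initial data at `0`. Bounds for `ψ` thus follow from those for the fundamental system of
the reflected potential. -/
theorem psi_eq_reflect (hσ : MemLp σ 2 (volume.restrict (Ioo 0 Real.pi))) (r₁ r₂ : ℂ[X]) (lam : ℂ)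
    {x : ℝ} (hx : x ∈ Icc 0 Real.pi) :
    (psi σ r₁ r₂ lam).1 x = r₁.eval lam * (phi (reflectPotential σ) lam).1 (Real.pi - x) +
        r₂.eval lam * (sinSol (reflectPotential σ) lam).1 (Real.pi - x) ∧
      (psi σ r₁ r₂ lam).2 x = -(r₁.eval lam * (phi (reflectPotential σ) lam).2 (Real.pi - x) +
        r₂.eval lam * (sinSol (reflectPotential σ) lam).2 (Real.pi - x)) := by
  obtain ⟨h, h1, h2⟩ := psi_spec hσ r₁ r₂ lam
  have hx' : Real.pi - x ∈ Icc 0 Real.pi := ⟨by linarith [hx.2], by linarith [hx.1]⟩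
  have h3 := (h.reflect hσ).eq_fundamental (memLp_reflectPotential hσ) hx'
  simp only [sub_zero, sub_sub_cancel, h1, h2, neg_neg] at h3
  exact ⟨h3.1, by rw [← h3.2, neg_neg]⟩

end Solutions

/-! ### Square integrable functions on the line, supports and Fourier integrals -/

section LineL2

/-- The space `L₂(ℝ)`. -/
abbrev LineL2 : Type := Lp ℂ 2 (volume : Measure ℝ)

theorem norm_sq_eq_integral {α : Type*} [MeasurableSpace α] {μ : Measure α} (f : Lp ℂ 2 μ) :
    ‖f‖ ^ 2 = ∫ x, ‖f x‖ ^ 2 ∂μ := by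
  have h := inner_self_eq_norm_sq_to_K (𝕜 := ℂ) f
  rw [L2.inner_def] at h
  have h1 : ∀ x, inner ℂ (f x) (f x) = ((‖f x‖ ^ 2 : ℝ) : ℂ) := fun x => by
    rw [inner_self_eq_norm_sq_to_K]
    push_cast
    rfl
  simp only [h1] at h
  have h3 : ∫ x, ((‖f x‖ ^ 2 : ℝ) : ℂ) ∂μ = ((∫ x, ‖f x‖ ^ 2 ∂μ : ℝ) : ℂ) := integral_ofReal
  rw [h3] at h
  have h2 : ((∫ x, ‖f x‖ ^ 2 ∂μ : ℝ) : ℂ) = ((‖f‖ ^ 2 : ℝ) : ℂ) := by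
    push_cast
    exact h
  exact_mod_cast h2.symm

/-- The functions that vanish outside of `I`. -/
def supportedIn (I : Set ℝ) : Submodule ℂ LineL2 :=
  LinearMap.ker (LpToLpRestrictCLM ℝ ℂ ℂ volume 2 Iᶜ).toLinearMap

theorem mem_supportedIn {I : Set ℝ} (hI : MeasurableSet I) {f : LineL2} :
    f ∈ supportedIn I ↔ ∀ᵐ s, s ∉ I → f s = 0 := by
  have h1 := LpToLpRestrictCLM_coeFn ℂ (μ := (volume : Measure ℝ)) (p := 2) Iᶜ f
  have h2 : f ∈ supportedIn I ↔ f =ᵐ[volume.restrict Iᶜ] 0 := by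
    rw [supportedIn, LinearMap.mem_ker, ContinuousLinearMap.coe_coe]
    constructor
    · intro h
      rw [h] at h1
      exact h1.symm.trans (Lp.coeFn_zero _ _ _)
    · intro h
      exact (Lp.eq_zero_iff_ae_eq_zero).2 (h1.trans h)
  rw [h2, EventuallyEq, ae_restrict_iff' hI.compl]
  rfl

theorem supportedIn_mono {I J : Set ℝ} (hI : MeasurableSet I) (hJ : MeasurableSet J) (h : I ⊆ J) :
    supportedIn I ≤ supportedIn J := fun f hf => by
  rw [mem_supportedIn hI] at hf
  rw [mem_supportedIn hJ]
  filter_upwards [hf] with s hs hsJ using hs fun h1 => hsJ (h h1)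

theorem isClosed_supportedIn (I : Set ℝ) : IsClosed (supportedIn I : Set LineL2) :=
  (LpToLpRestrictCLM ℝ ℂ ℂ volume 2 Iᶜ).isClosed_ker

theorem integral_mem_supportedIn {I : Set ℝ} {F : ℝ → LineL2} {x : ℝ} (hx : 0 ≤ x)
    (h : ∀ t ∈ Ioc 0 x, F t ∈ supportedIn I) (hi : IntervalIntegrable F volume 0 x) :
    ∫ t in (0 : ℝ)..x, F t ∈ supportedIn I := by
  rw [supportedIn, LinearMap.mem_ker, ContinuousLinearMap.coe_coe,
    ← ContinuousLinearMap.intervalIntegral_comp_comm _ hi]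
  refine intervalIntegral.integral_zero_ae (Eventually.of_forall fun t ht => ?_)
  rw [uIoc_of_le hx] at ht
  exact h t ht

/-- The translation `f ↦ f(· - a)`. -/
def translate (a : ℝ) : LineL2 →ₗᵢ[ℂ] LineL2 :=
  Lp.compMeasurePreservingₗᵢ ℂ (fun s => s - a) (measurePreserving_sub_right volume a)

theorem translate_ae (a : ℝ) (f : LineL2) : translate a f =ᵐ[volume] fun s => f (s - a) :=
  Lp.coeFn_compMeasurePreserving f (measurePreserving_sub_right volume a)

theorem continuous_translate {Z : Type*} [TopologicalSpace Z] {a : Z → ℝ} {f : Z → LineL2}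
    (ha : Continuous a) (hf : Continuous f) : Continuous fun z => translate (a z) (f z) := by
  let F : Z → C(ℝ, ℝ) := fun z => ⟨fun s => s - a z, by fun_prop⟩
  have hF : Continuous F := ContinuousMap.continuous_of_continuous_uncurry _ (by
    change Continuous fun p : Z × ℝ => p.2 - a p.1
    fun_prop)
  exact hf.compMeasurePreservingLp hF (fun z => measurePreserving_sub_right volume (a z))
    (by norm_num)

theorem translate_mem {I J : Set ℝ} (hI : MeasurableSet I) (hJ : MeasurableSet J) {a : ℝ}
    (h : ∀ s, s - a ∈ I → s ∈ J) {f : LineL2} (hf : f ∈ supportedIn I) :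
    translate a f ∈ supportedIn J := by
  rw [mem_supportedIn hI] at hf
  rw [mem_supportedIn hJ]
  have h1 := (measurePreserving_sub_right volume a).quasiMeasurePreserving.ae hf
  filter_upwards [h1, translate_ae a f] with s h2 h3 hs
  rw [h3]
  exact h2 fun h4 => hs (h s h4)

/-- The reflection `f ↦ f(-·)`. -/
def mirror : LineL2 →ₗᵢ[ℂ] LineL2 :=
  Lp.compMeasurePreservingₗᵢ ℂ (fun s => -s) (Measure.measurePreserving_neg volume)

theorem mirror_ae (f : LineL2) : mirror f =ᵐ[volume] fun s => f (-s) :=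
  Lp.coeFn_compMeasurePreserving f (Measure.measurePreserving_neg volume)

theorem mirror_mem {I J : Set ℝ} (hI : MeasurableSet I) (hJ : MeasurableSet J)
    (h : ∀ s, -s ∈ I → s ∈ J) {f : LineL2} (hf : f ∈ supportedIn I) :
    mirror f ∈ supportedIn J := by
  rw [mem_supportedIn hI] at hf
  rw [mem_supportedIn hJ]
  have h1 := (Measure.measurePreserving_neg volume).quasiMeasurePreserving.ae hf
  filter_upwards [h1, mirror_ae f] with s h2 h3 hs
  rw [h3]
  exact h2 fun h4 => hs (h s h4)

/-- The restriction of `h` to the interval `(0, x]`. -/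
def cutoff (h : LineL2) (x : ℝ) : LineL2 :=
  ((Lp.memLp h).indicator (measurableSet_Ioc (a := (0 : ℝ)) (b := x))).toLp _

theorem cutoff_ae (h : LineL2) (x : ℝ) : cutoff h x =ᵐ[volume] (Ioc 0 x).indicator h :=
  MemLp.coeFn_toLp _

theorem cutoff_mem (h : LineL2) (x : ℝ) : cutoff h x ∈ supportedIn (Icc 0 x) := by
  rw [mem_supportedIn measurableSet_Icc]
  filter_upwards [cutoff_ae h x] with s hs hsx
  rw [hs, indicator_of_notMem fun h1 => hsx (Ioc_subset_Icc_self h1)]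

theorem integrable_norm_sq {α : Type*} [MeasurableSpace α] {μ : Measure α} (f : Lp ℂ 2 μ) :
    Integrable (fun x => ‖f x‖ ^ 2) μ :=
  (memLp_two_iff_integrable_sq_norm (Lp.memLp f).1).1 (Lp.memLp f)

theorem norm_cutoff_sub_sq (h : LineL2) {x y : ℝ} (hx : 0 ≤ x) (hxy : x ≤ y) :
    ‖cutoff h y - cutoff h x‖ ^ 2 =
      (∫ s in (0 : ℝ)..y, ‖h s‖ ^ 2) - ∫ s in (0 : ℝ)..x, ‖h s‖ ^ 2 := by
  have hi : ∀ a b, IntervalIntegrable (fun s => ‖h s‖ ^ 2) volume a b := fun a b =>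
    (integrable_norm_sq h).intervalIntegrable
  rw [norm_sq_eq_integral, intervalIntegral.integral_interval_sub_left (hi _ _) (hi _ _),
    intervalIntegral.integral_of_le hxy, ← integral_indicator measurableSet_Ioc]
  refine integral_congr_ae ?_
  filter_upwards [Lp.coeFn_sub (cutoff h y) (cutoff h x), cutoff_ae h x, cutoff_ae h y]
    with s h1 h2 h3
  rw [h1, Pi.sub_apply, h2, h3]
  by_cases ha : s ∈ Ioc 0 x
  · have hb : s ∈ Ioc 0 y := ⟨ha.1, ha.2.trans hxy⟩
    have hc : s ∉ Ioc x y := fun h => absurd ha.2 (not_le.2 h.1)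
    simp [indicator_of_mem ha, indicator_of_mem hb, indicator_of_notMem hc]
  · by_cases hb : s ∈ Ioc 0 y
    · have hc : s ∈ Ioc x y := ⟨not_le.1 fun h => ha ⟨hb.1, h⟩, hb.2⟩
      simp [indicator_of_notMem ha, indicator_of_mem hb, indicator_of_mem hc]
    · have hc : s ∉ Ioc x y := fun h => hb ⟨hx.trans_lt h.1, h.2⟩
      simp [indicator_of_notMem ha, indicator_of_notMem hb, indicator_of_notMem hc]

theorem continuousOn_cutoff (h : LineL2) : ContinuousOn (cutoff h) (Ici 0) := by
  have hi : ∀ a b, IntervalIntegrable (fun s => ‖h s‖ ^ 2) volume a b := fun a b =>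
    (integrable_norm_sq h).intervalIntegrable
  set Φ : ℝ → ℝ := fun x => ∫ s in (0 : ℝ)..x, ‖h s‖ ^ 2
  have hΦ : Continuous Φ := intervalIntegral.continuous_primitive hi 0
  have hd : ∀ x ∈ Ici (0 : ℝ), ∀ y ∈ Ici (0 : ℝ), ‖cutoff h y - cutoff h x‖ = √|Φ y - Φ x| := by
    intro x hx y hy
    rcases le_total x y with hxy | hxy
    · rw [eq_comm, Real.sqrt_eq_iff_mul_self_eq (abs_nonneg _) (norm_nonneg _), ← sq,
        norm_cutoff_sub_sq h hx hxy, abs_of_nonneg]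
      rw [← norm_cutoff_sub_sq h hx hxy]
      positivity
    · rw [norm_sub_rev, abs_sub_comm, eq_comm,
        Real.sqrt_eq_iff_mul_self_eq (abs_nonneg _) (norm_nonneg _), ← sq,
        norm_cutoff_sub_sq h hy hxy, abs_of_nonneg]
      rw [← norm_cutoff_sub_sq h hy hxy]
      positivity
  intro x hx
  rw [ContinuousWithinAt, tendsto_iff_norm_sub_tendsto_zero]
  have h1 : Tendsto (fun y => √|Φ y - Φ x|) (𝓝[Ici 0] x) (𝓝 0) := by
    have h2 : Continuous fun y => √|Φ y - Φ x| := by fun_prop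
    have h3 := h2.tendsto x
    simp only [sub_self, abs_zero, Real.sqrt_zero] at h3
    exact h3.mono_left nhdsWithin_le_nhds
  refine h1.congr' ?_
  filter_upwards [self_mem_nhdsWithin] with y hy using (hd x hx y hy).symm

theorem memLp_Icc_of_continuous {f : ℝ → ℂ} (hf : Continuous f) (a b : ℝ) :
    MemLp f 2 (volume.restrict (Icc a b)) := by
  rw [memLp_two_iff_integrable_sq_norm hf.aestronglyMeasurable]
  exact (Continuous.continuousOn (by fun_prop)).integrableOn_compact isCompact_Icc

/-- The window `[-10, 10]` contains all supports that occur, which lie in `[-2π, 2π]`. The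
conjugation compensates for the conjugate-linearity of the inner product in its first argument. -/
theorem memLp_expKernel (ρ : ℂ) :
    MemLp ((Icc (-10 : ℝ) 10).indicator fun s : ℝ => conj (Complex.exp (Complex.I * ρ * s))) 2
      (volume : Measure ℝ) := by
  have hc : Continuous fun s : ℝ => conj (Complex.exp (Complex.I * ρ * s)) := by fun_prop
  rw [memLp_indicator_iff_restrict measurableSet_Icc]
  exact memLp_Icc_of_continuous hc _ _

/-- The Fourier integral `f ↦ ∫ f(s) exp(iρs) ds` over the window `[-10, 10]`. -/
def fourierInt (ρ : ℂ) : LineL2 →L[ℂ] ℂ := innerSL ℂ (memLp_expKernel ρ).toLp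

theorem fourierInt_window (ρ : ℂ) (f : LineL2) :
    fourierInt ρ f = ∫ s in Icc (-10 : ℝ) 10, f s * Complex.exp (Complex.I * ρ * s) := by
  change inner ℂ (memLp_expKernel ρ).toLp f = _
  rw [L2.inner_def, ← integral_indicator measurableSet_Icc]
  refine integral_congr_ae ?_
  filter_upwards [(memLp_expKernel ρ).coeFn_toLp] with s hs
  rw [hs]
  by_cases h : s ∈ Icc (-10 : ℝ) 10
  · simp [indicator_of_mem h, -mem_Icc]
  · simp [indicator_of_notMem h]

theorem fourierInt_eq_integral (ρ : ℂ) {I : Set ℝ} (hI : MeasurableSet I)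
    (hI' : I ⊆ Icc (-10) 10) {f : LineL2} (hf : f ∈ supportedIn I) :
    fourierInt ρ f = ∫ s, f s * Complex.exp (Complex.I * ρ * s) := by
  rw [fourierInt_window]
  refine setIntegral_eq_integral_of_ae_compl_eq_zero ?_
  filter_upwards [(mem_supportedIn hI).1 hf] with s hs h
  rw [hs fun h1 => h (hI' h1), zero_mul]

theorem fourierInt_eq_setIntegral (ρ : ℂ) {I : Set ℝ} (hI : MeasurableSet I)
    (hI' : I ⊆ Icc (-10) 10) {f : LineL2} (hf : f ∈ supportedIn I) :
    fourierInt ρ f = ∫ s in I, f s * Complex.exp (Complex.I * ρ * s) := by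
  rw [fourierInt_eq_integral ρ hI hI' hf, eq_comm]
  refine setIntegral_eq_integral_of_ae_compl_eq_zero ?_
  filter_upwards [(mem_supportedIn hI).1 hf] with s hs h
  rw [hs h, zero_mul]

/-- A translation becomes multiplication by an exponential. Both supports have to lie in the window,
which otherwise truncates the integral. -/
theorem fourierInt_translate (ρ : ℂ) {I J : Set ℝ} (hI : MeasurableSet I) (hJ : MeasurableSet J)
    (hI' : I ⊆ Icc (-10) 10) (hJ' : J ⊆ Icc (-10) 10) {a : ℝ} (h : ∀ s, s - a ∈ I → s ∈ J)
    {f : LineL2} (hf : f ∈ supportedIn I) :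
    fourierInt ρ (translate a f) = Complex.exp (Complex.I * ρ * a) * fourierInt ρ f := by
  rw [fourierInt_eq_integral ρ hJ hJ' (translate_mem hI hJ h hf),
    fourierInt_eq_integral ρ hI hI' hf, ← integral_const_mul,
    ← integral_sub_right_eq_self (fun s => Complex.exp (Complex.I * ρ * a) *
      (f s * Complex.exp (Complex.I * ρ * s))) a]
  refine integral_congr_ae ?_
  filter_upwards [translate_ae a f] with s hs
  rw [hs]
  rw [mul_left_comm, ← Complex.exp_add]
  congr 2
  push_cast
  ring

theorem fourierInt_mirror (ρ : ℂ) (f : LineL2) : fourierInt ρ (mirror f) = fourierInt (-ρ) f := by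
  rw [fourierInt_window, fourierInt_window, ← integral_indicator measurableSet_Icc,
    ← integral_indicator measurableSet_Icc, ← integral_neg_eq_self]
  refine integral_congr_ae ?_
  have h1 := (Measure.measurePreserving_neg volume).quasiMeasurePreserving.ae (mirror_ae f)
  filter_upwards [h1] with s hs
  have h2 : -s ∈ Icc (-10 : ℝ) 10 ↔ s ∈ Icc (-10 : ℝ) 10 := by
    constructor <;> intro h <;> exact ⟨by linarith [h.2], by linarith [h.1]⟩
  by_cases h : s ∈ Icc (-10 : ℝ) 10
  · rw [indicator_of_mem (h2.2 h), indicator_of_mem h, hs, neg_neg]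
    congr 2
    push_cast
    ring
  · rw [indicator_of_notMem fun h3 => h (h2.1 h3), indicator_of_notMem h]

theorem fourierInt_cutoff (ρ : ℂ) (h : LineL2) {x : ℝ} (hx : 0 ≤ x) (hx' : x ≤ 10) :
    fourierInt ρ (cutoff h x) = ∫ s in (0 : ℝ)..x, h s * Complex.exp (Complex.I * ρ * s) := by
  have hs : Icc 0 x ⊆ Icc (-10 : ℝ) 10 := Icc_subset_Icc (by norm_num) hx'
  rw [fourierInt_eq_setIntegral ρ measurableSet_Icc hs (cutoff_mem h x),
    integral_Icc_eq_integral_Ioc, intervalIntegral.integral_of_le hx]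
  refine setIntegral_congr_ae measurableSet_Ioc ?_
  filter_upwards [cutoff_ae h x] with s h1 h2
  rw [h1, indicator_of_mem h2]

theorem norm_exp_le {ρ : ℂ} {s a : ℝ} (hs : s ∈ Icc (-a) a) :
    ‖Complex.exp (Complex.I * ρ * s)‖ ≤ Real.exp (|ρ.im| * a) := by
  rw [Complex.norm_exp]
  have h1 : (Complex.I * ρ * s).re = -(ρ.im * s) := by simp
  rw [h1]
  refine Real.exp_le_exp.2 ?_
  have h2 : |s| ≤ a := abs_le.2 hs
  calc -(ρ.im * s) ≤ |ρ.im * s| := neg_le_abs _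
    _ = |ρ.im| * |s| := abs_mul _ _
    _ ≤ _ := by gcongr

/-- The Fourier integral of a function supported in `[-a, a]`. -/
theorem norm_fourierInt_le (ρ : ℂ) {a : ℝ} (ha : 0 ≤ a) (ha' : a ≤ 10) {f : LineL2}
    (hf : f ∈ supportedIn (Icc (-a) a)) :
    ‖fourierInt ρ f‖ ≤ 5 * Real.exp (|ρ.im| * a) * ‖f‖ := by
  have hs : Icc (-a) a ⊆ Icc (-10 : ℝ) 10 := Icc_subset_Icc (by linarith) ha'
  have hc : Continuous fun s : ℝ => conj (Complex.exp (Complex.I * ρ * s)) := by fun_prop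
  have hm : MemLp ((Icc (-a) a).indicator fun s : ℝ => conj (Complex.exp (Complex.I * ρ * s))) 2
      (volume : Measure ℝ) := by
    rw [memLp_indicator_iff_restrict measurableSet_Icc]
    exact memLp_Icc_of_continuous hc _ _
  have h1 : fourierInt ρ f = inner ℂ hm.toLp f := by
    rw [fourierInt_eq_setIntegral ρ measurableSet_Icc hs hf, L2.inner_def,
      ← integral_indicator measurableSet_Icc]
    refine integral_congr_ae ?_
    filter_upwards [hm.coeFn_toLp] with s hs
    rw [hs]
    by_cases h : s ∈ Icc (-a) a
    · simp [indicator_of_mem h, -mem_Icc]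
    · simp [indicator_of_notMem h]
  rw [h1]
  refine (norm_inner_le_norm _ _).trans ?_
  gcongr
  refine abs_le_of_sq_le_sq' ?_ (by positivity) |>.2
  rw [norm_sq_eq_integral]
  calc ∫ s, ‖hm.toLp _ s‖ ^ 2 = ∫ s in Icc (-a) a, ‖Complex.exp (Complex.I * ρ * s)‖ ^ 2 := by
        rw [← integral_indicator measurableSet_Icc]
        refine integral_congr_ae ?_
        filter_upwards [hm.coeFn_toLp] with s hs
        rw [hs]
        by_cases h : s ∈ Icc (-a) a
        · simp [indicator_of_mem h, -mem_Icc]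
        · simp [indicator_of_notMem h]
    _ ≤ ∫ s in Icc (-a) a, Real.exp (|ρ.im| * a) ^ 2 := by
        refine setIntegral_mono_on ?_ ?_ measurableSet_Icc fun s hs => ?_
        · exact (Continuous.continuousOn (by fun_prop)).integrableOn_compact isCompact_Icc
        · exact integrableOn_const (by simp)
        · have := norm_exp_le (ρ := ρ) hs
          gcongr
    _ = 2 * a * Real.exp (|ρ.im| * a) ^ 2 := by
        rw [setIntegral_const]
        simp [measureReal_def]
        rw [ENNReal.toReal_ofReal (by linarith)]
        ring
    -- The constant: `a ≤ 10` gives `2 * a ≤ 20 ≤ 5 ^ 2`.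
    _ ≤ _ := by
        rw [mul_pow]
        gcongr
        linarith

end LineL2

/-! ### Transformation operators -/

section Transformation

variable {σ : ℝ → ℂ}

/-- Coefficients of the system for the amplitudes of the two travelling waves and the regularised
solution. -/
def transferMatrix (σ : ℝ → ℂ) (t : ℝ) :
    LineL2 × LineL2 × LineL2 →L[ℂ] LineL2 × LineL2 × LineL2 :=
  let U := ContinuousLinearMap.fst ℂ LineL2 (LineL2 × LineL2)
  let W := (ContinuousLinearMap.fst ℂ LineL2 LineL2).comp
    (ContinuousLinearMap.snd ℂ LineL2 (LineL2 × LineL2))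
  let V := (ContinuousLinearMap.snd ℂ LineL2 LineL2).comp
    (ContinuousLinearMap.snd ℂ LineL2 (LineL2 × LineL2))
  let T := fun a : ℝ => (translate a).toContinuousLinearMap
  (σ t • (T (2 * t)).comp W - (Complex.I * σ t ^ 2) • (T t).comp V).prod
    ((σ t • (T (-(2 * t))).comp U + (Complex.I * σ t ^ 2) • (T (-t)).comp V).prod
      (σ t • V + (1 / (2 * Complex.I)) • ((T (-t)).comp U - (T t).comp W)))

theorem transferMatrix_apply (t : ℝ) (F : LineL2 × LineL2 × LineL2) :
    transferMatrix σ t F =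
      (σ t • translate (2 * t) F.2.1 - (Complex.I * σ t ^ 2) • translate t F.2.2,
        σ t • translate (-(2 * t)) F.1 + (Complex.I * σ t ^ 2) • translate (-t) F.2.2,
        σ t • F.2.2 + (1 / (2 * Complex.I)) • (translate (-t) F.1 - translate t F.2.1)) := rfl

theorem isKernel_transferMatrix (hσ : MemLp σ 2 (volume.restrict (Ioo 0 Real.pi))) :
    IsKernel (transferMatrix σ) (fun t => 1 + ‖σ t‖ + ‖σ t ^ 2‖) where
  measurable Y := by
    have hm := (memLp_Ioc hσ).1
    have hm2 : AEStronglyMeasurable (fun t => Complex.I * σ t ^ 2)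
      (volume.restrict (Ioc 0 Real.pi)) := (hm.pow 2).const_mul _
    have h := continuous_extend Y
    have h1 : Continuous fun t => (extend Y t).1 := continuous_fst.comp h
    have h2 : Continuous fun t => (extend Y t).2.1 := (continuous_fst.comp continuous_snd).comp h
    have h3 : Continuous fun t => (extend Y t).2.2 := (continuous_snd.comp continuous_snd).comp h
    have c1 := continuous_translate (a := fun t : ℝ => 2 * t) (by fun_prop) h2
    have c2 := continuous_translate (a := fun t : ℝ => t) (by fun_prop) h3
    have c3 := continuous_translate (a := fun t : ℝ => -(2 * t)) (by fun_prop) h1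
    have c4 := continuous_translate (a := fun t : ℝ => -t) (by fun_prop) h3
    have c5 := continuous_translate (a := fun t : ℝ => -t) (by fun_prop) h1
    have c6 := continuous_translate (a := fun t : ℝ => t) (by fun_prop) h2
    simp only [transferMatrix_apply]
    exact ((hm.smul c1.aestronglyMeasurable).sub (hm2.smul c2.aestronglyMeasurable)).prodMk
      (((hm.smul c3.aestronglyMeasurable).add (hm2.smul c4.aestronglyMeasurable)).prodMk
        ((hm.smul h3.aestronglyMeasurable).add
          (((c5.sub c6).const_smul (1 / (2 * Complex.I))).aestronglyMeasurable)))
  bound t := by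
    refine ContinuousLinearMap.opNorm_le_bound _ (by positivity) fun F => ?_
    have h1 : ‖F.1‖ ≤ ‖F‖ := norm_fst_le F
    have h2 : ‖F.2.1‖ ≤ ‖F‖ := (norm_fst_le F.2).trans (norm_snd_le F)
    have h3 : ‖F.2.2‖ ≤ ‖F‖ := (norm_snd_le F.2).trans (norm_snd_le F)
    have h0 := norm_nonneg F
    have e : (1 + ‖σ t‖ + ‖σ t ^ 2‖) * ‖F‖ = ‖σ t‖ * ‖F‖ + ‖σ t ^ 2‖ * ‖F‖ + ‖F‖ := by ring
    have hI : ‖Complex.I * σ t ^ 2‖ = ‖σ t ^ 2‖ := by simp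
    rw [transferMatrix_apply, e]
    refine max_le ?_ (max_le ?_ ?_)
    · calc _ ≤ ‖σ t‖ * ‖F.2.1‖ + ‖σ t ^ 2‖ * ‖F.2.2‖ := by
            refine (norm_sub_le _ _).trans ?_
            rw [norm_smul, norm_smul, hI, LinearIsometry.norm_map, LinearIsometry.norm_map]
        _ ≤ ‖σ t‖ * ‖F‖ + ‖σ t ^ 2‖ * ‖F‖ := by gcongr
        _ ≤ _ := le_add_of_nonneg_right h0
    · calc _ ≤ ‖σ t‖ * ‖F.1‖ + ‖σ t ^ 2‖ * ‖F.2.2‖ := by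
            refine (norm_add_le _ _).trans ?_
            rw [norm_smul, norm_smul, hI, LinearIsometry.norm_map, LinearIsometry.norm_map]
        _ ≤ ‖σ t‖ * ‖F‖ + ‖σ t ^ 2‖ * ‖F‖ := by gcongr
        _ ≤ _ := le_add_of_nonneg_right h0
    · calc _ ≤ ‖σ t‖ * ‖F.2.2‖ + 1 / 2 * (‖F.1‖ + ‖F.2.1‖) := by
            refine (norm_add_le _ _).trans ?_
            have h4 : ‖(1 / (2 * Complex.I) : ℂ)‖ = 1 / 2 := by simp
            rw [norm_smul, norm_smul, h4]
            gcongr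
            refine (norm_sub_le _ _).trans ?_
            rw [LinearIsometry.norm_map, LinearIsometry.norm_map]
        _ ≤ ‖σ t‖ * ‖F‖ + 1 / 2 * (‖F‖ + ‖F‖) := by gcongr
        _ ≤ _ := by nlinarith [mul_nonneg (norm_nonneg (σ t ^ 2)) h0]
  integrable := (intervalIntegrable_const.add (intervalIntegrable_potential hσ).norm).add
    (intervalIntegrable_potential_sq hσ).norm

/-- The domain of dependence of the three components. -/
def dependenceDomain (x : ℝ) : Submodule ℂ (LineL2 × LineL2 × LineL2) :=
  (supportedIn (Icc 0 (2 * x))).prod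
    ((supportedIn (Icc (-(2 * x)) 0)).prod (supportedIn (Icc (-x) x)))

theorem isClosed_dependenceDomain (x : ℝ) :
    IsClosed (dependenceDomain x : Set (LineL2 × LineL2 × LineL2)) := by
  rw [dependenceDomain, Submodule.prod_coe, Submodule.prod_coe]
  exact (isClosed_supportedIn _).prod ((isClosed_supportedIn _).prod (isClosed_supportedIn _))

/-- Finite speed of propagation: the shifts by `±t` and `±2t` carry the supports at time `t` into
one another, for instance `[-2t, 0] + 2t = [0, 2t]` and `[-t, t] + t = [0, 2t]`, and the domains
grow with time. -/
theorem transferMatrix_mem {t x : ℝ} (ht : t ≤ x) {F : LineL2 × LineL2 × LineL2}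
    (hF : F ∈ dependenceDomain t) : transferMatrix σ t F ∈ dependenceDomain x := by
  obtain ⟨h1, h2, h3⟩ := hF
  have m := fun a b : ℝ => measurableSet_Icc (a := a) (b := b)
  rw [transferMatrix_apply]
  refine ⟨Submodule.sub_mem _ (Submodule.smul_mem _ _ (translate_mem (m _ _) (m _ _) ?_ h2))
      (Submodule.smul_mem _ _ (translate_mem (m _ _) (m _ _) ?_ h3)),
    Submodule.add_mem _ (Submodule.smul_mem _ _ (translate_mem (m _ _) (m _ _) ?_ h1))
      (Submodule.smul_mem _ _ (translate_mem (m _ _) (m _ _) ?_ h3)),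
    Submodule.add_mem _ (Submodule.smul_mem _ _ (supportedIn_mono (m _ _) (m _ _) ?_ h3))
      (Submodule.smul_mem _ _ (Submodule.sub_mem _ (translate_mem (m _ _) (m _ _) ?_ h1)
        (translate_mem (m _ _) (m _ _) ?_ h2)))⟩ <;>
  · intro s hs
    have h4 := hs.1
    have h5 := hs.2
    constructor <;> linarith

theorem volterra_mem_dependenceDomain (hσ : MemLp σ 2 (volume.restrict (Ioo 0 Real.pi)))
    {Y : Curve (LineL2 × LineL2 × LineL2)} (hY : ∀ x : Icc (0 : ℝ) Real.pi, Y x ∈ dependenceDomain x)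
    (x : Icc (0 : ℝ) Real.pi) : (isKernel_transferMatrix hσ).volterra Y x ∈ dependenceDomain x := by
  have hi := ((isKernel_transferMatrix hσ).intervalIntegrable Y).mono_set (IsPrimitive.subset x.2)
  have h : ∀ t ∈ Ioc 0 (x : ℝ), transferMatrix σ t (extend Y t) ∈ dependenceDomain x := by
    intro t ht
    refine transferMatrix_mem ht.2 ?_
    have ht' : t ∈ Icc 0 Real.pi := ⟨ht.1.le, ht.2.trans x.2.2⟩
    rw [extend, IccExtend_of_mem _ _ ht']
    exact hY ⟨t, ht'⟩
  rw [IsKernel.volterra_apply]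
  set G := fun t => transferMatrix σ t (extend Y t)
  have e1 := (ContinuousLinearMap.fst ℂ LineL2 (LineL2 × LineL2)).intervalIntegral_comp_comm hi
  have e2 := ((ContinuousLinearMap.fst ℂ LineL2 LineL2).comp
    (ContinuousLinearMap.snd ℂ LineL2 (LineL2 × LineL2))).intervalIntegral_comp_comm hi
  have e3 := ((ContinuousLinearMap.snd ℂ LineL2 LineL2).comp
    (ContinuousLinearMap.snd ℂ LineL2 (LineL2 × LineL2))).intervalIntegral_comp_comm hi
  refine ⟨?_, ?_, ?_⟩
  · refine Eq.subst (motive := fun z => z ∈ supportedIn _) e1 ?_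
    exact integral_mem_supportedIn x.2.1 (fun t ht => (h t ht).1) ⟨hi.1.fst, hi.2.fst⟩
  · refine Eq.subst (motive := fun z => z ∈ supportedIn _) e2 ?_
    exact integral_mem_supportedIn x.2.1 (fun t ht => (h t ht).2.1) ⟨hi.1.snd.fst, hi.2.snd.fst⟩
  · refine Eq.subst (motive := fun z => z ∈ supportedIn _) e3 ?_
    exact integral_mem_supportedIn x.2.1 (fun t ht => (h t ht).2.2) ⟨hi.1.snd.snd, hi.2.snd.snd⟩

/-- All terms of the Neumann series respect the domain of dependence, and at each `x` this domain is
a closed subspace, so the sum respects it too. -/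
theorem exists_supported_solution (hσ : MemLp σ 2 (volume.restrict (Ioo 0 Real.pi)))
    {Y₀ : Curve (LineL2 × LineL2 × LineL2)} (h₀ : ∀ x : Icc (0 : ℝ) Real.pi, Y₀ x ∈ dependenceDomain x) :
    ∃ Y : Curve (LineL2 × LineL2 × LineL2),
      Y = Y₀ + (isKernel_transferMatrix hσ).volterra Y ∧ ∀ x : Icc (0 : ℝ) Real.pi, Y x ∈ dependenceDomain x := by
  obtain ⟨Y, hY, hs⟩ := (isKernel_transferMatrix hσ).exists_solution Y₀
  refine ⟨Y, hY, fun x => ?_⟩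
  have h1 : ∀ n, ∀ x : Icc (0 : ℝ) Real.pi,
      ((isKernel_transferMatrix hσ).volterra ^ n) Y₀ x ∈ dependenceDomain x := by
    intro n
    induction n with
    | zero => exact h₀
    | succ n ih =>
      intro x
      rw [pow_succ']
      exact volterra_mem_dependenceDomain hσ ih x
  have h2 : HasSum (fun n => ((isKernel_transferMatrix hσ).volterra ^ n) Y₀ x) (Y x) :=
    hs.mapL (ContinuousMap.evalCLM ℂ (M := LineL2 × LineL2 × LineL2) x)
  exact (isClosed_dependenceDomain x).mem_of_tendsto h2
    (Eventually.of_forall fun s => Submodule.sum_mem _ fun n _ => h1 n x)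

/-- A square integrable function on `(0, π]` as a function on the line. -/
def toLine (g : ℝ → ℂ) (hg : MemLp g 2 (volume.restrict (Ioc 0 Real.pi))) : LineL2 :=
  ((memLp_indicator_iff_restrict measurableSet_Ioc).2 hg).toLp ((Ioc 0 Real.pi).indicator g)

theorem toLine_ae (g : ℝ → ℂ) (hg : MemLp g 2 (volume.restrict (Ioc 0 Real.pi))) :
    toLine g hg =ᵐ[volume] (Ioc 0 Real.pi).indicator g := MemLp.coeFn_toLp _

theorem fourierInt_cutoff_toLine (ρ : ℂ) (g : ℝ → ℂ)
    (hg : MemLp g 2 (volume.restrict (Ioc 0 Real.pi))) {x : ℝ} (hx : x ∈ Icc 0 Real.pi) :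
    fourierInt ρ (cutoff (toLine g hg) x) =
      ∫ t in (0 : ℝ)..x, g t * Complex.exp (Complex.I * ρ * t) := by
  rw [fourierInt_cutoff ρ _ hx.1 (hx.2.trans (by linarith [Real.pi_lt_four]))]
  refine intervalIntegral.integral_congr_ae ?_
  filter_upwards [toLine_ae g hg] with t h1 h2
  rw [uIoc_of_le hx.1] at h2
  have h3 : t ∈ Ioc 0 Real.pi := ⟨h2.1, h2.2.trans hx.2⟩
  rw [h1, indicator_of_mem h3]

theorem memLp_dilate (g : ℝ → ℂ) (hg : MemLp g 2 (volume.restrict (Ioc 0 Real.pi))) :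
    MemLp (fun s => (1 / 2 : ℂ) * (Ioc 0 Real.pi).indicator g (s / 2)) 2 volume := by
  refine MemLp.const_mul ?_ _
  have h1 : MemLp ((Ioc 0 Real.pi).indicator g) 2 volume :=
    (memLp_indicator_iff_restrict measurableSet_Ioc).2 hg
  have h2 : Integrable ((Ioc 0 Real.pi).indicator g) volume :=
    (integrable_indicator_iff measurableSet_Ioc).2 (hg.integrable one_le_two)
  rw [memLp_two_iff_integrable_sq_norm (h2.comp_div two_ne_zero).1]
  exact ((memLp_two_iff_integrable_sq_norm h1.1).1 h1).comp_div two_ne_zero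

/-- The function `s ↦ g(s/2)/2` on the line. -/
def toLineHalf (g : ℝ → ℂ) (hg : MemLp g 2 (volume.restrict (Ioc 0 Real.pi))) : LineL2 :=
  (memLp_dilate g hg).toLp _

theorem fourierInt_cutoff_toLineHalf (ρ : ℂ) (g : ℝ → ℂ)
    (hg : MemLp g 2 (volume.restrict (Ioc 0 Real.pi))) {x : ℝ} (hx : x ∈ Icc 0 Real.pi) :
    fourierInt ρ (cutoff (toLineHalf g hg) (2 * x)) =
      ∫ t in (0 : ℝ)..x, g t * Complex.exp (Complex.I * ρ * ((2 * t : ℝ) : ℂ)) := by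
  rw [fourierInt_cutoff ρ _ (by linarith [hx.1]) (by linarith [hx.2, Real.pi_lt_four])]
  have h1 : ∫ s in (0 : ℝ)..2 * x, toLineHalf g hg s * Complex.exp (Complex.I * ρ * s) =
      ∫ s in (0 : ℝ)..2 * x, (fun t => (1 / 2 : ℂ) * (g t *
        Complex.exp (Complex.I * ρ * ((2 * t : ℝ) : ℂ)))) (s / 2) := by
    refine intervalIntegral.integral_congr_ae ?_
    filter_upwards [(memLp_dilate g hg).coeFn_toLp] with s h1 h2
    rw [uIoc_of_le (by linarith [hx.1])] at h2
    have h3 : s / 2 ∈ Ioc 0 Real.pi := ⟨by linarith [h2.1], by linarith [h2.2, hx.2]⟩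
    change toLineHalf g hg s * _ = _
    rw [toLineHalf, h1, indicator_of_mem h3]
    have h4 : 2 * (s / 2) = s := by ring
    simp only [h4]
    ring
  rw [h1, intervalIntegral.integral_comp_div (f := fun t => (1 / 2 : ℂ) * (g t *
    Complex.exp (Complex.I * ρ * ((2 * t : ℝ) : ℂ)))) two_ne_zero, intervalIntegral.integral_const_mul]
  simp

/-- The exponential `exp(iρa)`. -/
abbrev waveExp (ρ : ℂ) (a : ℝ) : ℂ := Complex.exp (Complex.I * ρ * a)

theorem waveExp_neg_mul (ρ : ℂ) (a : ℝ) : waveExp ρ (-a) * waveExp ρ a = 1 := by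
  rw [waveExp, waveExp, ← Complex.exp_add]
  push_cast
  simp

theorem waveExp_two_mul (ρ : ℂ) (a : ℝ) : waveExp ρ (2 * a) = waveExp ρ a ^ 2 := by
  rw [waveExp, waveExp, ← Complex.exp_nat_mul]
  push_cast
  congr 1
  ring

theorem isPrimitive_waveExp (ρ : ℂ) (c : ℝ) : IsPrimitive (fun t => waveExp ρ (c * t))
    (fun t => Complex.I * ρ * c * waveExp ρ (c * t)) := by
  refine IsPrimitive.of_continuousOn_deriv (fun t => ?_) (by fun_prop)
  have h1 : HasDerivAt (fun t : ℝ => Complex.I * ρ * ((c * t : ℝ) : ℂ)) (Complex.I * ρ * c) t := by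
    have h2 := ((hasDerivAt_id t).const_mul c).ofReal_comp.const_mul (Complex.I * ρ)
    simpa using h2
  exact h1.cexp.congr_deriv (by ring)

/-- The curve `x ↦ h 1_(0, cx]`. -/
def cutoffCurve (h : LineL2) (c : ℝ) (hc : 0 ≤ c) : Curve LineL2 where
  toFun x := cutoff h (c * x)
  continuous_toFun := (continuousOn_cutoff h).comp_continuous (by fun_prop)
    fun x => mul_nonneg hc x.2.1

theorem isPrimitive_of_integral {f f' : ℝ → ℂ} (hi : IntervalIntegrable f' volume 0 Real.pi)
    (h : ∀ x ∈ Icc 0 Real.pi, f x = ∫ t in (0 : ℝ)..x, f' t) : IsPrimitive f f' where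
  integrable := hi
  eq x hx := by
    rw [h x hx, h 0 (left_mem_Icc.2 Real.pi_pos.le), intervalIntegral.integral_same, zero_add]

theorem isPrimitive_source (hσ : MemLp σ 2 (volume.restrict (Ioo 0 Real.pi))) {C : ℝ → ℂ}
    (hC : Continuous C) (hC' : MemLp C 2 (volume.restrict (Ioc 0 Real.pi))) (w₀ ρ : ℂ) :
    IsPrimitive (fun x => fourierInt ρ (w₀ • cutoff (toLineHalf σ (memLp_Ioc hσ)) (2 * x) +
        cutoff (toLine C hC') x))
      (fun t => w₀ * (σ t * waveExp ρ (2 * t)) + C t * waveExp ρ t) := by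
  have i1 : IntervalIntegrable (fun t => σ t * waveExp ρ (2 * t)) volume 0 Real.pi :=
    IntervalIntegrable.mul_continuousOn_Icc (intervalIntegrable_potential hσ)
      (Continuous.continuousOn (by fun_prop))
  have i2 : IntervalIntegrable (fun t => C t * waveExp ρ t) volume 0 Real.pi :=
    Continuous.intervalIntegrable (by fun_prop) _ _
  have p1 : IsPrimitive (fun x => fourierInt ρ (cutoff (toLineHalf σ (memLp_Ioc hσ)) (2 * x)))
      (fun t => σ t * waveExp ρ (2 * t)) :=
    isPrimitive_of_integral i1 fun x hx => fourierInt_cutoff_toLineHalf ρ σ _ hx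
  have p2 : IsPrimitive (fun x => fourierInt ρ (cutoff (toLine C hC') x))
      (fun t => C t * waveExp ρ t) :=
    isPrimitive_of_integral i2 fun x hx => fourierInt_cutoff_toLine ρ C _ hx
  refine ((p1.const_mul w₀).add p2).congr_fun fun x _ => ?_
  simp

/-- In the amplitudes `U = exp(iρx)(y + iz)` and `W = exp(-iρx)(y - iz)` of the two travelling
waves, `ρ` enters the system for `(U, W, v)` only through exponentials `exp(±iρt)` and `exp(±2iρt)`.
These are Fourier images of translations, so the system is the Fourier image of one Volterra
equation in `L₂(ℝ)³` that does not involve `ρ`; its solution supplies the kernels for all `ρ` at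
once. The function `v` is there because of the term with `σ ^ 2`: in both applications `ρ v` equals
`y` up to a function independent of `ρ`, so no division by `ρ` is needed. -/
theorem exists_transformation (hσ : MemLp σ 2 (volume.restrict (Ioo 0 Real.pi))) {C : ℝ → ℂ}
    (hC : Continuous C) (u₀ w₀ : ℂ) :
    ∃ k l m : Curve LineL2, (∀ x : Icc (0 : ℝ) Real.pi, k x ∈ supportedIn (Icc (-x) x) ∧
        l x ∈ supportedIn (Icc (-x) x) ∧ m x ∈ supportedIn (Icc (-x) x)) ∧
      ∀ ρ : ℂ, ∃ y z v : ℝ → ℂ,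
        (∀ x, y x = (u₀ * waveExp ρ (-x) + w₀ * waveExp ρ x) / 2 + fourierInt ρ (extend k x)) ∧
        (∀ x, z x = (u₀ * waveExp ρ (-x) - w₀ * waveExp ρ x) / (2 * Complex.I) +
          fourierInt ρ (extend l x)) ∧
        (∀ x, v x = fourierInt ρ (extend m x)) ∧
        IsPrimitive y (fun t => σ t * y t + C t + ρ * z t) ∧
        IsPrimitive z (fun t => -(σ t * z t) - ρ * y t - σ t ^ 2 * v t) ∧
        IsPrimitive v (fun t => σ t * v t + z t) := by
  have hC' : MemLp C 2 (volume.restrict (Ioc 0 Real.pi)) :=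
    (memLp_Icc_of_continuous hC 0 Real.pi).mono_measure
      (Measure.restrict_mono Ioc_subset_Icc_self le_rfl)
  have h1' : MemLp (fun _ : ℝ => (1 : ℂ)) 2 (volume.restrict (Ioc 0 Real.pi)) := memLp_const _
  set P := cutoffCurve (toLineHalf σ (memLp_Ioc hσ)) 2 zero_le_two with hP
  set Q := cutoffCurve (toLine C hC') 1 zero_le_one with hQ
  set R := cutoffCurve (toLine _ h1') 1 zero_le_one with hR
  -- The initial amplitudes `u₀` and `w₀` would be point masses, which are not in `L₂(ℝ)`. They are
  -- split off, and `Y₀` collects what they and `C` contribute. The factor `exp(2iρt)` turns `σ`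
  -- into the dilate `s ↦ σ(s/2)/2`, and `mirror` replaces `ρ` by `-ρ`.
  let Y₀ : Curve (LineL2 × LineL2 × LineL2) :=
    ⟨fun x => (w₀ • P x + Q x, mirror (u₀ • P x + Q x),
      (1 / (2 * Complex.I)) • (u₀ • mirror (R x) - w₀ • R x)), by
      have := mirror.continuous
      fun_prop⟩
  have m := fun a b : ℝ => measurableSet_Icc (a := a) (b := b)
  have sP : ∀ x : Icc (0 : ℝ) Real.pi, P x ∈ supportedIn (Icc 0 (2 * x)) := fun x => cutoff_mem _ _
  have sQ : ∀ x : Icc (0 : ℝ) Real.pi, Q x ∈ supportedIn (Icc 0 (2 * x)) := fun x =>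
    supportedIn_mono (m _ _) (m _ _) (Icc_subset_Icc_right (by linarith [x.2.1])) (cutoff_mem _ _)
  have sR : ∀ x : Icc (0 : ℝ) Real.pi, R x ∈ supportedIn (Icc (-x) x) := fun x =>
    supportedIn_mono (m _ _) (m _ _) (Icc_subset_Icc (by linarith [x.2.1]) (by linarith))
      (cutoff_mem _ _)
  have hY₀ : ∀ x : Icc (0 : ℝ) Real.pi, Y₀ x ∈ dependenceDomain x := fun x =>
    ⟨Submodule.add_mem _ (Submodule.smul_mem _ _ (sP x)) (sQ x),
      mirror_mem (m _ _) (m _ _) (fun s hs => ⟨by linarith [hs.2], by linarith [hs.1]⟩)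
        (Submodule.add_mem _ (Submodule.smul_mem _ _ (sP x)) (sQ x)),
      Submodule.smul_mem _ _ (Submodule.sub_mem _ (Submodule.smul_mem _ _
        (mirror_mem (m _ _) (m _ _) (fun s hs => ⟨by linarith [hs.2], by linarith [hs.1]⟩) (sR x)))
        (Submodule.smul_mem _ _ (sR x)))⟩
  obtain ⟨Y, hY, hs⟩ := exists_supported_solution hσ hY₀
  have hT : ∀ (ε : ℝ) (F : Curve LineL2), Continuous fun x : Icc (0 : ℝ) Real.pi =>
      translate (ε * x) (F x) := fun ε F =>
    continuous_translate (by fun_prop) F.continuous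
  have hY1 : Continuous fun x => (Y x).1 := by fun_prop
  have hY2 : Continuous fun x => (Y x).2.1 := by fun_prop
  have hY3 : Continuous fun x => (Y x).2.2 := by fun_prop
  have hT1 : Continuous fun x : Icc (0 : ℝ) Real.pi => translate (-1 * x) (Y x).1 :=
    hT (-1) ⟨_, hY1⟩
  have hT2 : Continuous fun x : Icc (0 : ℝ) Real.pi => translate (1 * x) (Y x).2.1 :=
    hT 1 ⟨_, hY2⟩
  let k : Curve LineL2 := ⟨fun x => (1 / 2 : ℂ) • (translate (-1 * x) (Y x).1 +
    translate (1 * x) (Y x).2.1), by fun_prop⟩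
  let l : Curve LineL2 := ⟨fun x => (1 / (2 * Complex.I) : ℂ) • (translate (-1 * x) (Y x).1 -
    translate (1 * x) (Y x).2.1), by fun_prop⟩
  have s1 : ∀ x : Icc (0 : ℝ) Real.pi, ∀ s, s - -1 * (x : ℝ) ∈ Icc 0 (2 * (x : ℝ)) →
      s ∈ Icc (-x : ℝ) x := fun x s hs => ⟨by linarith [hs.1], by linarith [hs.2]⟩
  have s2 : ∀ x : Icc (0 : ℝ) Real.pi, ∀ s, s - 1 * (x : ℝ) ∈ Icc (-(2 * (x : ℝ))) 0 →
      s ∈ Icc (-x : ℝ) x := fun x s hs => ⟨by linarith [hs.1], by linarith [hs.2]⟩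
  have t1 := fun x : Icc (0 : ℝ) Real.pi => translate_mem (m _ _) (m _ _) (s1 x) (hs x).1
  have t2 := fun x : Icc (0 : ℝ) Real.pi => translate_mem (m _ _) (m _ _) (s2 x) (hs x).2.1
  refine ⟨k, l, ⟨_, hY3⟩, fun x => ⟨Submodule.smul_mem _ _ (Submodule.add_mem _ (t1 x) (t2 x)),
    Submodule.smul_mem _ _ (Submodule.sub_mem _ (t1 x) (t2 x)), (hs x).2.2⟩, fun ρ => ?_⟩
  have hext : ∀ t ∈ Icc 0 Real.pi, extend Y t ∈ dependenceDomain t := fun t ht => by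
    rw [extend, IccExtend_of_mem _ _ ht]
    exact hs ⟨t, ht⟩
  have hneg : ∀ t, waveExp (-ρ) t = waveExp ρ (-t) := fun t => by
    simp only [waveExp]; congr 1; push_cast; ring
  have win : ∀ a b : ℝ, -10 ≤ a → b ≤ 10 → Icc a b ⊆ Icc (-10) 10 := fun a b h1 h2 =>
    Icc_subset_Icc h1 h2
  have pi4 := Real.pi_lt_four
  have f1 : ∀ t ∈ Icc 0 Real.pi, fourierInt ρ (translate (-(2 * t)) (extend Y t).1) =
      waveExp ρ (-(2 * t)) * fourierInt ρ (extend Y t).1 := fun t ht =>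
    fourierInt_translate ρ (m _ _) (m (-(2 * t)) 0) (win _ _ (by linarith) (by linarith [ht.2]))
      (win _ _ (by linarith [ht.2]) (by linarith))
      (fun s hs => ⟨by linarith [hs.1], by linarith [hs.2]⟩) (hext t ht).1
  have f1' : ∀ t ∈ Icc 0 Real.pi, fourierInt ρ (translate (-t) (extend Y t).1) =
      waveExp ρ (-t) * fourierInt ρ (extend Y t).1 := fun t ht =>
    fourierInt_translate ρ (m _ _) (m (-t) t) (win _ _ (by linarith) (by linarith [ht.2]))
      (win _ _ (by linarith [ht.2]) (by linarith [ht.2]))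
      (fun s hs => ⟨by linarith [hs.1], by linarith [hs.2]⟩) (hext t ht).1
  have f2 : ∀ t ∈ Icc 0 Real.pi, fourierInt ρ (translate (2 * t) (extend Y t).2.1) =
      waveExp ρ (2 * t) * fourierInt ρ (extend Y t).2.1 := fun t ht =>
    fourierInt_translate ρ (m _ _) (m 0 (2 * t)) (win _ _ (by linarith [ht.2]) (by linarith))
      (win _ _ (by linarith) (by linarith [ht.2]))
      (fun s hs => ⟨by linarith [hs.1], by linarith [hs.2]⟩) (hext t ht).2.1
  have f2' : ∀ t ∈ Icc 0 Real.pi, fourierInt ρ (translate t (extend Y t).2.1) =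
      waveExp ρ t * fourierInt ρ (extend Y t).2.1 := fun t ht =>
    fourierInt_translate ρ (m _ _) (m (-t) t) (win _ _ (by linarith [ht.2]) (by linarith))
      (win _ _ (by linarith [ht.2]) (by linarith [ht.2]))
      (fun s hs => ⟨by linarith [hs.1], by linarith [hs.2]⟩) (hext t ht).2.1
  have f3 : ∀ t ∈ Icc 0 Real.pi, fourierInt ρ (translate t (extend Y t).2.2) =
      waveExp ρ t * fourierInt ρ (extend Y t).2.2 := fun t ht =>
    fourierInt_translate ρ (m _ _) (m 0 (2 * t)) (win _ _ (by linarith [ht.2]) (by linarith [ht.2]))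
      (win _ _ (by linarith) (by linarith [ht.2]))
      (fun s hs => ⟨by linarith [hs.1], by linarith [hs.2]⟩) (hext t ht).2.2
  have f3' : ∀ t ∈ Icc 0 Real.pi, fourierInt ρ (translate (-t) (extend Y t).2.2) =
      waveExp ρ (-t) * fourierInt ρ (extend Y t).2.2 := fun t ht =>
    fourierInt_translate ρ (m _ _) (m (-(2 * t)) 0)
      (win _ _ (by linarith [ht.2]) (by linarith [ht.2]))
      (win _ _ (by linarith [ht.2]) (by linarith))
      (fun s hs => ⟨by linarith [hs.1], by linarith [hs.2]⟩) (hext t ht).2.2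
  have hx₀ : ∀ x ∈ Icc 0 Real.pi, extend Y₀ x =
      (w₀ • cutoff (toLineHalf σ (memLp_Ioc hσ)) (2 * x) + cutoff (toLine C hC') x,
        mirror (u₀ • cutoff (toLineHalf σ (memLp_Ioc hσ)) (2 * x) + cutoff (toLine C hC') x),
        (1 / (2 * Complex.I)) • (u₀ • mirror (cutoff (toLine _ h1') x) -
          w₀ • cutoff (toLine _ h1') x)) := fun x hx => by
    rw [extend, IccExtend_of_mem _ _ hx]
    simp only [Y₀, hP, hQ, hR, cutoffCurve, ContinuousMap.coe_mk, one_mul]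
  have hsum : ∀ x ∈ Icc 0 Real.pi, extend Y x = extend Y₀ x +
      extend ((isKernel_transferMatrix hσ).volterra Y) x := fun x hx => by
    rw [IsKernel.extend_volterra _ _ hx]
    exact IsKernel.extend_eq _ hY hx
  set U : ℝ → ℂ := fun t => u₀ + fourierInt ρ (extend Y t).1 with hU
  set W : ℝ → ℂ := fun t => w₀ + fourierInt ρ (extend Y t).2.1 with hW
  set V : ℝ → ℂ := fun t => fourierInt ρ (extend Y t).2.2 with hV
  have hprim := (isKernel_transferMatrix hσ).isPrimitive_volterra Y
  have pU : IsPrimitive U (fun t => σ t * waveExp ρ (2 * t) * W t +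
      waveExp ρ t * (C t - Complex.I * σ t ^ 2 * V t)) := by
    refine (((IsPrimitive.const u₀).add ((isPrimitive_source hσ hC hC' w₀ ρ).add
      (hprim ((fourierInt ρ).comp (ContinuousLinearMap.fst ℂ _ _))))).congr_fun
        fun x hx => ?_).congr_deriv fun t ht => ?_
    · simp only [hU, hsum x hx, hx₀ x hx, Prod.fst_add, map_add, ContinuousLinearMap.comp_apply,
        ContinuousLinearMap.coe_fst']
    · simp only [ContinuousLinearMap.comp_apply, ContinuousLinearMap.coe_fst',
        transferMatrix_apply, map_sub, map_smul, smul_eq_mul, f2 t ht, f3 t ht, hW, hV]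
      ring
  have pW : IsPrimitive W (fun t => σ t * waveExp ρ (-(2 * t)) * U t +
      waveExp ρ (-t) * (C t + Complex.I * σ t ^ 2 * V t)) := by
    refine (((IsPrimitive.const w₀).add ((isPrimitive_source hσ hC hC' u₀ (-ρ)).add
      (hprim ((fourierInt ρ).comp ((ContinuousLinearMap.fst ℂ _ _).comp
        (ContinuousLinearMap.snd ℂ _ _)))))).congr_fun fun x hx => ?_).congr_deriv fun t ht => ?_
    · simp only [hW, hsum x hx, hx₀ x hx, Prod.fst_add, Prod.snd_add, map_add,
        ContinuousLinearMap.comp_apply, ContinuousLinearMap.coe_fst', ContinuousLinearMap.coe_snd',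
        fourierInt_mirror]
    · simp only [ContinuousLinearMap.comp_apply, ContinuousLinearMap.coe_fst',
        ContinuousLinearMap.coe_snd', transferMatrix_apply, map_add, map_smul, smul_eq_mul,
        f1 t ht, f3' t ht, hU, hV, hneg]
      ring
  have pV : IsPrimitive V (fun t => σ t * V t + (1 / (2 * Complex.I)) *
      (waveExp ρ (-t) * U t - waveExp ρ t * W t)) := by
    have q1 := isPrimitive_source hσ continuous_const h1' 0 ρ
    have q2 := isPrimitive_source hσ continuous_const h1' 0 (-ρ)
    simp only [zero_smul, zero_add, zero_mul, one_mul] at q1 q2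
    refine (((((q2.const_mul u₀).sub (q1.const_mul w₀)).const_mul (1 / (2 * Complex.I))).add
      (hprim ((fourierInt ρ).comp ((ContinuousLinearMap.snd ℂ _ _).comp
        (ContinuousLinearMap.snd ℂ _ _))))).congr_fun fun x hx => ?_).congr_deriv fun t ht => ?_
    · simp only [hV, hsum x hx, hx₀ x hx, Prod.snd_add, map_add, map_sub, map_smul, smul_eq_mul,
        ContinuousLinearMap.comp_apply, ContinuousLinearMap.coe_snd', fourierInt_mirror]
    · simp only [ContinuousLinearMap.comp_apply, ContinuousLinearMap.coe_snd',
        transferMatrix_apply, map_add, map_sub, map_smul, smul_eq_mul, f1' t ht, f2' t ht,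
        hU, hV, hW, hneg]
      ring
  have e1 : IsPrimitive (fun t => waveExp ρ t) (fun t => Complex.I * ρ * waveExp ρ t) := by
    simpa using isPrimitive_waveExp ρ 1
  have e2 : IsPrimitive (fun t => waveExp ρ (-t)) (fun t => -(Complex.I * ρ * waveExp ρ (-t))) := by
    simpa using isPrimitive_waveExp ρ (-1)
  have hI : Complex.I ^ 2 = -1 := Complex.I_sq
  have hinv : 1 / (2 * Complex.I) = -Complex.I / 2 := by
    rw [one_div, mul_inv, Complex.inv_I]; ring
  have hk : ∀ x ∈ Icc 0 Real.pi, (1 / 2 : ℂ) * (waveExp ρ (-x) * U x + waveExp ρ x * W x) =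
      (u₀ * waveExp ρ (-x) + w₀ * waveExp ρ x) / 2 + fourierInt ρ (extend k x) := fun x hx => by
    have h1 : extend k x = (1 / 2 : ℂ) • (translate (-x) (extend Y x).1 +
        translate x (extend Y x).2.1) := by
      simp only [extend, IccExtend_of_mem _ _ hx, k, ContinuousMap.coe_mk, neg_one_mul, one_mul]
    rw [h1, map_smul, map_add, f1' x hx, f2' x hx, smul_eq_mul]
    simp only [hU, hW]
    ring
  have hl : ∀ x ∈ Icc 0 Real.pi, (1 / (2 * Complex.I)) *
      (waveExp ρ (-x) * U x - waveExp ρ x * W x) =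
      (u₀ * waveExp ρ (-x) - w₀ * waveExp ρ x) / (2 * Complex.I) + fourierInt ρ (extend l x) :=
    fun x hx => by
    have h1 : extend l x = (1 / (2 * Complex.I) : ℂ) • (translate (-x) (extend Y x).1 -
        translate x (extend Y x).2.1) := by
      simp only [extend, IccExtend_of_mem _ _ hx, l, ContinuousMap.coe_mk, neg_one_mul, one_mul]
    rw [h1, map_smul, map_sub, f1' x hx, f2' x hx, smul_eq_mul]
    simp only [hU, hW]
    ring
  have hm : ∀ x ∈ Icc 0 Real.pi, extend (⟨_, hY3⟩ : Curve LineL2) x = (extend Y x).2.2 :=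
    fun x hx => by simp only [extend, IccExtend_of_mem _ _ hx, ContinuousMap.coe_mk]
  refine ⟨_, _, _, fun _ => rfl, fun _ => rfl, fun _ => rfl, ?_, ?_, ?_⟩
  · refine ((((e2.mul pU).add (e1.mul pW)).const_mul (1 / 2)).congr_fun hk).congr_deriv
      fun t ht => ?_
    rw [← hk t ht, ← hl t ht, hinv, waveExp_two_mul, show -(2 * t) = 2 * (-t) by ring,
      waveExp_two_mul]
    have h := waveExp_neg_mul ρ t
    linear_combination (1 / 2 * (σ t * waveExp ρ t * W t + σ t * waveExp ρ (-t) * U t + 2 * C t)) * h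
  · refine ((((e2.mul pU).sub (e1.mul pW)).const_mul (1 / (2 * Complex.I))).congr_fun
      hl).congr_deriv fun t ht => ?_
    rw [← hk t ht, ← hl t ht, hm t ht, hinv, waveExp_two_mul, show -(2 * t) = 2 * (-t) by ring,
      waveExp_two_mul]
    have h := waveExp_neg_mul ρ t
    linear_combination (-Complex.I / 2 * (σ t * waveExp ρ t * W t - σ t * waveExp ρ (-t) * U t -
      2 * Complex.I * σ t ^ 2 * V t)) * h +
      (ρ / 2 * (waveExp ρ (-t) * U t + waveExp ρ t * W t) + σ t ^ 2 * V t) * hI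
  · refine (pV.congr_fun fun x hx => ?_).congr_deriv fun t ht => ?_
    · rw [hm x hx]
    · rw [hm t ht, ← hl t ht]

end Transformation

/-! ### Representations and bounds of the fundamental solutions -/

section Representation

variable {σ : ℝ → ℂ}

theorem zero_mem : (0 : ℝ) ∈ Icc 0 Real.pi := left_mem_Icc.2 Real.pi_pos.le

theorem isKernel_scalar (hσ : MemLp σ 2 (volume.restrict (Ioo 0 Real.pi))) :
    IsKernel (fun t => σ t • ContinuousLinearMap.id ℂ ℂ) (fun t => ‖σ t‖) where
  measurable Y := (memLp_Ioc hσ).1.mul (continuous_extend Y).aestronglyMeasurable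
  bound t := by rw [norm_smul, ContinuousLinearMap.norm_id, mul_one]
  integrable := (intervalIntegrable_potential hσ).norm

/-- A homogeneous scalar Volterra equation has only the zero solution. The lemma identifies `ρ v` in
the auxiliary system of `exists_transformation`. -/
theorem IsPrimitive.eq_zero (hσ : MemLp σ 2 (volume.restrict (Ioo 0 Real.pi))) {d : ℝ → ℂ}
    (hd : IsPrimitive d (fun t => σ t * d t)) (h0 : d 0 = 0) {x : ℝ} (hx : x ∈ Icc 0 Real.pi) :
    d x = 0 := by
  let D : Curve ℂ := ⟨fun x => d x, continuousOn_iff_continuous_domRestrict.1 hd.continuousOn⟩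
  have hD : ∀ x ∈ Icc 0 Real.pi, extend D x = d x := fun x hx => by
    rw [extend, IccExtend_of_mem _ _ hx]; rfl
  have h1 : D = 0 + (isKernel_scalar hσ).volterra D := by
    refine ContinuousMap.ext fun x => ?_
    change d x = 0 + ∫ t in (0 : ℝ)..x, σ t • extend D t
    rw [hd.eq x x.2, h0]
    congr 1
    refine intervalIntegral.integral_congr fun t ht => ?_
    rw [uIcc_of_le x.2.1] at ht
    simp only [hD t ⟨ht.1, ht.2.trans x.2.2⟩, smul_eq_mul]
  have h2 := (isKernel_scalar hσ).eq_of_eq h1 (Z := 0) (by simp)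
  rw [← hD x hx, h2]
  rfl

theorem fourierInt_extend_zero {k : Curve LineL2}
    (h : ∀ x : Icc (0 : ℝ) Real.pi, k x ∈ supportedIn (Icc (-x) x)) (ρ : ℂ) :
    fourierInt ρ (extend k 0) = 0 := by
  have h1 : extend k 0 ∈ supportedIn (Icc (-0) 0) := by
    rw [extend, IccExtend_of_mem _ _ zero_mem]
    exact h ⟨0, zero_mem⟩
  rw [fourierInt_eq_setIntegral ρ measurableSet_Icc (Icc_subset_Icc (by norm_num) (by norm_num)) h1]
  simp

theorem waveExp_eq_cos (ρ : ℂ) (x : ℝ) :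
    (waveExp ρ (-x) + waveExp ρ x) / 2 = Complex.cos (ρ * x) ∧
      (waveExp ρ (-x) - waveExp ρ x) / (2 * Complex.I) = -Complex.sin (ρ * x) := by
  have e1 : waveExp ρ x = Complex.exp (ρ * x * Complex.I) := by
    simp only [waveExp]; congr 1; ring
  have e2 : waveExp ρ (-x) = Complex.exp (-(ρ * x) * Complex.I) := by
    simp only [waveExp]; congr 1; push_cast; ring
  rw [e1, e2, Complex.cos, Complex.sin]
  refine ⟨by ring, ?_⟩
  rw [div_eq_iff (by simp)]
  linear_combination (Complex.exp (ρ * x * Complex.I) - Complex.exp (-(ρ * x) * Complex.I)) *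
    (-Complex.I_sq)

theorem exists_phi_representation (hσ : MemLp σ 2 (volume.restrict (Ioo 0 Real.pi))) :
    ∃ (C : ℝ → ℂ) (k l : Curve LineL2), Continuous C ∧
      (∀ x : Icc (0 : ℝ) Real.pi, k x ∈ supportedIn (Icc (-x) x) ∧
        l x ∈ supportedIn (Icc (-x) x)) ∧
      ∀ ρ : ℂ, ∀ x ∈ Icc 0 Real.pi,
        (phi σ (ρ ^ 2)).1 x = Complex.cos (ρ * x) + fourierInt ρ (extend k x) ∧
        (phi σ (ρ ^ 2)).2 x = C x + ρ * (-Complex.sin (ρ * x) + fourierInt ρ (extend l x)) := by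
  obtain ⟨hs0, hi0, hi0'⟩ := phi_spec hσ 0
  obtain ⟨p1, p2⟩ := (isSolution_iff hσ).1 hs0
  let C : ℝ → ℂ := IccExtend Real.pi_pos.le ((Icc 0 Real.pi).domRestrict (phi σ 0).2)
  have hC : Continuous C :=
    (continuousOn_iff_continuous_domRestrict.1 hs0.continuousOn_quasi).Icc_extend'
  have hC' : ∀ t ∈ Icc 0 Real.pi, C t = (phi σ 0).2 t := fun t ht => IccExtend_of_mem _ _ ht
  obtain ⟨k, l, m, hsupp, H⟩ := exists_transformation hσ hC 1 1
  refine ⟨C, k, l, hC, fun x => ⟨(hsupp x).1, (hsupp x).2.1⟩, fun ρ => ?_⟩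
  obtain ⟨y, z, v, hy, hz, hv, py, pz, pv⟩ := H ρ
  simp only [one_mul, (waveExp_eq_cos ρ _).1, (waveExp_eq_cos ρ _).2] at hy hz
  have y0 : y 0 = 1 := by
    rw [hy, fourierInt_extend_zero fun x => (hsupp x).1]; simp
  have z0 : z 0 = 0 := by
    rw [hz, fourierInt_extend_zero fun x => (hsupp x).2.1]; simp
  have v0 : v 0 = 0 := by
    rw [hv, fourierInt_extend_zero fun x => (hsupp x).2.2]
  -- This replaces `ρ σ² v` by `σ² (y - φ(·, 0))` and so converts the auxiliary system into the
  -- equation for `φ(·, ρ²)`, with quasi-derivative `φ^{[1]}(·, 0) + ρ z`.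
  have hd : ∀ t ∈ Icc 0 Real.pi, y t - (phi σ 0).1 t - ρ * v t = 0 := fun t ht =>
    IsPrimitive.eq_zero hσ (d := fun t => y t - (phi σ 0).1 t - ρ * v t)
      (((py.sub p1).sub (pv.const_mul ρ)).congr_deriv fun t ht => by rw [hC' t ht]; ring)
      (by simp only [y0, v0, hi0]; ring) ht
  have hsol : IsSolution σ (ρ ^ 2) y (fun t => (phi σ 0).2 t + ρ * z t) := by
    rw [isSolution_iff hσ]
    refine ⟨py.congr_deriv fun t ht => ?_, (p2.add (pz.const_mul ρ)).congr_deriv fun t ht => ?_⟩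
    · rw [hC' t ht]; ring
    · linear_combination (σ t ^ 2) * hd t ht
  intro x hx
  obtain ⟨h1, h2, h3⟩ := phi_spec hσ (ρ ^ 2)
  have h := h1.unique hσ hsol (by rw [h2, y0]) (by rw [h3, hi0', z0]; ring) hx
  rw [h.1, h.2, hy x, ← hz x, hC' x hx]
  exact ⟨rfl, rfl⟩

theorem exists_sinSol_representation (hσ : MemLp σ 2 (volume.restrict (Ioo 0 Real.pi))) :
    ∃ (k l : Curve LineL2),
      (∀ x : Icc (0 : ℝ) Real.pi, k x ∈ supportedIn (Icc (-x) x) ∧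
        l x ∈ supportedIn (Icc (-x) x)) ∧
      ∀ ρ : ℂ, ∀ x ∈ Icc 0 Real.pi,
        ρ * (sinSol σ (ρ ^ 2)).1 x = Complex.sin (ρ * x) + fourierInt ρ (extend k x) ∧
        (sinSol σ (ρ ^ 2)).2 x = Complex.cos (ρ * x) + fourierInt ρ (extend l x) := by
  -- Without a source and with these amplitudes one has `v = S`, `z = S^{[1]}` and `y = ρ S`. The
  -- solution itself is `v`, so `ρ = 0` is not exceptional.
  obtain ⟨k, l, m, hsupp, H⟩ := exists_transformation hσ (continuous_const (y := (0 : ℂ)))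
    Complex.I (-Complex.I)
  refine ⟨k, l, fun x => ⟨(hsupp x).1, (hsupp x).2.1⟩, fun ρ => ?_⟩
  obtain ⟨y, z, v, hy, hz, hv, py, pz, pv⟩ := H ρ
  have hI := Complex.I_ne_zero
  have hy' : ∀ x, y x = Complex.sin (ρ * x) + fourierInt ρ (extend k x) := fun x => by
    have h := (waveExp_eq_cos ρ x).2
    rw [div_eq_iff (by simp)] at h
    rw [hy]
    linear_combination (Complex.I / 2) * h - Complex.sin (ρ * x) * Complex.I_sq
  have hz' : ∀ x, z x = Complex.cos (ρ * x) + fourierInt ρ (extend l x) := fun x => by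
    rw [hz, ← (waveExp_eq_cos ρ x).1]
    field_simp
    ring
  have y0 : y 0 = 0 := by
    rw [hy', fourierInt_extend_zero fun x => (hsupp x).1]; simp
  have z0 : z 0 = 1 := by
    rw [hz', fourierInt_extend_zero fun x => (hsupp x).2.1]; simp
  have v0 : v 0 = 0 := by
    rw [hv, fourierInt_extend_zero fun x => (hsupp x).2.2]
  have hd : ∀ t ∈ Icc 0 Real.pi, y t - ρ * v t = 0 := fun t ht =>
    IsPrimitive.eq_zero hσ (d := fun t => y t - ρ * v t)
      ((py.sub (pv.const_mul ρ)).congr_deriv fun t ht => by ring)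
      (by simp only [y0, v0]; ring) ht
  have hsol : IsSolution σ (ρ ^ 2) v z := by
    rw [isSolution_iff hσ]
    refine ⟨pv.congr_deriv fun t ht => by ring, pz.congr_deriv fun t ht => ?_⟩
    linear_combination (-ρ) * hd t ht
  intro x hx
  obtain ⟨h1, h2, h3⟩ := sinSol_spec hσ (ρ ^ 2)
  have h := h1.unique hσ hsol (by rw [h2, v0]) (by rw [h3, z0]) hx
  rw [h.1, h.2, ← hy' x, ← hz' x]
  exact ⟨by linear_combination -hd x hx, rfl⟩

theorem norm_waveExp_le (ρ : ℂ) {x : ℝ} (hx : 0 ≤ x) :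
    ‖waveExp ρ x‖ ≤ Real.exp (|ρ.im| * x) ∧ ‖waveExp ρ (-x)‖ ≤ Real.exp (|ρ.im| * x) :=
  ⟨norm_exp_le ⟨by linarith, le_rfl⟩, norm_exp_le ⟨le_rfl, by linarith⟩⟩

theorem norm_cos_sin_le (ρ : ℂ) {x : ℝ} (hx : 0 ≤ x) :
    ‖Complex.cos (ρ * x)‖ ≤ Real.exp (|ρ.im| * x) ∧
      ‖Complex.sin (ρ * x)‖ ≤ Real.exp (|ρ.im| * x) := by
  obtain ⟨h1, h2⟩ := norm_waveExp_le ρ hx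
  obtain ⟨h3, h4⟩ := waveExp_eq_cos ρ x
  rw [← h3, ← norm_neg (Complex.sin _), ← h4, norm_div, norm_div]
  have e : ‖(2 * Complex.I : ℂ)‖ = 2 := by simp
  rw [e, Complex.norm_two]
  constructor
  · linarith [norm_add_le (waveExp ρ (-x)) (waveExp ρ x)]
  · linarith [norm_sub_le (waveExp ρ (-x)) (waveExp ρ x)]

theorem norm_fourierInt_extend_le {k : Curve LineL2}
    (h : ∀ x : Icc (0 : ℝ) Real.pi, k x ∈ supportedIn (Icc (-x) x)) (ρ : ℂ) {x : ℝ}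
    (hx : x ∈ Icc 0 Real.pi) :
    ‖fourierInt ρ (extend k x)‖ ≤ 5 * ‖k‖ * Real.exp (|ρ.im| * x) := by
  have h1 : extend k x ∈ supportedIn (Icc (-x) x) := by
    rw [extend, IccExtend_of_mem _ _ hx]
    exact h ⟨x, hx⟩
  refine (norm_fourierInt_le ρ hx.1 (by linarith [hx.2, Real.pi_lt_four]) h1).trans ?_
  have := norm_extend_le k x
  calc _ ≤ 5 * Real.exp (|ρ.im| * x) * ‖k‖ := by gcongr
    _ = _ := by ring

theorem exists_solution_bounds (hσ : MemLp σ 2 (volume.restrict (Ioo 0 Real.pi))) :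
    ∃ K : ℝ, 0 < K ∧ ∀ ρ : ℂ, 1 ≤ ‖ρ‖ → ∀ x ∈ Icc 0 Real.pi,
      ‖(phi σ (ρ ^ 2)).1 x‖ ≤ K * Real.exp (|ρ.im| * x) ∧
      ‖(phi σ (ρ ^ 2)).2 x‖ ≤ K * ‖ρ‖ * Real.exp (|ρ.im| * x) ∧
      ‖(sinSol σ (ρ ^ 2)).1 x‖ ≤ K * Real.exp (|ρ.im| * x) ∧
      ‖(sinSol σ (ρ ^ 2)).2 x‖ ≤ K * Real.exp (|ρ.im| * x) := by
  obtain ⟨C, k, l, hC, hkl, hφ⟩ := exists_phi_representation hσ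
  obtain ⟨k', l', hkl', hS⟩ := exists_sinSol_representation hσ
  obtain ⟨B, hB⟩ := isCompact_Icc.exists_bound_of_continuousOn (hC.continuousOn (s := Icc 0 Real.pi))
  have hB0 : 0 ≤ B := (norm_nonneg _).trans (hB 0 zero_mem)
  refine ⟨1 + B + 5 * (‖k‖ + ‖l‖ + ‖k'‖ + ‖l'‖), by positivity, fun ρ hρ x hx => ?_⟩
  obtain ⟨hc, hs⟩ := norm_cos_sin_le ρ hx.1
  obtain ⟨e1, e2⟩ := hφ ρ x hx
  obtain ⟨e3, e4⟩ := hS ρ x hx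
  have f1 := norm_fourierInt_extend_le (fun x => (hkl x).1) ρ hx
  have f2 := norm_fourierInt_extend_le (fun x => (hkl x).2) ρ hx
  have f3 := norm_fourierInt_extend_le (fun x => (hkl' x).1) ρ hx
  have f4 := norm_fourierInt_extend_le (fun x => (hkl' x).2) ρ hx
  have hE1 : 1 ≤ Real.exp (|ρ.im| * x) := Real.one_le_exp (mul_nonneg (abs_nonneg _) hx.1)
  set e := Real.exp (|ρ.im| * x)
  have he : 0 ≤ e := zero_le_one.trans hE1
  have n1 := mul_nonneg (norm_nonneg k) he
  have n2 := mul_nonneg (norm_nonneg l) he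
  have n3 := mul_nonneg (norm_nonneg k') he
  have n4 := mul_nonneg (norm_nonneg l') he
  have n5 := mul_nonneg hB0 he
  refine ⟨?_, ?_, ?_, ?_⟩
  · rw [e1]
    refine (norm_add_le _ _).trans ?_
    nlinarith
  · rw [e2]
    have g1 : ‖C x‖ ≤ B * e * ‖ρ‖ := by
      calc ‖C x‖ ≤ B := hB x hx
        _ = B * 1 * 1 := by ring
        _ ≤ B * e * ‖ρ‖ := by gcongr
    have g2 : ‖ρ * (-Complex.sin (ρ * x) + fourierInt ρ (extend l x))‖ ≤
        ‖ρ‖ * (e + 5 * ‖l‖ * e) := by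
      rw [norm_mul]
      gcongr
      refine (norm_add_le _ _).trans ?_
      rw [norm_neg]
      exact add_le_add hs f2
    refine (norm_add_le _ _).trans ((add_le_add g1 g2).trans ?_)
    have : 0 ≤ ‖ρ‖ * (5 * (‖k‖ * e + ‖k'‖ * e + ‖l'‖ * e)) := by positivity
    nlinarith
  · have g : ‖ρ‖ * ‖(sinSol σ (ρ ^ 2)).1 x‖ ≤ e + 5 * ‖k'‖ * e := by
      rw [← norm_mul, e3]
      exact (norm_add_le _ _).trans (add_le_add hs f3)
    have g2 : ‖(sinSol σ (ρ ^ 2)).1 x‖ ≤ ‖ρ‖ * ‖(sinSol σ (ρ ^ 2)).1 x‖ :=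
      le_mul_of_one_le_left (norm_nonneg _) hρ
    nlinarith
  · rw [e4]
    refine (norm_add_le _ _).trans ?_
    nlinarith

end Representation


/-! ### Fourier integrals of square integrable functions: decay and square summability -/

theorem integrableOn_LineL2 (f : LineL2) (a b : ℝ) : IntegrableOn f (Icc a b) :=
  ((Lp.memLp f).restrict _).integrable (by norm_num)

theorem differentiable_fourierInt (f : LineL2) : Differentiable ℂ fun ρ => fourierInt ρ f := by
  intro ρ₀
  simp only [fourierInt_window]
  refine (hasDerivAt_integral_of_dominated_loc_of_deriv_le (s := Metric.ball ρ₀ 1)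
    (F' := fun ρ s => f s * (Complex.I * s * Complex.exp (Complex.I * ρ * s)))
    (bound := fun s => ‖f s‖ * (10 * Real.exp (|ρ₀.im| * 10 + 10)))
    (Metric.ball_mem_nhds _ one_pos) ?_ ?_ ?_ ?_ ?_ ?_).2.differentiableAt
  · refine Eventually.of_forall fun ρ => ?_
    exact (integrableOn_LineL2 f _ _).aestronglyMeasurable.mul
      (Continuous.aestronglyMeasurable (by fun_prop))
  · exact (integrableOn_LineL2 f _ _).mul_continuousOn
      (Continuous.continuousOn (by fun_prop)) isCompact_Icc
  · exact (integrableOn_LineL2 f _ _).aestronglyMeasurable.mul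
      (Continuous.aestronglyMeasurable (by fun_prop))
  · refine (ae_restrict_iff' measurableSet_Icc).2 (Eventually.of_forall fun s hs ρ hρ => ?_)
    rw [norm_mul, norm_mul, norm_mul, Complex.norm_I, one_mul]
    have h1 : ‖(s : ℂ)‖ ≤ 10 := by
      rw [Complex.norm_real]
      exact abs_le.2 hs
    have h2 : |ρ.im| ≤ |ρ₀.im| + 1 := by
      have h3 : |(ρ - ρ₀).im| ≤ 1 := (Complex.abs_im_le_norm _).trans (mem_ball_iff_norm.1 hρ).le
      have h4 : ρ.im = ρ₀.im + (ρ - ρ₀).im := by simp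
      rw [h4]
      exact (abs_add_le _ _).trans (by linarith)
    have h5 := norm_exp_le (ρ := ρ) hs
    have h6 : Real.exp (|ρ.im| * 10) ≤ Real.exp (|ρ₀.im| * 10 + 10) :=
      Real.exp_le_exp.2 (by linarith)
    gcongr
    exact h5.trans h6
  · exact (integrableOn_LineL2 f _ _).norm.mul_const _
  · refine Eventually.of_forall fun s ρ _ => ?_
    have h : HasDerivAt (fun ρ : ℂ => Complex.I * ρ * s) (Complex.I * s) ρ := by
      simpa using ((hasDerivAt_id ρ).const_mul Complex.I).mul_const (s : ℂ)
    exact (h.cexp.const_mul (f s)).congr_deriv (by ring)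

/-- `exp(iw) = 1` only at multiples of `2π`, none of which has modulus `π`; compactness of the
circle does the rest. -/
theorem exists_norm_one_sub_exp_ge :
    ∃ c : ℝ, 0 < c ∧ ∀ w : ℂ, ‖w‖ = Real.pi → c ≤ ‖1 - Complex.exp (Complex.I * w)‖ := by
  have hne : (Metric.sphere (0 : ℂ) Real.pi).Nonempty :=
    NormedSpace.sphere_nonempty.2 Real.pi_pos.le
  obtain ⟨w₀, hw₀, hmin⟩ := (isCompact_sphere (0 : ℂ) Real.pi).exists_isMinOn hne
    (f := fun w => ‖1 - Complex.exp (Complex.I * w)‖) (Continuous.continuousOn (by fun_prop))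
  refine ⟨_, norm_pos_iff.2 fun h => ?_, fun w hw => hmin (mem_sphere_zero_iff_norm.2 hw)⟩
  obtain ⟨n, hn⟩ := Complex.exp_eq_one_iff.1 (sub_eq_zero.1 h).symm
  have h1 : w₀ = n * (2 * Real.pi) := by
    refine mul_left_cancel₀ Complex.I_ne_zero ?_
    rw [hn]
    ring
  have h2 := mem_sphere_zero_iff_norm.1 hw₀
  rw [h1] at h2
  simp only [norm_mul, Complex.norm_intCast, Complex.norm_real, Real.norm_eq_abs,
    abs_of_pos Real.pi_pos, RCLike.norm_ofNat] at h2
  have h3 : |(n : ℝ)| * 2 = 1 := by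
    refine mul_right_cancel₀ Real.pi_pos.ne' ?_
    linarith
  have h4 : |n| * 2 = 1 := by exact_mod_cast h3
  omega

/-- The Riemann–Lebesgue lemma in the complex plane. -/
theorem eventually_norm_fourierInt_le {f : LineL2}
    (hf : f ∈ supportedIn (Icc (-Real.pi) Real.pi)) {ε : ℝ} (hε : 0 < ε) :
    ∀ᶠ ρ in Bornology.cobounded ℂ, ‖fourierInt ρ f‖ ≤ ε * Real.exp (|ρ.im| * Real.pi) := by
  obtain ⟨c, hc, hc'⟩ := exists_norm_one_sub_exp_ge
  have h1 : Tendsto (fun ρ : ℂ => Real.pi / ‖ρ‖) (Bornology.cobounded ℂ) (𝓝 0) :=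
    tendsto_norm_cobounded_atTop.const_div_atTop _
  have h2 : Tendsto (fun h : ℝ => 5 * Real.exp Real.pi * ‖f - translate h f‖) (𝓝 0) (𝓝 0) := by
    have h3 : Continuous fun h : ℝ => 5 * Real.exp Real.pi * ‖f - translate h f‖ :=
      continuous_const.mul (continuous_const.sub
        (continuous_translate continuous_id continuous_const)).norm
    have h4 : translate 0 f = f := by
      refine Lp.ext ?_
      filter_upwards [translate_ae 0 f] with s hs
      rw [hs, sub_zero]
    simpa [h4] using h3.tendsto 0
  have h3 := (h2.comp h1).eventually (gt_mem_nhds (mul_pos hc hε))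
  filter_upwards [h3, tendsto_norm_cobounded_atTop.eventually_ge_atTop 1] with ρ h4 hρ
  have hρ0 : 0 < ‖ρ‖ := one_pos.trans_le hρ
  -- A shift by `h` multiplies the Fourier integral by `exp(iρh)` with `|ρh| = π`, which stays away
  -- from `1`, while `f` minus its shift tends to `0` in `L₂`. The larger support costs only the
  -- factor `exp(|Im ρ| h) ≤ exp π`.
  set h := Real.pi / ‖ρ‖ with hh
  have hh0 : 0 ≤ h := by positivity
  have hh1 : h ≤ Real.pi := div_le_self Real.pi_pos.le hρ
  have hm : translate h f ∈ supportedIn (Icc (-(Real.pi + h)) (Real.pi + h)) :=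
    translate_mem measurableSet_Icc measurableSet_Icc
      (fun s hs => ⟨by linarith [hs.1], by linarith [hs.2]⟩) hf
  have hm' : f ∈ supportedIn (Icc (-(Real.pi + h)) (Real.pi + h)) :=
    supportedIn_mono measurableSet_Icc measurableSet_Icc
      (Icc_subset_Icc (by linarith) (by linarith)) hf
  have h10 : Real.pi + h ≤ 10 := by linarith [Real.pi_lt_four]
  have h5 := norm_fourierInt_le ρ (by positivity) h10 (sub_mem hm' hm)
  have h6 : fourierInt ρ (f - translate h f) =
      (1 - Complex.exp (Complex.I * (ρ * h))) * fourierInt ρ f := by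
    rw [map_sub, fourierInt_translate ρ measurableSet_Icc measurableSet_Icc
      (Icc_subset_Icc (by linarith [Real.pi_lt_four]) (by linarith [Real.pi_lt_four]))
      (J := Icc (-(Real.pi + h)) (Real.pi + h)) (Icc_subset_Icc (by linarith) h10)
      (fun s hs => ⟨by linarith [hs.1], by linarith [hs.2]⟩) hf, sub_mul, one_mul, mul_assoc]
  have h7 : ‖ρ * (h : ℂ)‖ = Real.pi := by
    rw [norm_mul, Complex.norm_real, Real.norm_of_nonneg hh0, hh]
    field_simp
  have h8 : |ρ.im| * (Real.pi + h) ≤ |ρ.im| * Real.pi + Real.pi := by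
    have : |ρ.im| * h ≤ ‖ρ‖ * h := by gcongr; exact Complex.abs_im_le_norm ρ
    have h9 : ‖ρ‖ * h = Real.pi := by rw [hh]; field_simp
    linarith
  have h9 : c * ‖fourierInt ρ f‖ ≤ c * (ε * Real.exp (|ρ.im| * Real.pi)) := by
    calc c * ‖fourierInt ρ f‖ ≤ ‖fourierInt ρ (f - translate h f)‖ := by
          rw [h6, norm_mul]
          gcongr
          exact hc' _ h7
      _ ≤ 5 * Real.exp (|ρ.im| * (Real.pi + h)) * ‖f - translate h f‖ := h5
      _ ≤ 5 * (Real.exp Real.pi * Real.exp (|ρ.im| * Real.pi)) * ‖f - translate h f‖ := by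
          rw [← Real.exp_add]
          gcongr
          linarith
      _ = 5 * Real.exp Real.pi * ‖f - translate h f‖ * Real.exp (|ρ.im| * Real.pi) := by ring
      _ ≤ c * ε * Real.exp (|ρ.im| * Real.pi) := by
          exact mul_le_mul_of_nonneg_right h4.le (by positivity)
      _ = _ := by ring
  exact le_of_mul_le_mul_left h9 hc

/-- A multiple of the mean of `‖F‖²` over the circle of radius `3`; it bounds `‖F‖²` on the disc of
radius `2`. -/
def localMass (F : ℂ → ℂ) (c : ℂ) : ℝ :=
  3 / (2 * Real.pi) * ∫ θ in (0 : ℝ)..2 * Real.pi, ‖F (circleMap c 3 θ)‖ ^ 2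

theorem localMass_nonneg (F : ℂ → ℂ) (c : ℂ) : 0 ≤ localMass F c :=
  mul_nonneg (by positivity)
    (intervalIntegral.integral_nonneg (by positivity) fun _ _ => by positivity)

/-- Cauchy's formula for `F ^ 2` on the circle of radius `3`, which keeps distance at least `1` from
the disc of radius `2`. Unlike values at irregular points, these means can be summed over a lattice
of centres. -/
theorem norm_sq_le_localMass {F : ℂ → ℂ} (hF : Differentiable ℂ F) {c w : ℂ} (hw : ‖w - c‖ ≤ 2) :
    ‖F w‖ ^ 2 ≤ localMass F c := by
  have h1 : w ∈ Metric.ball c 3 := mem_ball_iff_norm.2 (by linarith)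
  have h2 := DiffContOnCl.two_pi_i_inv_smul_circleIntegral_sub_inv_smul
    (hF.pow 2).diffContOnCl h1
  rw [← norm_pow, ← Pi.pow_apply F 2 w, ← h2, norm_smul, circleIntegral, localMass]
  have h3 : ‖(2 * (Real.pi : ℂ) * Complex.I)⁻¹‖ = 1 / (2 * Real.pi) := by
    simp [abs_of_pos Real.pi_pos]
  rw [h3]
  have h4 : 3 / (2 * Real.pi) * ∫ θ in (0 : ℝ)..2 * Real.pi, ‖F (circleMap c 3 θ)‖ ^ 2 =
      1 / (2 * Real.pi) * ∫ θ in (0 : ℝ)..2 * Real.pi, 3 * ‖F (circleMap c 3 θ)‖ ^ 2 := by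
    rw [intervalIntegral.integral_const_mul]
    ring
  rw [h4]
  gcongr
  refine intervalIntegral.norm_integral_le_of_norm_le (by positivity) (Eventually.of_forall
    fun θ _ => ?_) (Continuous.intervalIntegrable ?_ _ _)
  · rw [norm_smul, norm_smul, deriv_circleMap, norm_mul, norm_circleMap_zero, Complex.norm_I,
      mul_one, abs_of_pos (by norm_num : (0 : ℝ) < 3), norm_inv, Pi.pow_apply, norm_pow]
    have h5 : 1 ≤ ‖circleMap c 3 θ - w‖ := by
      have h6 : ‖circleMap c 3 θ - c‖ = 3 := by simp [circleMap]
      have h7 : ‖circleMap c 3 θ - c‖ ≤ ‖circleMap c 3 θ - w‖ + ‖w - c‖ := by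
        simpa using norm_add_le (circleMap c 3 θ - w) (w - c)
      linarith
    have h6 : ‖circleMap c 3 θ - w‖⁻¹ ≤ 1 := inv_le_one_of_one_le₀ h5
    calc _ ≤ 3 * (1 * ‖F (circleMap c 3 θ)‖ ^ 2) := by gcongr
      _ = _ := by ring
  · exact continuous_const.mul ((hF.continuous.comp (continuous_circleMap c 3)).norm.pow 2)

theorem norm_deriv_sq_le_localMass {F : ℂ → ℂ} (hF : Differentiable ℂ F) {c w : ℂ}
    (hw : ‖w - c‖ ≤ 1) : ‖deriv F w‖ ^ 2 ≤ localMass F c := by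
  have h := Complex.norm_deriv_le_of_forall_mem_sphere_norm_le (c := w) (C := √(localMass F c))
    one_pos hF.diffContOnCl fun z hz => Real.le_sqrt_of_sq_le
      (norm_sq_le_localMass hF (c := c) ?_)
  · rw [div_one] at h
    calc ‖deriv F w‖ ^ 2 ≤ √(localMass F c) ^ 2 := by gcongr
      _ = _ := Real.sq_sqrt (localMass_nonneg F c)
  · have h1 : ‖z - w‖ = 1 := mem_sphere_iff_norm.1 hz
    calc ‖z - c‖ ≤ ‖z - w‖ + ‖w - c‖ := by simpa using norm_add_le (z - w) (w - c)
      _ ≤ 2 := by linarith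

theorem neg_pi_lt_pi : -Real.pi < Real.pi := by linarith [Real.pi_pos]

/-- Absorbing `exp(iδt)` into the function turns sampling on a shifted lattice into Fourier
coefficients. The index is `-n` because Fourier coefficients carry the opposite sign in the
exponent. -/
theorem fourierInt_int_add {f : LineL2} (hf : f ∈ supportedIn (Icc (-Real.pi) Real.pi)) (δ : ℂ)
    (n : ℤ) : fourierInt (n + δ) f = 2 * Real.pi * fourierCoeffOn neg_pi_lt_pi
      (fun t => f t * Complex.exp (Complex.I * δ * t)) (-n) := by
  have hI : Icc (-Real.pi) Real.pi ⊆ Icc (-10) 10 :=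
    Icc_subset_Icc (by linarith [Real.pi_lt_four]) (by linarith [Real.pi_lt_four])
  rw [fourierInt_eq_setIntegral _ measurableSet_Icc hI hf, integral_Icc_eq_integral_Ioc,
    ← intervalIntegral.integral_of_le neg_pi_lt_pi.le, fourierCoeffOn_eq_integral,
    Complex.real_smul, ← mul_assoc]
  have h3 : (2 * Real.pi : ℂ) * ((1 / (Real.pi - -Real.pi) : ℝ) : ℂ) = 1 := by
    have := Complex.ofReal_ne_zero.2 Real.pi_ne_zero
    push_cast
    rw [sub_neg_eq_add, ← two_mul]
    field_simp
  rw [h3, one_mul]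
  refine intervalIntegral.integral_congr fun t _ => ?_
  simp only [neg_neg, fourier_coe_apply, smul_eq_mul]
  rw [mul_left_comm, ← Complex.exp_add]
  congr 2
  have := Complex.ofReal_ne_zero.2 Real.pi_ne_zero
  push_cast
  field_simp
  ring

/-- Parseval's identity. -/
theorem hasSum_norm_fourierInt_sq {f : LineL2} (hf : f ∈ supportedIn (Icc (-Real.pi) Real.pi)) :
    HasSum (fun n : ℤ => ‖fourierInt n f‖ ^ 2) (2 * Real.pi * ‖f‖ ^ 2) := by
  have h1 := hasSum_sq_fourierCoeffOn neg_pi_lt_pi ((Lp.memLp f).restrict _)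
  have h2 := ((Equiv.neg ℤ).hasSum_iff.2 h1).mul_left ((2 * Real.pi) ^ 2)
  have h3 : ∫ t in -Real.pi..Real.pi, ‖f t‖ ^ 2 = ‖f‖ ^ 2 := by
    rw [norm_sq_eq_integral, intervalIntegral.integral_of_le neg_pi_lt_pi.le,
      ← integral_Icc_eq_integral_Ioc]
    refine setIntegral_eq_integral_of_ae_compl_eq_zero ?_
    filter_upwards [(mem_supportedIn measurableSet_Icc).1 hf] with s hs h
    simp [hs h]
  rw [h3, smul_eq_mul, sub_neg_eq_add, ← two_mul] at h2
  have h4 : 2 * Real.pi * ‖f‖ ^ 2 = (2 * Real.pi) ^ 2 * ((2 * Real.pi)⁻¹ * ‖f‖ ^ 2) := by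
    have := Real.pi_pos
    field_simp
  rw [h4]
  refine h2.congr_fun fun n => ?_
  have h5 := fourierInt_int_add hf 0 n
  simp only [add_zero, mul_zero, zero_mul, Complex.exp_zero, mul_one] at h5
  rw [h5, norm_mul, norm_mul, RCLike.norm_ofNat, Complex.norm_real, Real.norm_eq_abs,
    abs_of_pos Real.pi_pos, mul_pow]
  rfl

/-- Bessel's inequality along a shifted lattice. -/
theorem sum_norm_fourierInt_sq_le {f : LineL2} (hf : f ∈ supportedIn (Icc (-Real.pi) Real.pi))
    (δ : ℂ) (s : Finset ℤ) :
    ∑ n ∈ s, ‖fourierInt (n + δ) f‖ ^ 2 ≤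
      2 * Real.pi * Real.exp (2 * Real.pi * |δ.im|) * ‖f‖ ^ 2 := by
  have hab := neg_pi_lt_pi
  set g : ℝ → ℂ := fun t => f t * Complex.exp (Complex.I * δ * t) with hg
  have hb : ∀ t ∈ Ioc (-Real.pi) Real.pi, ‖g t‖ ≤ Real.exp (|δ.im| * Real.pi) * ‖f t‖ := by
    intro t ht
    rw [hg, norm_mul, mul_comm]
    gcongr
    exact norm_exp_le (Ioc_subset_Icc_self ht)
  have hgm : MemLp g 2 (volume.restrict (Ioc (-Real.pi) Real.pi)) := by
    refine MemLp.of_le_mul (c := Real.exp (|δ.im| * Real.pi)) ((Lp.memLp f).restrict _) ?_ ?_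
    · exact (Lp.memLp f).1.restrict.mul (Continuous.aestronglyMeasurable (by fun_prop))
    · exact (ae_restrict_iff' measurableSet_Ioc).2 (Eventually.of_forall hb)
  have h1 := hasSum_sq_fourierCoeffOn hab hgm
  have h3 : ∫ t in -Real.pi..Real.pi, ‖g t‖ ^ 2 ≤ Real.exp (2 * Real.pi * |δ.im|) * ‖f‖ ^ 2 := by
    rw [norm_sq_eq_integral, intervalIntegral.integral_of_le hab.le, ← integral_const_mul]
    refine (setIntegral_mono_on ?_ ?_ measurableSet_Ioc fun t ht => ?_).trans
      (setIntegral_le_integral ((integrable_norm_sq f).const_mul _)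
        (Eventually.of_forall fun t => by positivity))
    · exact hgm.integrable_norm_pow two_ne_zero
    · exact ((integrable_norm_sq f).const_mul _).integrableOn
    · have h4 := hb t ht
      calc ‖g t‖ ^ 2 ≤ (Real.exp (|δ.im| * Real.pi) * ‖f t‖) ^ 2 := by gcongr
        _ = Real.exp (2 * Real.pi * |δ.im|) * ‖f t‖ ^ 2 := by
            rw [mul_pow, ← Real.exp_nat_mul]
            congr 2
            push_cast
            ring
  calc ∑ n ∈ s, ‖fourierInt (n + δ) f‖ ^ 2
      = (2 * Real.pi) ^ 2 * ∑ n ∈ s.map (Equiv.neg ℤ).toEmbedding,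
          ‖fourierCoeffOn hab g n‖ ^ 2 := by
        rw [Finset.sum_map, Finset.mul_sum]
        refine Finset.sum_congr rfl fun n _ => ?_
        rw [fourierInt_int_add hf, norm_mul, mul_pow]
        simp only [norm_mul, RCLike.norm_ofNat, Complex.norm_real, Real.norm_eq_abs,
          abs_of_pos Real.pi_pos]
        rfl
    _ ≤ (2 * Real.pi) ^ 2 * ((Real.pi - -Real.pi)⁻¹ • ∫ t in -Real.pi..Real.pi, ‖g t‖ ^ 2) := by
        gcongr
        exact sum_le_hasSum _ (fun _ _ => by positivity) h1
    _ ≤ (2 * Real.pi) ^ 2 *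
          ((2 * Real.pi)⁻¹ * (Real.exp (2 * Real.pi * |δ.im|) * ‖f‖ ^ 2)) := by
        rw [smul_eq_mul, sub_neg_eq_add, ← two_mul]
        gcongr
    _ = _ := by
        field_simp

/-- For a fixed angle the points on the circles form the shifted lattice `ℤ + 3 exp(iθ)`, to which
Bessel's inequality applies; then one integrates over the angle. The imaginary part of the shift is
at most `3`, whence the exponent `6π`. -/
theorem sum_localMass_fourierInt_le {f : LineL2} (hf : f ∈ supportedIn (Icc (-Real.pi) Real.pi))
    (s : Finset ℤ) : ∑ n ∈ s, localMass (fun ρ => fourierInt ρ f) n ≤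
      6 * Real.pi * Real.exp (6 * Real.pi) * ‖f‖ ^ 2 := by
  have hc : Continuous fun ρ => fourierInt ρ f := (differentiable_fourierInt f).continuous
  simp only [localMass]
  have hi : ∀ n ∈ s, IntervalIntegrable
      (fun θ => ‖fourierInt (circleMap (n : ℂ) 3 θ) f‖ ^ 2) volume 0 (2 * Real.pi) := fun n _ =>
    ((hc.comp (continuous_circleMap (n : ℂ) 3)).norm.pow 2).intervalIntegrable _ _
  rw [← Finset.mul_sum, ← intervalIntegral.integral_finsetSum hi]
  have h1 : ∀ θ ∈ Icc 0 (2 * Real.pi), ∑ n ∈ s, ‖fourierInt (circleMap (n : ℂ) 3 θ) f‖ ^ 2 ≤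
      2 * Real.pi * Real.exp (6 * Real.pi) * ‖f‖ ^ 2 := by
    intro θ _
    have h2 : ∀ n : ℤ, circleMap (n : ℂ) 3 θ = n + circleMap 0 3 θ := fun n => by simp [circleMap]
    simp only [h2]
    refine (sum_norm_fourierInt_sq_le hf _ s).trans ?_
    have h3 : |(circleMap 0 3 θ).im| ≤ 3 := (Complex.abs_im_le_norm _).trans (by simp)
    have h4 : 2 * Real.pi * |(circleMap 0 3 θ).im| ≤ 6 * Real.pi := by
      nlinarith [Real.pi_pos]
    gcongr
  have h5 := intervalIntegral.integral_mono_on (μ := volume) (a := 0) (b := 2 * Real.pi)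
    (by positivity) (Continuous.intervalIntegrable (continuous_finsetSum _ fun (n : ℤ) _ =>
      (hc.comp (continuous_circleMap (n : ℂ) 3)).norm.pow 2) _ _)
    intervalIntegrable_const h1
  rw [intervalIntegral.integral_const, smul_eq_mul, sub_zero] at h5
  calc _ ≤ 3 / (2 * Real.pi) *
        (2 * Real.pi * (2 * Real.pi * Real.exp (6 * Real.pi) * ‖f‖ ^ 2)) := by
          gcongr
          exact h5
    _ = _ := by
      field_simp
      ring

theorem summable_localMass_fourierInt {f : LineL2}
    (hf : f ∈ supportedIn (Icc (-Real.pi) Real.pi)) :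
    Summable fun n : ℤ => localMass (fun ρ => fourierInt ρ f) n :=
  summable_of_sum_le (fun _ => localMass_nonneg _ _) (sum_localMass_fourierInt_le hf)


/-! ### Asymptotics of the characteristic function -/

theorem exists_norm_eval_le (p : ℂ[X]) {d : ℕ} (hd : p.natDegree ≤ d) :
    ∃ C : ℝ, 0 ≤ C ∧ ∀ z : ℂ, 1 ≤ ‖z‖ → ‖p.eval z‖ ≤ C * ‖z‖ ^ d := by
  refine ⟨∑ i ∈ Finset.range (p.natDegree + 1), ‖p.coeff i‖, by positivity, fun z hz => ?_⟩
  rw [eval_eq_sum_range, Finset.sum_mul]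
  refine (norm_sum_le _ _).trans (Finset.sum_le_sum fun i hi => ?_)
  rw [norm_mul, norm_pow]
  gcongr
  have := Finset.mem_range.1 hi
  omega

theorem exists_le_norm_eval {p : ℂ[X]} (hp : p.Monic) :
    ∃ R : ℝ, 1 ≤ R ∧ ∀ z : ℂ, R ≤ ‖z‖ → 1 / 2 * ‖z‖ ^ p.natDegree ≤ ‖p.eval z‖ := by
  set A : ℝ := ∑ i ∈ Finset.range p.natDegree, ‖p.coeff i‖ with hA
  have hA0 : 0 ≤ A := by positivity
  refine ⟨1 + 2 * A, by linarith, fun z hz => ?_⟩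
  have hz1 : 1 ≤ ‖z‖ := by linarith
  have h1 : p.eval z = z ^ p.natDegree + ∑ i ∈ Finset.range p.natDegree, p.coeff i * z ^ i := by
    rw [eval_eq_sum_range, Finset.sum_range_succ, hp.coeff_natDegree, one_mul, add_comm]
  have h2 : ‖∑ i ∈ Finset.range p.natDegree, p.coeff i * z ^ i‖ * ‖z‖ ≤
      A * ‖z‖ ^ p.natDegree := by
    rw [hA, Finset.sum_mul]
    refine (mul_le_mul_of_nonneg_right (norm_sum_le _ _) (norm_nonneg z)).trans ?_
    rw [Finset.sum_mul]
    refine Finset.sum_le_sum fun i hi => ?_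
    rw [norm_mul, norm_pow, mul_assoc, ← pow_succ]
    gcongr
    exact Finset.mem_range.1 hi
  have h3 : ‖∑ i ∈ Finset.range p.natDegree, p.coeff i * z ^ i‖ ≤ 1 / 2 * ‖z‖ ^ p.natDegree := by
    have h4 : A ≤ 1 / 2 * ‖z‖ := by linarith
    refine le_of_mul_le_mul_right (h2.trans ?_) (one_pos.trans_le hz1)
    calc A * ‖z‖ ^ p.natDegree ≤ 1 / 2 * ‖z‖ * ‖z‖ ^ p.natDegree := by gcongr
      _ = _ := by ring
  rw [h1]
  have h5 := norm_sub_le_norm_add (z ^ p.natDegree)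
    (∑ i ∈ Finset.range p.natDegree, p.coeff i * z ^ i)
  rw [norm_pow] at h5
  linarith

section CharFun

variable {σ : ℝ → ℂ} {r₁ r₂ : ℂ[X]}

/-- The relative deviation of `charFun` from its leading term `-r₁(ρ²) ρ sin (ρ π)`. -/
def charRemainder (σ : ℝ → ℂ) (r₁ r₂ : ℂ[X]) (ρ : ℂ) : ℂ :=
  charFun σ r₁ r₂ (ρ ^ 2) / (r₁.eval (ρ ^ 2) * ρ) + Complex.sin (ρ * Real.pi)

theorem charFun_sq_eq {ρ : ℂ} (h₁ : r₁.eval (ρ ^ 2) ≠ 0) (h : ρ ≠ 0) :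
    charFun σ r₁ r₂ (ρ ^ 2) = r₁.eval (ρ ^ 2) * ρ *
      (charRemainder σ r₁ r₂ ρ - Complex.sin (ρ * Real.pi)) := by
  rw [charRemainder, add_sub_cancel_right, mul_div_cancel₀]
  exact mul_ne_zero h₁ h

/-- Inserting the representation of `φ` at `π` leaves, besides the Fourier integral of `l`, only
`C(π)/ρ` and `(r₂/r₁) φ(π)/ρ`. The quotient `r₂/r₁` is bounded for large `ρ` because `r₁` is monic
and `deg r₂ ≤ deg r₁`. -/
theorem exists_charFun_expansion (hσ : MemLp σ 2 (volume.restrict (Ioo 0 Real.pi)))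
    (hr : IsAdmissible r₁ r₂) :
    ∃ (k l : LineL2) (K R : ℝ), k ∈ supportedIn (Icc (-Real.pi) Real.pi) ∧
      l ∈ supportedIn (Icc (-Real.pi) Real.pi) ∧ 0 ≤ K ∧ 1 ≤ R ∧ ∀ ρ : ℂ, R ≤ ‖ρ‖ →
        1 / 2 * ‖ρ‖ ^ (2 * r₁.natDegree) ≤ ‖r₁.eval (ρ ^ 2)‖ ∧ r₁.eval (ρ ^ 2) ≠ 0 ∧
        ‖charRemainder σ r₁ r₂ ρ - fourierInt ρ l‖ ≤ K * Real.exp (|ρ.im| * Real.pi) / ‖ρ‖ ∧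
        (phi σ (ρ ^ 2)).1 Real.pi = Complex.cos (ρ * Real.pi) + fourierInt ρ k := by
  obtain ⟨C, k, l, hC, hkl, hφ⟩ := exists_phi_representation hσ
  obtain ⟨K, hK, hb⟩ := exists_solution_bounds hσ
  obtain ⟨A, hA, hA'⟩ := exists_norm_eval_le r₂ hr.natDegree_le
  obtain ⟨R, hR, hR'⟩ := exists_le_norm_eval hr.monic
  have hsup : ∀ {k : Curve LineL2}, (∀ x : Icc (0 : ℝ) Real.pi, k x ∈ supportedIn (Icc (-x) x)) →
      extend k Real.pi ∈ supportedIn (Icc (-Real.pi) Real.pi) := by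
    intro k h
    rw [extend, IccExtend_of_mem _ _ pi_mem]
    exact h ⟨Real.pi, pi_mem⟩
  refine ⟨extend k Real.pi, extend l Real.pi, ‖C Real.pi‖ + 2 * A * K, R,
    hsup fun x => (hkl x).1, hsup fun x => (hkl x).2, by positivity, hR, fun ρ hρ => ?_⟩
  have hρ1 : 1 ≤ ‖ρ‖ := hR.trans hρ
  have hρ0 : ρ ≠ 0 := norm_pos_iff.1 (one_pos.trans_le hρ1)
  have hsq : ‖ρ‖ ≤ ‖ρ ^ 2‖ := by
    rw [norm_pow]
    exact le_self_pow₀ hρ1 two_ne_zero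
  have h1 := hR' (ρ ^ 2) (hρ.trans hsq)
  have h2 := hA' (ρ ^ 2) (hρ1.trans hsq)
  rw [norm_pow, ← pow_mul] at h1 h2
  have hpos : 0 < ‖r₁.eval (ρ ^ 2)‖ := lt_of_lt_of_le (by positivity) h1
  obtain ⟨e1, e2⟩ := hφ ρ Real.pi pi_mem
  refine ⟨h1, norm_pos_iff.1 hpos, ?_, e1⟩
  have h3 : charRemainder σ r₁ r₂ ρ - fourierInt ρ (extend l Real.pi) =
      (C Real.pi + r₂.eval (ρ ^ 2) / r₁.eval (ρ ^ 2) * (phi σ (ρ ^ 2)).1 Real.pi) / ρ := by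
    have := norm_pos_iff.1 hpos
    rw [charRemainder, charFun, e2]
    field_simp
    ring
  rw [h3, norm_div]
  gcongr
  refine (norm_add_le _ _).trans ?_
  rw [add_mul]
  have hE : 1 ≤ Real.exp (|ρ.im| * Real.pi) :=
    Real.one_le_exp (mul_nonneg (abs_nonneg _) Real.pi_pos.le)
  refine add_le_add (le_mul_of_one_le_right (norm_nonneg _) hE) ?_
  rw [norm_mul, norm_div, mul_assoc]
  gcongr
  · rw [div_le_iff₀ hpos]
    calc ‖r₂.eval (ρ ^ 2)‖ ≤ A * ‖ρ‖ ^ (2 * r₁.natDegree) := h2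
      _ = 2 * A * (1 / 2 * ‖ρ‖ ^ (2 * r₁.natDegree)) := by ring
      _ ≤ _ := by gcongr
  · exact (hb ρ hρ1 Real.pi pi_mem).1

theorem norm_sin_sq (z : ℂ) :
    ‖Complex.sin z‖ ^ 2 = Real.sin z.re ^ 2 + Real.sinh z.im ^ 2 := by
  have h : Complex.sin z = (Real.sin z.re * Real.cosh z.im : ℝ) +
      (Real.cos z.re * Real.sinh z.im : ℝ) * Complex.I := by
    rw [Complex.sin_eq]
    push_cast
    rfl
  rw [Complex.sq_norm, h, Complex.normSq_add_mul_I]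
  have h1 := Real.cosh_sq z.im
  have h2 := Real.sin_sq_add_cos_sq z.re
  linear_combination Real.sin z.re ^ 2 * h1 + Real.sinh z.im ^ 2 * h2

/-- For `|Im ρ| ≥ 1/4` the hyperbolic term alone is large enough. For smaller `|Im ρ|` the condition
on `|ρ|` places `|Re ρ|` within `1/8` of `N + 1/2`, where the sine of `π Re ρ` is close to `±1`. -/
theorem quarter_exp_le_norm_sin {ρ : ℂ} {N : ℕ} (h : ‖ρ‖ = N + 1 / 2) :
    1 / 4 * Real.exp (|ρ.im| * Real.pi) ≤ ‖Complex.sin (ρ * Real.pi)‖ := by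
  have hsq := norm_sin_sq (ρ * Real.pi)
  have hre : (ρ * Real.pi).re = ρ.re * Real.pi := by simp
  have him : (ρ * Real.pi).im = ρ.im * Real.pi := by simp
  rw [hre, him] at hsq
  set E := Real.exp (|ρ.im| * Real.pi) with hE
  have hE1 : 1 ≤ E := Real.one_le_exp (mul_nonneg (abs_nonneg _) Real.pi_pos.le)
  have hsinh : Real.sinh (ρ.im * Real.pi) ^ 2 = ((E - E⁻¹) / 2) ^ 2 := by
    rw [hE, ← Real.exp_neg, ← Real.sinh_eq, ← sq_abs, Real.abs_sinh, abs_mul,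
      abs_of_pos Real.pi_pos]
  have hEi : E * E⁻¹ = 1 := mul_inv_cancel₀ (by positivity)
  have hEi0 : 0 < E⁻¹ := by positivity
  refine le_of_sq_le_sq ?_ (norm_nonneg _)
  rw [hsq, hsinh]
  by_cases hb : 1 / 4 ≤ |ρ.im|
  · have h2 : 7 / 4 ≤ E := by
      have := Real.add_one_le_exp (|ρ.im| * Real.pi)
      nlinarith [Real.pi_gt_three]
    have h3 : E⁻¹ ≤ 4 / 7 := by
      rw [show (4 / 7 : ℝ) = (7 / 4)⁻¹ by norm_num]
      gcongr
    have h4 : 1 / 4 * E ≤ (E - E⁻¹) / 2 := by linarith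
    have h5 : (1 / 4 * E) ^ 2 ≤ ((E - E⁻¹) / 2) ^ 2 := by gcongr
    linarith [sq_nonneg (Real.sin (ρ.re * Real.pi))]
  · push Not at hb
    have h1 : ρ.re ^ 2 + ρ.im ^ 2 = (N + 1 / 2) ^ 2 := by
      rw [← h, Complex.sq_norm, Complex.normSq_apply]
      ring
    have h2 : |ρ.re| ≤ N + 1 / 2 := by
      rw [← h]
      exact Complex.abs_re_le_norm ρ
    have h3 : ρ.im ^ 2 ≤ 1 / 16 := by
      rw [← sq_abs]
      nlinarith [abs_nonneg ρ.im]
    have h4 : (N : ℝ) + 1 / 2 - |ρ.re| ≤ 1 / 8 := by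
      have h5 : (N + 1 / 2 - |ρ.re|) * (N + 1 / 2 + |ρ.re|) ≤ 1 / 16 := by
        have := sq_abs ρ.re
        nlinarith
      have hN : (0 : ℝ) ≤ N := N.cast_nonneg
      nlinarith [abs_nonneg ρ.re]
    have h5 : Real.sin (ρ.re * Real.pi) ^ 2 = Real.cos ((N + 1 / 2 - |ρ.re|) * Real.pi) ^ 2 := by
      have h6 : Real.sin (|ρ.re| * Real.pi) ^ 2 = Real.sin (ρ.re * Real.pi) ^ 2 := by
        rcases abs_choice ρ.re with h7 | h7 <;> rw [h7]
        rw [neg_mul, Real.sin_neg, neg_sq]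
      rw [← h6, show |ρ.re| * Real.pi = (Real.pi / 2 - (N + 1 / 2 - |ρ.re|) * Real.pi) +
        N * Real.pi by ring, Real.sin_add_nat_mul_pi, Real.sin_pi_div_two_sub, mul_pow, ← pow_mul,
        mul_comm N, pow_mul]
      simp
    set u := (N + 1 / 2 - |ρ.re|) * Real.pi with hu
    have hu0 : 0 ≤ u := mul_nonneg (by linarith) Real.pi_pos.le
    have hu1 : u ≤ 1 / 2 := by nlinarith [Real.pi_lt_four, Real.pi_pos]
    have h6 := Real.one_sub_sq_div_two_le_cos (x := u)
    have h7 : 7 / 8 ≤ Real.cos u := by nlinarith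
    rw [h5]
    have h8 : (7 / 8 : ℝ) ^ 2 ≤ Real.cos u ^ 2 := by gcongr
    nlinarith [sq_nonneg E, sq_nonneg E⁻¹]

/-- On these circles the sine is at least a quarter of the exponential, while the Riemann–Lebesgue
lemma and the `1/ρ` term keep the remainder below an eighth of it. The other factor `1/2` in `1/16`
comes from the lower bound for `r₁`. -/
theorem eventually_charFun_ge (hσ : MemLp σ 2 (volume.restrict (Ioo 0 Real.pi)))
    (hr : IsAdmissible r₁ r₂) :
    ∀ᶠ N : ℕ in atTop, ∀ ρ : ℂ, ‖ρ‖ = N + 1 / 2 →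
      1 / 16 * ‖ρ‖ ^ (2 * r₁.natDegree + 1) * Real.exp (|ρ.im| * Real.pi) ≤
        ‖charFun σ r₁ r₂ (ρ ^ 2)‖ := by
  obtain ⟨k, l, K, R, -, hl, hK, hR, hW⟩ := exists_charFun_expansion hσ hr
  have h1 := eventually_norm_fourierInt_le hl (ε := 1 / 16) (by norm_num)
  rw [Filter.HasBasis.eventually_iff (Filter.HasBasis.cobounded_of_norm atTop_basis)] at h1
  obtain ⟨R', -, hR'⟩ := h1
  filter_upwards [tendsto_natCast_atTop_atTop.eventually_ge_atTop (max R (max R' (16 * K)))]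
    with N hN ρ hρ
  have hN1 : R ≤ ‖ρ‖ := by linarith [le_max_left R (max R' (16 * K))]
  have hN2 : R' ≤ ‖ρ‖ := by
    linarith [le_max_right R (max R' (16 * K)), le_max_left R' (16 * K)]
  have hN3 : 16 * K ≤ ‖ρ‖ := by
    linarith [le_max_right R (max R' (16 * K)), le_max_right R' (16 * K)]
  have hρ0 : 0 < ‖ρ‖ := by linarith
  obtain ⟨g1, g2, g3, -⟩ := hW ρ hN1
  have g4 := hR' (mem_preimage.2 (mem_Ici.2 hN2))
  have g5 := quarter_exp_le_norm_sin hρ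
  set E := Real.exp (|ρ.im| * Real.pi) with hE
  have hE0 : 0 ≤ E := (Real.exp_pos _).le
  have g6 : K * E / ‖ρ‖ ≤ 1 / 16 * E := by
    rw [div_le_iff₀ hρ0]
    nlinarith
  have g7 : ‖charRemainder σ r₁ r₂ ρ‖ ≤ 1 / 8 * E := by
    have := norm_add_le (charRemainder σ r₁ r₂ ρ - fourierInt ρ l) (fourierInt ρ l)
    rw [sub_add_cancel] at this
    linarith
  have g8 : 1 / 8 * E ≤ ‖charRemainder σ r₁ r₂ ρ - Complex.sin (ρ * Real.pi)‖ := by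
    have := norm_sub_norm_le (Complex.sin (ρ * Real.pi)) (charRemainder σ r₁ r₂ ρ)
    rw [norm_sub_rev] at this
    linarith
  rw [charFun_sq_eq g2 (norm_pos_iff.1 hρ0), norm_mul, norm_mul, pow_succ]
  calc 1 / 16 * (‖ρ‖ ^ (2 * r₁.natDegree) * ‖ρ‖) * E =
      1 / 2 * ‖ρ‖ ^ (2 * r₁.natDegree) * ‖ρ‖ * (1 / 8 * E) := by ring
    _ ≤ _ := by gcongr

end CharFun


/-! ### Asymptotics of the spectral data -/

theorem rho_sq_of_re_pos {w : ℂ} (h : 0 < w.re) : rho (w ^ 2) = w := by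
  rw [rho, map_pow, Complex.sq_cpow_two_inv (by simpa using h), Complex.conj_conj]

theorem rho_modelLam {M n : ℕ} (h : M < n) : rho (modelLam M n) = n - M := by
  rw [modelLam, if_neg (not_le.2 h), rho_sq_of_re_pos]
  simpa using h

theorem block_of_simple {lam : ℕ → ℂ} {n : ℕ} (h : ∀ k, lam k = lam n → k = n) :
    blockStart lam n = n ∧ pos lam n = 0 ∧ mult lam n = 1 := by
  have h1 : {k | lam k = lam n} = {n} := by
    ext k
    exact ⟨h k, fun h => by rw [mem_singleton_iff.1 h]; rfl⟩
  have h2 : blockStart lam n = n := by rw [blockStart, h1, csInf_singleton]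
  exact ⟨h2, by rw [pos, h2, Nat.sub_self], by rw [mult, h1, ncard_singleton]⟩

section Data

variable {σ : ℝ → ℂ} {r₁ r₂ : ℂ[X]} {lam α : ℕ → ℂ}

theorem IsSpectralData.charFun_eq_zero (h : IsSpectralData σ r₁ r₂ lam α) (n : ℕ) :
    charFun σ r₁ r₂ (lam n) = 0 := by
  refine (analyticOrderAt_ne_zero.1 ?_).2
  rw [← h.count]
  exact (Set.encard_ne_zero.2 ⟨n, rfl⟩)

theorem IsSpectralData.tendsto_norm_rho (h : IsSpectralData σ r₁ r₂ lam α) :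
    Tendsto (fun n => ‖rho (lam n)‖) atTop atTop := by
  have h1 : Tendsto (fun n : ℕ => (n : ℝ) - r₁.natDegree - 1) atTop atTop :=
    tendsto_atTop_add_const_right _ _ (tendsto_atTop_add_const_right _ _
      tendsto_natCast_atTop_atTop)
  refine tendsto_atTop_mono' _ ?_ h1
  filter_upwards [h.asymptotics.norm.eventually (gt_mem_nhds (by simp : ‖(0 : ℂ)‖ < 1))] with n hn
  have h2 := norm_sub_norm_le ((n : ℂ) - r₁.natDegree) (rho (lam n))
  have h3 : (n : ℝ) - r₁.natDegree ≤ ‖(n : ℂ) - r₁.natDegree‖ := by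
    have := Complex.re_le_norm ((n : ℂ) - r₁.natDegree)
    simpa using this
  rw [norm_sub_rev _ (rho (lam n))] at h2
  linarith

/-- Two late indices with equal values would give integers at distance less than `1`. Early indices
are excluded because `|rho|` tends to infinity. -/
theorem IsSpectralData.eventually_simple (h : IsSpectralData σ r₁ r₂ lam α) :
    ∀ᶠ n in atTop, ∀ k, lam k = lam n → k = n := by
  have h1 := h.asymptotics.norm.eventually (gt_mem_nhds (by simp : ‖(0 : ℂ)‖ < 1 / 2))
  obtain ⟨n₁, hn₁⟩ := eventually_atTop.1 h1
  have h2 := h.tendsto_norm_rho.eventually_gt_atTop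
    (∑ k ∈ Finset.range n₁, ‖rho (lam k)‖)
  filter_upwards [h2, eventually_ge_atTop n₁] with n hn hn' k hk
  rcases lt_or_ge k n₁ with hk' | hk'
  · rw [← hk] at hn
    exact absurd (Finset.single_le_sum (f := fun k => ‖rho (lam k)‖) (fun _ _ => norm_nonneg _)
      (Finset.mem_range.2 hk')) (not_le.2 hn)
  · have h3 := hn₁ n hn'
    have h8 := norm_sub_le (rho (lam n) - ((n : ℂ) - r₁.natDegree))
      (rho (lam n) - ((k : ℂ) - r₁.natDegree))
    have h4 := hn₁ k hk'
    rw [hk] at h4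
    have h5 : ‖(k : ℂ) - n‖ < 1 := by
      calc ‖(k : ℂ) - n‖ = ‖(rho (lam n) - (n - r₁.natDegree)) -
          (rho (lam n) - (k - r₁.natDegree))‖ := by congr 1; ring
        _ < 1 := by linarith
    have h6 : ‖(((k : ℤ) - n : ℤ) : ℂ)‖ < 1 := by push_cast; exact h5
    rw [Complex.norm_intCast] at h6
    have h7 : |(k : ℤ) - n| < 1 := by exact_mod_cast h6
    have := Int.abs_lt_one_iff.1 h7
    omega

/-- Multiply the expansion of `M = -weylNum / charFun` at the simple eigenvalue by `charFun` and
pass to the limit: the difference quotient tends to the derivative and the regular part disappears.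
-/
theorem IsSpectralData.alpha_mul_deriv (hσ : MemLp σ 2 (volume.restrict (Ioo 0 Real.pi)))
    (h : IsSpectralData σ r₁ r₂ lam α) {n : ℕ} (hn : ∀ k, lam k = lam n → k = n) :
    α n * deriv (charFun σ r₁ r₂) (lam n) = -weylNum σ r₁ r₂ (lam n) := by
  obtain ⟨-, h1, h2⟩ := block_of_simple hn
  obtain ⟨g, hg, hw⟩ := h.principalPart n h1
  rw [h2] at hw
  have hd := differentiable_charFun hσ r₁ r₂
  -- Vanishing near the point would mean infinite order, but the order counts the occurrences of the
  -- eigenvalue, here one.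
  have hne : ∀ᶠ z in 𝓝[≠] (lam n), charFun σ r₁ r₂ z ≠ 0 := by
    refine (hd.analyticAt _).eventually_eq_zero_or_eventually_ne_zero.resolve_left fun h3 => ?_
    have h4 := h.count (lam n)
    rw [analyticOrderAt_eq_top.2 h3, show {k | lam k = lam n} = {n} from
      Set.ext fun k => ⟨hn k, fun h => by rw [mem_singleton_iff.1 h]; rfl⟩,
      encard_singleton] at h4
    exact absurd h4 (by simp)
  have t1 : Tendsto (fun z => α n * slope (charFun σ r₁ r₂) (lam n) z +
      charFun σ r₁ r₂ z * g z) (𝓝[≠] (lam n)) (𝓝 (α n * deriv (charFun σ r₁ r₂) (lam n) +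
      charFun σ r₁ r₂ (lam n) * g (lam n))) :=
    ((hasDerivAt_iff_tendsto_slope.1 (hd _).hasDerivAt).const_mul _).add
      (((hd.continuous.tendsto _).mono_left nhdsWithin_le_nhds).mul
        (hg.continuousAt.tendsto.mono_left nhdsWithin_le_nhds))
  have t2 : Tendsto (fun z => -weylNum σ r₁ r₂ z) (𝓝[≠] (lam n))
      (𝓝 (-weylNum σ r₁ r₂ (lam n))) :=
    ((differentiable_weylNum hσ r₁ r₂).continuous.neg.tendsto _).mono_left nhdsWithin_le_nhds
  have t3 := tendsto_nhds_unique (t1.congr' ?_) t2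
  · rw [← t3, h.charFun_eq_zero n, zero_mul, add_zero]
  · filter_upwards [hw, hne, self_mem_nhdsWithin] with z h3 h4 h5
    have h6 : z - lam n ≠ 0 := sub_ne_zero.2 h5
    rw [weyl_eq hσ] at h3
    simp only [Finset.sum_range_one, add_zero, zero_add, pow_one] at h3
    rw [slope_def_field, h.charFun_eq_zero n, sub_zero]
    field_simp at h3 ⊢
    linear_combination -h3

theorem differentiableAt_charRemainder (hσ : MemLp σ 2 (volume.restrict (Ioo 0 Real.pi)))
    {ρ : ℂ} (h₁ : r₁.eval (ρ ^ 2) ≠ 0) (h : ρ ≠ 0) :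
    DifferentiableAt ℂ (charRemainder σ r₁ r₂) ρ := by
  have hd := differentiable_charFun hσ r₁ r₂
  have hr : Differentiable ℂ fun z => r₁.eval z := r₁.differentiable
  have e1 : DifferentiableAt ℂ (fun ρ : ℂ => ρ ^ 2) ρ := by fun_prop
  refine DifferentiableAt.add (DifferentiableAt.div ?_ ?_ (mul_ne_zero h₁ h)) (by fun_prop)
  · exact (hd (ρ ^ 2)).comp ρ e1
  · exact ((hr (ρ ^ 2)).comp ρ e1).mul differentiableAt_id

/-- The Fourier integrals are controlled on whole discs by `localMass`, which is summable over the
lattice, and the other error is of order `1/n`. The radius `2` leaves room for a Cauchy estimate on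
the unit disc around an eigenvalue. -/
theorem exists_charRemainder_le (hσ : MemLp σ 2 (volume.restrict (Ioo 0 Real.pi)))
    (hr : IsAdmissible r₁ r₂) : ∃ β : ℕ → ℝ, (∀ n, 0 ≤ β n) ∧ (Summable fun n => β n ^ 2) ∧
      ∀ᶠ n : ℕ in atTop, ∀ w : ℂ, ‖w - ((n : ℂ) - r₁.natDegree)‖ ≤ 2 →
        w ≠ 0 ∧ r₁.eval (w ^ 2) ≠ 0 ∧ ‖charRemainder σ r₁ r₂ w‖ ≤ β n ∧
        ‖(phi σ (w ^ 2)).1 Real.pi - Complex.cos (w * Real.pi)‖ ≤ β n := by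
  obtain ⟨k, l, K, R, hk, hl, hK, hR, hW⟩ := exists_charFun_expansion hσ hr
  have hsum : ∀ {f : LineL2}, f ∈ supportedIn (Icc (-Real.pi) Real.pi) → Summable fun n : ℕ =>
      localMass (fun ρ => fourierInt ρ f) ((n : ℂ) - r₁.natDegree) := by
    intro f hf
    have h1 := (summable_localMass_fourierInt hf).comp_injective
      (i := fun n : ℕ => (n : ℤ) - r₁.natDegree) (fun a b h => by simpa using h)
    simpa [Function.comp_def] using h1
  set a : ℕ → ℝ := fun n => localMass (fun ρ => fourierInt ρ l) ((n : ℂ) - r₁.natDegree)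
  set b : ℕ → ℝ := fun n => localMass (fun ρ => fourierInt ρ k) ((n : ℂ) - r₁.natDegree)
  have ha : ∀ n, 0 ≤ a n := fun n => localMass_nonneg _ _
  have hb : ∀ n, 0 ≤ b n := fun n => localMass_nonneg _ _
  set c : ℝ := K * Real.exp (2 * Real.pi) * 2
  have hc : 0 ≤ c := by positivity
  refine ⟨fun n => √(a n) + √(b n) + c / n, fun n => by positivity, ?_, ?_⟩
  · have h1 : Summable fun n : ℕ => 3 * (a n + b n + c ^ 2 * (1 / (n : ℝ) ^ 2)) :=
      (((hsum hl).add (hsum hk)).add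
        ((Real.summable_one_div_nat_pow.2 one_lt_two).mul_left _)).mul_left 3
    refine h1.of_nonneg_of_le (fun n => by positivity) fun n => ?_
    have e1 := Real.sq_sqrt (ha n)
    have e2 := Real.sq_sqrt (hb n)
    have e3 : c ^ 2 * (1 / (n : ℝ) ^ 2) = (c / n) ^ 2 := by ring
    rw [e3]
    nlinarith [sq_nonneg (√(a n) - √(b n)), sq_nonneg (√(a n) - c / n),
      sq_nonneg (√(b n) - c / n)]
  · filter_upwards [tendsto_natCast_atTop_atTop.eventually_ge_atTop
      (2 * R + 2 * r₁.natDegree + 4 : ℝ)] with n hn w hw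
    have hn0 : (0 : ℝ) < n := by
      have : (0 : ℝ) ≤ r₁.natDegree := Nat.cast_nonneg _
      linarith
    have h1 : (n : ℝ) / 2 + R ≤ ‖w‖ + R := by
      have h2 := norm_sub_norm_le ((n : ℂ) - r₁.natDegree) w
      have h3 : (n : ℝ) - r₁.natDegree ≤ ‖(n : ℂ) - r₁.natDegree‖ := by
        have := Complex.re_le_norm ((n : ℂ) - r₁.natDegree)
        simpa using this
      rw [norm_sub_rev _ w] at h2
      linarith
    have h2 : R ≤ ‖w‖ := by
      have : (0 : ℝ) ≤ r₁.natDegree := Nat.cast_nonneg _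
      linarith
    have hw0 : 0 < ‖w‖ := by linarith
    obtain ⟨-, g2, g3, g4⟩ := hW w h2
    refine ⟨norm_pos_iff.1 hw0, g2, ?_, ?_⟩
    · have g5 : ‖fourierInt w l‖ ≤ √(a n) :=
        Real.le_sqrt_of_sq_le (norm_sq_le_localMass (differentiable_fourierInt l) hw)
      have him : |w.im| ≤ 2 := by
        have h3 := (Complex.abs_im_le_norm (w - ((n : ℂ) - r₁.natDegree))).trans hw
        simpa using h3
      have g6 : K * Real.exp (|w.im| * Real.pi) / ‖w‖ ≤ c / n := by
        calc K * Real.exp (|w.im| * Real.pi) / ‖w‖ ≤ K * Real.exp (2 * Real.pi) / (n / 2) := by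
              have := Real.pi_pos
              gcongr
              linarith
          _ = c / n := by
              simp only [c]
              field_simp
      have := norm_add_le (charRemainder σ r₁ r₂ w - fourierInt w l) (fourierInt w l)
      rw [sub_add_cancel] at this
      linarith [Real.sqrt_nonneg (b n)]
    · rw [g4, add_sub_cancel_left]
      have g5 : ‖fourierInt w k‖ ≤ √(b n) :=
        Real.le_sqrt_of_sq_le (norm_sq_le_localMass (differentiable_fourierInt k) hw)
      have : 0 ≤ c / n := by positivity
      linarith [Real.sqrt_nonneg (a n)]

theorem eventually_norm_le_two_mul_norm_sin :
    ∀ᶠ w : ℂ in 𝓝 0, ‖w‖ ≤ 2 * ‖Complex.sin w‖ := by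
  have h := (hasDerivAt_iff_isLittleO.1 (Complex.hasDerivAt_sin 0)).def
    (show (0 : ℝ) < 1 / 2 by norm_num)
  filter_upwards [h] with w hw
  simp only [Complex.sin_zero, sub_zero, Complex.cos_zero, smul_eq_mul, mul_one] at hw
  have := norm_sub_norm_le w (Complex.sin w)
  rw [norm_sub_rev] at this
  linarith

/-- At an eigenvalue `sin(πρ)` equals the remainder, so the distance of `ρ` to the integer is of the
size of the remainder. For `α`, the `ρ`-derivative of `charFun (ρ ^ 2)`, `alpha_mul_deriv` and
`weylNum_mul_phi` combine into `α (W' - π cos(πρ)) (cos(πρ) + κ) = -2`. Here `W'` and `κ` are small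
and `cos² = 1 - sin²` is nearly `1`, so `α` is close to `2/π`. -/
theorem IsSpectralData.exists_summable_bound (hσ : MemLp σ 2 (volume.restrict (Ioo 0 Real.pi)))
    (hr : IsAdmissible r₁ r₂) (h : IsSpectralData σ r₁ r₂ lam α) :
    ∃ β : ℕ → ℝ, (Summable fun n => β n ^ 2) ∧
      ∀ᶠ n : ℕ in atTop, ‖rho (lam n) - ((n : ℂ) - r₁.natDegree)‖ ≤ β n ∧
        ‖α n - 2 / Real.pi‖ ≤ β n := by
  obtain ⟨β, hβ0, hβ, hb⟩ := exists_charRemainder_le hσ hr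
  refine ⟨fun n => 20 * β n, by simpa [mul_pow] using hβ.mul_left (20 ^ 2), ?_⟩
  have hβt : Tendsto β atTop (𝓝 0) := by
    have h1 := hβ.tendsto_atTop_zero.sqrt
    simpa [Real.sqrt_sq (hβ0 _)] using h1
  have hε := h.asymptotics
  have hsin : ∀ᶠ n : ℕ in atTop, ‖(rho (lam n) - ((n : ℂ) - r₁.natDegree)) * Real.pi‖ ≤
      2 * ‖Complex.sin ((rho (lam n) - ((n : ℂ) - r₁.natDegree)) * Real.pi)‖ := by
    have h1 := hε.mul_const (Real.pi : ℂ)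
    rw [zero_mul] at h1
    exact h1.eventually eventually_norm_le_two_mul_norm_sin
  -- The threshold `1/50` makes `16 * β n` smaller than `1`, so that the product `P` introduced
  -- below, which is close to `-π`, has modulus at least `2`.
  filter_upwards [hb, hsin, hε.norm.eventually (gt_mem_nhds (by simp : ‖(0 : ℂ)‖ < 1)),
    hβt.eventually (gt_mem_nhds (by norm_num : (0 : ℝ) < 1 / 50)), h.eventually_simple]
    with n hb hsin hε hβ1 hsimple
  set ρ := rho (lam n) with hρ
  have hρsq : ρ ^ 2 = lam n := rho_sq _
  set z : ℂ := (n : ℂ) - r₁.natDegree with hz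
  obtain ⟨hρ0, hr0, hW, hφ⟩ := hb ρ (by linarith)
  have h0 := h.charFun_eq_zero n
  have hs : Complex.sin (ρ * Real.pi) = charRemainder σ r₁ r₂ ρ := by
    have h1 := charFun_sq_eq (σ := σ) (r₂ := r₂) hr0 hρ0
    rw [hρsq, h0, ← hρsq, zero_eq_mul] at h1
    exact (sub_eq_zero.1 (h1.resolve_left (mul_ne_zero hr0 hρ0))).symm
  have hs' : ‖Complex.sin ((ρ - z) * Real.pi)‖ = ‖Complex.sin (ρ * Real.pi)‖ := by
    have h1 : (ρ - z) * Real.pi = ρ * Real.pi + (r₁.natDegree - (n : ℤ) : ℤ) * Real.pi := by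
      rw [hz]
      push_cast
      ring
    rw [h1, Complex.sin_antiperiodic.add_int_mul_eq, norm_mul]
    rcases Int.units_eq_one_or (Int.negOnePow (r₁.natDegree - (n : ℤ))) with h2 | h2 <;>
      simp [h2]
  constructor
  · rw [hs', hs, norm_mul, Complex.norm_real, Real.norm_of_nonneg Real.pi_pos.le] at hsin
    nlinarith [Real.pi_gt_three, norm_nonneg (ρ - z), hβ0 n]
  · have hdiff : DifferentiableOn ℂ (charRemainder σ r₁ r₂) (closure (Metric.ball ρ 1)) := by
      intro w hw
      rw [closure_ball ρ one_ne_zero] at hw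
      have h1 : ‖w - ρ‖ ≤ 1 := mem_closedBall_iff_norm.1 hw
      have h2 : ‖w - z‖ ≤ 2 := by
        have := norm_add_le (w - ρ) (ρ - z)
        rw [sub_add_sub_cancel] at this
        linarith
      obtain ⟨h3, h4, -⟩ := hb w h2
      exact (differentiableAt_charRemainder hσ h4 h3).differentiableWithinAt
    have hW' : ‖deriv (charRemainder σ r₁ r₂) ρ‖ ≤ β n := by
      have h1 := Complex.norm_deriv_le_of_forall_mem_sphere_norm_le one_pos hdiff.diffContOnCl
        (C := β n) fun w hw => (hb w ?_).2.2.1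
      · rwa [div_one] at h1
      · have h1 : ‖w - ρ‖ = 1 := mem_sphere_iff_norm.1 hw
        have := norm_add_le (w - ρ) (ρ - z)
        rw [sub_add_sub_cancel] at this
        linarith
    set W' := deriv (charRemainder σ r₁ r₂) ρ with hW'def
    have hX1 : HasDerivAt (fun w => charFun σ r₁ r₂ (w ^ 2))
        (deriv (charFun σ r₁ r₂) (lam n) * (2 * ρ)) ρ := by
      have h1 : HasDerivAt (charFun σ r₁ r₂) (deriv (charFun σ r₁ r₂) (lam n)) (ρ ^ 2) := by
        rw [hρsq]
        exact (differentiable_charFun hσ r₁ r₂ _).hasDerivAt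
      have h2 : HasDerivAt (fun w : ℂ => w ^ 2) (2 * ρ) ρ := by simpa using hasDerivAt_pow 2 ρ
      exact h1.comp ρ h2
    have hX2 : HasDerivAt (fun w => charFun σ r₁ r₂ (w ^ 2))
        (r₁.eval (ρ ^ 2) * ρ * (W' - Complex.cos (ρ * Real.pi) * Real.pi)) ρ := by
      have h1 : HasDerivAt (fun w : ℂ => charRemainder σ r₁ r₂ w - Complex.sin (w * Real.pi))
          (W' - Complex.cos (ρ * Real.pi) * Real.pi) ρ := by
        refine (differentiableAt_charRemainder hσ hr0 hρ0).hasDerivAt.sub ?_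
        have h2 : HasDerivAt (fun w : ℂ => w * Real.pi) (Real.pi : ℂ) ρ := by
          simpa using (hasDerivAt_id ρ).mul_const (Real.pi : ℂ)
        exact h2.csin
      have h3 : Differentiable ℂ fun w : ℂ => r₁.eval (w ^ 2) * w := by
        have h4 : Differentiable ℂ fun z => r₁.eval z := r₁.differentiable
        exact (h4.comp (by fun_prop : Differentiable ℂ fun w : ℂ => w ^ 2)).mul differentiable_id
      have h4 := (h3 ρ).hasDerivAt.mul h1
      rw [hs, sub_self, mul_zero, zero_add] at h4
      refine h4.congr_of_eventuallyEq ?_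
      filter_upwards [Metric.ball_mem_nhds ρ one_pos] with w hw
      have h2 : ‖w - z‖ ≤ 2 := by
        have := norm_add_le (w - ρ) (ρ - z)
        rw [sub_add_sub_cancel] at this
        linarith [mem_ball_iff_norm.1 hw]
      obtain ⟨h5, h6, -⟩ := hb w h2
      exact charFun_sq_eq h6 h5
    have hX := hX1.unique hX2
    have ha := h.alpha_mul_deriv hσ hsimple
    have hwφ := weylNum_mul_phi hσ r₁ r₂ (lam n)
    rw [h0, mul_zero, add_zero, ← hρsq] at hwφ
    rw [← hρsq] at ha hX
    set c := Complex.cos (ρ * Real.pi) with hc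
    set s := Complex.sin (ρ * Real.pi) with hsdef
    set κ := (phi σ (ρ ^ 2)).1 Real.pi - c with hκ
    have hφ2 : (phi σ (ρ ^ 2)).1 Real.pi = c + κ := by rw [hκ]; ring
    rw [hφ2] at hwφ
    have hP : α n * ((W' - c * Real.pi) * (c + κ)) = -2 := by
      refine mul_left_cancel₀ (mul_ne_zero hr0 hρ0) ?_
      linear_combination (-α n * (c + κ)) * hX + 2 * ρ * (c + κ) * ha - 2 * ρ * hwφ
    have hcs : s ^ 2 + c ^ 2 = 1 := Complex.sin_sq_add_cos_sq _
    have hβn := hβ0 n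
    rw [← hs] at hW
    have hcn : ‖c‖ ≤ 2 := by
      have h1 : ‖c‖ ^ 2 ≤ 2 ^ 2 := by
        rw [← norm_pow, show c ^ 2 = 1 - s ^ 2 by linear_combination hcs]
        refine (norm_sub_le _ _).trans ?_
        rw [norm_one, norm_pow]
        nlinarith [norm_nonneg s]
      exact abs_le_of_sq_le_sq' h1 (by norm_num) |>.2
    have hP2 : ‖(W' - c * Real.pi) * (c + κ) + Real.pi‖ ≤ 16 * β n := by
      have h1 : (W' - c * Real.pi) * (c + κ) + Real.pi =
          Real.pi * s ^ 2 - Real.pi * (c * κ) + W' * c + W' * κ := by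
        linear_combination (Real.pi : ℂ) * hcs.symm
      have hpi : ‖(Real.pi : ℂ)‖ = Real.pi := by
        rw [Complex.norm_real, Real.norm_of_nonneg Real.pi_pos.le]
      have b1 : ‖(Real.pi : ℂ) * s ^ 2‖ ≤ 4 * (β n * (1 / 50)) := by
        rw [norm_mul, norm_pow, hpi, sq]
        have := Real.pi_lt_four
        gcongr
        linarith
      have b2 : ‖(Real.pi : ℂ) * (c * κ)‖ ≤ 4 * (2 * β n) := by
        rw [norm_mul, norm_mul, hpi]
        have := Real.pi_lt_four
        gcongr
      have b3 : ‖W' * c‖ ≤ β n * 2 := by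
        rw [norm_mul]
        gcongr
      have b4 : ‖W' * κ‖ ≤ β n * (1 / 50) := by
        rw [norm_mul]
        gcongr
        linarith
      rw [h1]
      have := norm_add_le (Real.pi * s ^ 2 - Real.pi * (c * κ) + W' * c) (W' * κ)
      have := norm_add_le (Real.pi * s ^ 2 - Real.pi * (c * κ)) (W' * c)
      have := norm_sub_le ((Real.pi : ℂ) * s ^ 2) (Real.pi * (c * κ))
      linarith
    set P := (W' - c * Real.pi) * (c + κ) with hPdef
    have hpi0 : (Real.pi : ℂ) ≠ 0 := Complex.ofReal_ne_zero.2 Real.pi_ne_zero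
    have hPn : 2 ≤ ‖P‖ := by
      have h1 := norm_sub_norm_le (Real.pi : ℂ) (P + Real.pi)
      have h2 : ‖(Real.pi : ℂ) - (P + Real.pi)‖ = ‖P‖ := by
        rw [show (Real.pi : ℂ) - (P + Real.pi) = -P by ring, norm_neg]
      rw [h2, Complex.norm_real, Real.norm_of_nonneg Real.pi_pos.le] at h1
      linarith [Real.pi_gt_three]
    have hα : (α n - 2 / Real.pi) * (Real.pi * P) = -2 * (P + Real.pi) := by
      field_simp
      linear_combination (Real.pi : ℂ) * hP
    have h5 := congrArg norm hα
    rw [norm_mul, norm_mul _ P, norm_mul (-2), Complex.norm_real,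
      Real.norm_of_nonneg Real.pi_pos.le, norm_neg, RCLike.norm_ofNat] at h5
    have h6 : 3 * 2 ≤ Real.pi * ‖P‖ := by
      have := Real.pi_gt_three
      gcongr
    nlinarith [norm_nonneg (α n - 2 / Real.pi)]

theorem IsSpectralData.summable_xi_sq (hσ : MemLp σ 2 (volume.restrict (Ioo 0 Real.pi)))
    (hr : IsAdmissible r₁ r₂) (h : IsSpectralData σ r₁ r₂ lam α) :
    Summable fun n => xi ![lam, modelLam r₁.natDegree] ![α, modelAlpha r₁.natDegree] n ^ 2 := by
  obtain ⟨β, hβ, hb⟩ := h.exists_summable_bound hσ hr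
  refine summable_of_isBigO_nat (hβ.mul_left 4) (Asymptotics.IsBigO.of_bound 1 ?_)
  filter_upwards [hb, eventually_gt_atTop r₁.natDegree] with n ⟨h1, h2⟩ hn
  rw [one_mul, Real.norm_of_nonneg (by positivity), Real.norm_of_nonneg (by positivity)]
  have h3 : xi ![lam, modelLam r₁.natDegree] ![α, modelAlpha r₁.natDegree] n ≤ 2 * β n := by
    simp only [xi, Matrix.cons_val_zero, Matrix.cons_val_one, rho_modelLam hn]
    rw [modelAlpha, if_neg (by omega), if_neg (by omega)]
    linarith
  calc _ ≤ (2 * β n) ^ 2 := by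
        gcongr
        exact add_nonneg (norm_nonneg _) (norm_nonneg _)
    _ = _ := by ring

end Data


/-! ### The space `L²(0, x)` with the bilinear pairing -/

abbrev IntervalL2 (x : ℝ) : Type := Lp ℂ 2 (volume.restrict (Ioc 0 x))

section IntervalL2

variable {x : ℝ}

/-- The bilinear pairing `∫₀ˣ F G`. -/
def pair (x : ℝ) : IntervalL2 x →L[ℂ] IntervalL2 x →L[ℂ] ℂ :=
  (ContinuousLinearMap.mul ℂ ℂ).lpPairing (volume.restrict (Ioc 0 x)) 2 2

theorem pair_apply (F G : IntervalL2 x) : pair x F G = ∫ t in Ioc 0 x, F t * G t := by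
  rw [pair, ContinuousLinearMap.lpPairing_eq_integral]
  rfl

theorem pair_comm (F G : IntervalL2 x) : pair x F G = pair x G F := by
  simp only [pair_apply, mul_comm]

theorem pair_star_left (F G : IntervalL2 x) : pair x (star F) G = inner ℂ F G := by
  rw [pair_apply, L2.inner_def]
  refine integral_congr_ae ?_
  filter_upwards [Lp.coeFn_star F] with t ht
  rw [ht]
  simp [mul_comm]

/-- Conjugating one argument turns the bilinear pairing into the inner product, so definiteness and
the Riesz representation carry over. -/
theorem bijective_pair : Function.Bijective (pair x) := by
  constructor
  · refine (injective_iff_map_eq_zero _).2 fun F hF => ?_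
    have h := pair_star_left F F
    rw [pair_comm, hF] at h
    exact inner_self_eq_zero.1 h.symm
  · intro η
    refine ⟨star ((InnerProductSpace.toDual ℂ _).symm η), ?_⟩
    ext G
    rw [pair_star_left, InnerProductSpace.toDual_symm_apply]

/-- The pairing identifies `L²(0, x)` with its dual. -/
def pairDual (x : ℝ) : IntervalL2 x ≃L[ℂ] (IntervalL2 x →L[ℂ] ℂ) :=
  ContinuousLinearEquiv.ofBijective (pair x) (LinearMap.ker_eq_bot.2 bijective_pair.1)
    (LinearMap.range_eq_top.2 bijective_pair.2)

theorem pairDual_apply (F G : IntervalL2 x) : pairDual x F G = pair x F G := rfl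

theorem memLp_extend (Y : Curve ℂ) : MemLp (extend Y) 2 (volume.restrict (Ioc 0 x)) :=
  (memLp_Icc_of_continuous (continuous_extend Y) 0 x).mono_measure
    (Measure.restrict_mono Ioc_subset_Icc_self le_rfl)

/-- Restriction of a continuous function to `(0, x]`. -/
def curveL2 (x : ℝ) : Curve ℂ →L[ℂ] IntervalL2 x :=
  LinearMap.mkContinuous
    { toFun := fun Y => (memLp_extend Y).toLp
      map_add' := fun Y Z => by
        rw [← MemLp.toLp_add]
        rfl
      map_smul' := fun c Y => by
        rw [RingHom.id_apply, ← MemLp.toLp_const_smul]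
        rfl }
    (measureUnivNNReal (volume.restrict (Ioc 0 x)) ^ (2 : ℝ≥0∞).toReal⁻¹) fun Y => by
      refine Lp.norm_le_of_ae_bound (norm_nonneg Y) ?_
      filter_upwards [(memLp_extend (x := x) Y).coeFn_toLp] with t ht
      change ‖(memLp_extend Y).toLp _ t‖ ≤ _
      rw [ht]
      exact norm_extend_le Y t

theorem curveL2_ae (x : ℝ) (Y : Curve ℂ) :
    curveL2 x Y =ᵐ[volume.restrict (Ioc 0 x)] extend Y := (memLp_extend Y).coeFn_toLp

theorem pair_curveL2 (hx : 0 ≤ x) (Y Z : Curve ℂ) :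
    pair x (curveL2 x Y) (curveL2 x Z) = ∫ t in (0 : ℝ)..x, extend Y t * extend Z t := by
  rw [pair_apply, intervalIntegral.integral_of_le hx]
  refine integral_congr_ae ?_
  filter_upwards [curveL2_ae x Y, curveL2_ae x Z] with t h1 h2
  rw [h1, h2]

end IntervalL2

/-! ### Solutions as entire families of vectors in `L²(0, x)`. -/

section SolutionCurves

variable {σ : ℝ → ℂ}

/-- The solution with `y(0) = c`, `y^{[1]}(0) = d` as a continuous function on `[0, π]`. -/
def solCurve (hσ : MemLp σ 2 (volume.restrict (Ioo 0 Real.pi))) (c d lam : ℂ) : Curve ℂ :=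
  ContinuousLinearMap.compLeftContinuous ℂ (Icc (0 : ℝ) Real.pi) (ContinuousLinearMap.fst ℂ ℂ ℂ)
    ((exists_entire_initialSolution hσ c d).choose lam)

theorem differentiable_solCurve (hσ : MemLp σ 2 (volume.restrict (Ioo 0 Real.pi))) (c d : ℂ) :
    Differentiable ℂ (solCurve hσ c d) :=
  (ContinuousLinearMap.differentiable (ContinuousLinearMap.compLeftContinuous ℂ
    (Icc (0 : ℝ) Real.pi) (ContinuousLinearMap.fst ℂ ℂ ℂ))).comp
    (exists_entire_initialSolution hσ c d).choose_spec.1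

theorem extend_solCurve (hσ : MemLp σ 2 (volume.restrict (Ioo 0 Real.pi))) (c d lam : ℂ) {t : ℝ}
    (ht : t ∈ Icc 0 Real.pi) :
    extend (solCurve hσ c d lam) t = (initialSolution σ lam 0 c d).1 t := by
  have h := (exists_entire_initialSolution hσ c d).choose_spec.2 lam t ht
  rw [extend, IccExtend_of_mem _ _ ht] at h ⊢
  exact congrArg Prod.fst h

/-- `φ(·, lam)` as an element of `L²(0, x)`. -/
def phiVec (hσ : MemLp σ 2 (volume.restrict (Ioo 0 Real.pi))) (x : ℝ) (lam : ℂ) : IntervalL2 x :=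
  curveL2 x (solCurve hσ 1 0 lam)

theorem differentiable_phiVec (hσ : MemLp σ 2 (volume.restrict (Ioo 0 Real.pi))) (x : ℝ) :
    Differentiable ℂ (phiVec hσ x) :=
  (curveL2 x).differentiable.comp (differentiable_solCurve hσ 1 0)

/-- `S(·, lam)` as an element of `L²(0, x)`. -/
def sinVec (hσ : MemLp σ 2 (volume.restrict (Ioo 0 Real.pi))) (x : ℝ) (lam : ℂ) : IntervalL2 x :=
  curveL2 x (solCurve hσ 0 1 lam)

theorem differentiable_sinVec (hσ : MemLp σ 2 (volume.restrict (Ioo 0 Real.pi))) (x : ℝ) :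
    Differentiable ℂ (sinVec hσ x) :=
  (curveL2 x).differentiable.comp (differentiable_solCurve hσ 0 1)

theorem pair_solCurve (hσ : MemLp σ 2 (volume.restrict (Ioo 0 Real.pi))) {x : ℝ}
    (hx : x ∈ Icc 0 Real.pi) (c d c' d' lam mu : ℂ) :
    pair x (curveL2 x (solCurve hσ c d lam)) (curveL2 x (solCurve hσ c' d' mu)) =
      ∫ t in (0 : ℝ)..x, (initialSolution σ lam 0 c d).1 t * (initialSolution σ mu 0 c' d').1 t := by
  rw [pair_curveL2 hx.1]
  refine intervalIntegral.integral_congr fun t ht => ?_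
  rw [uIcc_of_le hx.1] at ht
  have ht' : t ∈ Icc 0 Real.pi := ⟨ht.1, ht.2.trans hx.2⟩
  simp only [extend_solCurve hσ _ _ _ ht']

/-- The Lagrange identity; the bracket at `0` vanishes since both solutions have the same data
there. As a pairing, the divided bracket is entire in each parameter and needs no convention at `lam
= mu`. -/
theorem sub_mul_pair_phiVec (hσ : MemLp σ 2 (volume.restrict (Ioo 0 Real.pi))) {x : ℝ}
    (hx : x ∈ Icc 0 Real.pi) (lam mu : ℂ) :
    (lam - mu) * pair x (phiVec hσ x lam) (phiVec hσ x mu) =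
      (phi σ lam).1 x * (phi σ mu).2 x - (phi σ lam).2 x * (phi σ mu).1 x := by
  obtain ⟨h1, h2, h3⟩ := phi_spec hσ lam
  obtain ⟨h1', h2', h3'⟩ := phi_spec hσ mu
  rw [h1.wronskian hσ h1' hx, h2, h3, h2', h3', phiVec, phiVec, pair_solCurve hσ hx]
  simp [phi]

/-- Here the bracket at `0` equals `-1`. This constant is the origin of the pole at `μ` in the
contour integral. -/
theorem sub_mul_pair_sinVec (hσ : MemLp σ 2 (volume.restrict (Ioo 0 Real.pi))) {x : ℝ}
    (hx : x ∈ Icc 0 Real.pi) (lam mu : ℂ) :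
    (lam - mu) * pair x (sinVec hσ x lam) (phiVec hσ x mu) - 1 =
      (sinSol σ lam).1 x * (phi σ mu).2 x - (sinSol σ lam).2 x * (phi σ mu).1 x := by
  obtain ⟨h1, h2, h3⟩ := sinSol_spec hσ lam
  obtain ⟨h1', h2', h3'⟩ := phi_spec hσ mu
  rw [h1.wronskian hσ h1' hx, h2, h3, h2', h3', phiVec, sinVec, pair_solCurve hσ hx]
  simp [phi, sinSol]
  ring

end SolutionCurves


/-! ### Residues -/

/-- Giving `f` at each exceptional point the value of its local analytic continuation produces a
function holomorphic on the disc and unchanged on the circle, so Cauchy's theorem applies. -/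
theorem circleIntegral_eq_zero_of_removable {f : ℂ → ℂ} {c : ℂ} {R : ℝ} (hR : 0 ≤ R) (s : Finset ℂ)
    (hs : ∀ p ∈ s, p ∈ Metric.ball c R)
    (hf : ∀ z ∈ Metric.closedBall c R, z ∉ s → DifferentiableAt ℂ f z)
    (hp : ∀ p ∈ s, ∃ g : ℂ → ℂ, AnalyticAt ℂ g p ∧ ∀ᶠ z in 𝓝[≠] p, f z = g z) :
    ∮ z in C(c, R), f z = 0 := by
  classical
  choose! g hg hfg using hp
  set F : ℂ → ℂ := fun z => if z ∈ s then g z z else f z with hF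
  have hsc : IsClosed (s : Set ℂ) := s.finite_toSet.isClosed
  have hd : ∀ z ∈ Metric.closedBall c R, DifferentiableAt ℂ F z := by
    intro z hz
    by_cases hzs : z ∈ s
    · refine (hg z hzs).differentiableAt.congr_of_eventuallyEq ?_
      have h1 : ∀ᶠ w in 𝓝 z, w ∉ (s.erase z : Set ℂ) :=
        (s.erase z).finite_toSet.isClosed.isOpen_compl.mem_nhds (by simp)
      filter_upwards [eventually_nhdsWithin_iff.1 (hfg z hzs), h1] with w h2 h3
      by_cases hw : w = z
      · simp [hF, hw, hzs]
      · have : w ∉ s := fun h => h3 (by simp [hw, h])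
        simp only [hF, if_neg this]
        exact h2 hw
    · refine (hf z hz hzs).congr_of_eventuallyEq ?_
      filter_upwards [hsc.isOpen_compl.mem_nhds hzs] with w hw
      exact if_neg hw
  have h0 := Complex.circleIntegral_eq_zero_of_differentiable_on_off_countable hR countable_empty
    (fun z hz => (hd z hz).continuousAt.continuousWithinAt)
    (fun z hz => hd z (Metric.ball_subset_closedBall hz.1))
  rw [← h0]
  refine circleIntegral.integral_congr hR fun z hz => ?_
  have h1 : z ∉ s := fun h => by
    have h2 := hs z h
    rw [Metric.mem_ball] at h2
    rw [Metric.mem_sphere] at hz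
    exact h2.ne hz
  simp only [hF, if_neg h1]

/-- The Cauchy integral formula for derivatives at a point that need not be the center. -/
theorem circleIntegral_div_sub_pow {f : ℂ → ℂ} (hf : Differentiable ℂ f) {c w : ℂ} {R : ℝ}
    (hw : w ∈ Metric.ball c R) (j : ℕ) :
    ∮ z in C(c, R), f z / (z - w) ^ (j + 1) =
      2 * Real.pi * Complex.I * (iteratedDeriv j f w / j.factorial) := by
  have hR : 0 < R := dist_nonneg.trans_lt hw
  have hne : ∀ z ∈ Metric.sphere c R, z - w ≠ 0 := fun z hz h => by
    rw [sub_eq_zero] at h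
    rw [Metric.mem_ball, ← h] at hw
    exact hw.ne hz
  obtain ⟨F, hF, hfF⟩ := AnalyticAt.exists_eq_sum_add_pow_mul (f := fun u => f (w + u))
    ((hf.comp (by fun_prop : Differentiable ℂ fun u => w + u)).analyticAt 0) (j + 1)
  have hder : ∀ i, iteratedDeriv i (fun u => f (w + u)) 0 = iteratedDeriv i f w := fun i => by
    simp only [iteratedDeriv_comp_const_add, add_zero]
  simp only [hder, smul_eq_mul] at hfF
  set P : ℂ → ℂ := fun z => ∑ i ∈ Finset.range (j + 1),
    iteratedDeriv i f w / i.factorial * (z - w) ^ ((i : ℤ) - (j + 1 : ℕ)) with hP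
  have hPc : ∀ i ∈ Finset.range (j + 1), CircleIntegrable
      (fun z => iteratedDeriv i f w / i.factorial * (z - w) ^ ((i : ℤ) - (j + 1 : ℕ))) c R := by
    intro i _
    refine ContinuousOn.circleIntegrable hR.le ?_
    exact continuousOn_const.mul ((by fun_prop : ContinuousOn (fun z => z - w) _).zpow₀ _
      fun z hz => Or.inl (hne z hz))
  have h1 : ∮ z in C(c, R), P z =
      2 * Real.pi * Complex.I * (iteratedDeriv j f w / j.factorial) := by
    rw [hP, circleIntegral.integral_fun_sum hPc, Finset.sum_range_succ, Finset.sum_eq_zero, zero_add,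
      circleIntegral.integral_const_mul]
    · have : (j : ℤ) - (j + 1 : ℕ) = -1 := by push_cast; ring
      simp only [this, zpow_neg_one]
      rw [circleIntegral.integral_sub_inv_of_mem_ball hw]
      ring
    · intro i hi
      rw [circleIntegral.integral_const_mul, circleIntegral.integral_sub_zpow_of_ne, mul_zero]
      have := Finset.mem_range.1 hi
      push_cast
      omega
  have h2 : ∮ z in C(c, R), (f z / (z - w) ^ (j + 1) - P z) = 0 := by
    refine circleIntegral_eq_zero_of_removable hR.le {w} (by simpa using hw) ?_ ?_
    · intro z _ hz
      have hz' : z - w ≠ 0 := sub_ne_zero.2 (by simpa using hz)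
      refine DifferentiableAt.sub ?_ ?_
      · exact (hf z).div (by fun_prop) (pow_ne_zero _ hz')
      · refine DifferentiableAt.fun_sum fun i _ => ?_
        exact (((by fun_prop : DifferentiableAt ℂ (fun z => z - w) z)).zpow
          (Or.inl hz')).const_mul _
    · intro p hp
      rw [Finset.mem_singleton] at hp
      subst hp
      refine ⟨fun z => F (z - p), ?_, ?_⟩
      · refine AnalyticAt.fun_comp ?_ (by fun_prop)
        simpa using hF
      · filter_upwards [self_mem_nhdsWithin] with z hz
        have hz' : z - p ≠ 0 := sub_ne_zero.2 hz
        have h3 := hfF (z - p)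
        rw [add_sub_cancel] at h3
        rw [h3, add_div, mul_div_cancel_left₀ _ (pow_ne_zero _ hz'), hP, Finset.sum_div,
          add_sub_right_comm, ← Finset.sum_sub_distrib, Finset.sum_eq_zero, zero_add]
        intro i _
        rw [zpow_sub₀ hz', zpow_natCast, zpow_natCast]
        ring
  rw [circleIntegral.integral_sub, h1, sub_eq_zero] at h2
  · exact h2
  · exact ContinuousOn.circleIntegrable hR.le (hf.continuous.continuousOn.div (by fun_prop)
      fun z hz => pow_ne_zero _ (hne z hz))
  · exact CircleIntegrable.fun_sum _ hPc

/-! ### Blocks of equal values -/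

/-- Equal values are consecutive and repeated finitely often. -/
structure IsBlocked (lam : ℕ → ℂ) : Prop where
  consecutive : ∀ i j k : ℕ, i ≤ j → j ≤ k → lam i = lam k → lam j = lam i
  finite : ∀ n, {k | lam k = lam n}.Finite

/-- By consecutiveness the indices of a value fill the interval between its first and last
occurrence, and the multiplicity is the number of these indices. -/
theorem IsBlocked.eq_iff {lam : ℕ → ℂ} (h : IsBlocked lam) {n k : ℕ} :
    lam k = lam n ↔ blockStart lam n ≤ k ∧ k < blockStart lam n + mult lam n := by
  set s := {k | lam k = lam n} with hs
  have hne : s.Nonempty := ⟨n, rfl⟩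
  have hmin : blockStart lam n ∈ s := Nat.sInf_mem hne
  obtain ⟨b, hb, hmax⟩ := (h.finite n).exists_maximalFor id s hne
  have hmax' : ∀ k ∈ s, k ≤ b := fun k hk => by
    rcases le_total k b with h1 | h1
    · exact h1
    · exact hmax hk h1
  have hle : ∀ k ∈ s, blockStart lam n ≤ k := fun k hk => Nat.sInf_le hk
  have hs' : s = Icc (blockStart lam n) b := by
    ext k
    refine ⟨fun hk => ⟨hle k hk, hmax' k hk⟩, fun hk => ?_⟩
    have h1 := h.consecutive _ k b hk.1 hk.2 ((show lam _ = lam n from hmin).trans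
      (show lam b = lam n from hb).symm)
    exact h1.trans hmin
  have hm : mult lam n = b + 1 - blockStart lam n := by
    rw [mult, ← hs, hs', ← Finset.coe_Icc, ncard_coe_finset, Nat.card_Icc]
  have h1 : lam k = lam n ↔ k ∈ s := Iff.rfl
  have h2 := hle b hb
  rw [h1, hs', hm, mem_Icc]
  omega

theorem blockStart_congr {lam : ℕ → ℂ} {k n : ℕ} (h : lam k = lam n) :
    blockStart lam k = blockStart lam n ∧ mult lam k = mult lam n := by
  rw [blockStart, blockStart, mult, mult, h]
  exact ⟨rfl, rfl⟩

theorem blockStart_le (lam : ℕ → ℂ) (n : ℕ) : blockStart lam n ≤ n := Nat.sInf_le rfl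

theorem lam_blockStart (lam : ℕ → ℂ) (n : ℕ) : lam (blockStart lam n) = lam n :=
  Nat.sInf_mem (s := {k | lam k = lam n}) ⟨n, rfl⟩

theorem pos_blockStart (lam : ℕ → ℂ) (n : ℕ) : pos lam (blockStart lam n) = 0 := by
  rw [pos, (blockStart_congr (lam_blockStart lam n)).1, Nat.sub_self]

theorem IsBlocked.lam_blockStart_add {lam : ℕ → ℂ} (h : IsBlocked lam) (n : ℕ) {j : ℕ}
    (hj : j < mult lam n) : lam (blockStart lam n + j) = lam n ∧
      pos lam (blockStart lam n + j) = j := by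
  have h1 : lam (blockStart lam n + j) = lam n := h.eq_iff.2 ⟨by omega, by omega⟩
  refine ⟨h1, ?_⟩
  rw [pos, (blockStart_congr h1).1, Nat.add_sub_cancel_left]

/-- A sum over the indices of a block. -/
theorem IsBlocked.sum_filter {lam : ℕ → ℂ} (h : IsBlocked lam) {N n : ℕ}
    (hN : ∀ k, lam k = lam n → k < N) (f : ℕ → ℂ) :
    ∑ k ∈ Finset.range N with lam k = lam n, f k =
      ∑ j ∈ Finset.range (mult lam n), f (blockStart lam n + j) := by
  have h1 : (Finset.range N).filter (fun k => lam k = lam n) =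
      Finset.Ico (blockStart lam n) (blockStart lam n + mult lam n) := by
    ext k
    rw [Finset.mem_filter, Finset.mem_range, Finset.mem_Ico, h.eq_iff]
    exact ⟨fun h => h.2, fun h1 => ⟨hN k (h.eq_iff.2 h1), h1⟩⟩
  rw [h1, Finset.sum_Ico_eq_sum_range, Nat.add_sub_cancel_left]


/-! ### The contour integral of the Weyl function -/

section Contour

variable {σ : ℝ → ℂ} {r₁ r₂ : ℂ[X]} {lam α : ℕ → ℂ}

theorem IsSpectralData.isBlocked (h : IsSpectralData σ r₁ r₂ lam α) : IsBlocked lam where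
  consecutive := h.consecutive
  finite n := by
    by_contra hinf
    obtain ⟨n₀, hn₀⟩ := eventually_atTop.1 h.eventually_simple
    obtain ⟨k, hk, hk'⟩ := Set.Infinite.exists_gt hinf n₀
    refine hinf (Set.Finite.subset (finite_singleton k) fun j hj => ?_)
    exact hn₀ k hk'.le j ((show lam j = lam n from hj).trans (show lam k = lam n from hk).symm)

theorem IsSpectralData.exists_eq (hσ : MemLp σ 2 (volume.restrict (Ioo 0 Real.pi)))
    (h : IsSpectralData σ r₁ r₂ lam α) {z : ℂ} (hz : charFun σ r₁ r₂ z = 0) : ∃ n, lam n = z := by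
  have h1 : analyticOrderAt (charFun σ r₁ r₂) z ≠ 0 :=
    analyticOrderAt_ne_zero.2 ⟨(differentiable_charFun hσ r₁ r₂).analyticAt z, hz⟩
  rw [← h.count] at h1
  exact Set.encard_ne_zero.1 h1

/-- `P` is the sum of the principal parts at the eigenvalues inside the circle, multiplied by `f`;
the index at place `j` of a block carries the power `j + 1`. What is left of `M f` has removable
singularities and integral zero, and `P` is integrated by Cauchy's formula for derivatives. -/
theorem circleIntegral_weyl_mul (hσ : MemLp σ 2 (volume.restrict (Ioo 0 Real.pi)))
    (h : IsSpectralData σ r₁ r₂ lam α) {f : ℂ → ℂ} (hf : Differentiable ℂ f) {R : ℝ} (hR : 0 < R)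
    {N : ℕ} (hN : ∀ n, n < N ↔ ‖lam n‖ < R) (hR' : ∀ n, ‖lam n‖ ≠ R) :
    ∮ z in C(0, R), weyl σ r₁ r₂ z * f z = 2 * Real.pi * Complex.I * ∑ n ∈ Finset.range N,
      α n * (iteratedDeriv (pos lam n) f (lam n) / (pos lam n).factorial) := by
  classical
  have hb := h.isBlocked
  have hΔ : ∀ z ∈ Metric.closedBall (0 : ℂ) R, (∀ n < N, lam n ≠ z) → charFun σ r₁ r₂ z ≠ 0 := by
    intro z hz hn h0
    obtain ⟨n, rfl⟩ := h.exists_eq hσ h0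
    rw [mem_closedBall_zero_iff] at hz
    exact hn n ((hN n).2 (lt_of_le_of_ne hz (hR' n))) rfl
  have hMd : ∀ z ∈ Metric.closedBall (0 : ℂ) R, (∀ n < N, lam n ≠ z) →
      DifferentiableAt ℂ (fun z => weyl σ r₁ r₂ z * f z) z := by
    intro z hz hn
    simp only [weyl_eq hσ]
    exact ((differentiable_weylNum hσ r₁ r₂ z).div (differentiable_charFun hσ r₁ r₂ z)
      (hΔ z hz hn)).neg.mul (hf z)
  have hsph : ∀ z ∈ Metric.sphere (0 : ℂ) R, ∀ n, lam n ≠ z := by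
    intro z hz n hn
    rw [mem_sphere_zero_iff_norm, ← hn] at hz
    exact hR' n hz
  set P : ℂ → ℂ := fun z => ∑ n ∈ Finset.range N, α n * (f z / (z - lam n) ^ (pos lam n + 1))
    with hP
  have hPi : ∀ n ∈ Finset.range N, CircleIntegrable
      (fun z => α n * (f z / (z - lam n) ^ (pos lam n + 1))) 0 R := fun n _ =>
    ContinuousOn.circleIntegrable hR.le (continuousOn_const.mul
      (hf.continuous.continuousOn.div (by fun_prop) fun z hz =>
        pow_ne_zero _ (sub_ne_zero.2 (hsph z hz n).symm)))
  have h1 : ∮ z in C(0, R), P z = 2 * Real.pi * Complex.I * ∑ n ∈ Finset.range N,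
      α n * (iteratedDeriv (pos lam n) f (lam n) / (pos lam n).factorial) := by
    rw [hP, circleIntegral.integral_fun_sum hPi, Finset.mul_sum]
    refine Finset.sum_congr rfl fun n hn => ?_
    rw [circleIntegral.integral_const_mul, circleIntegral_div_sub_pow hf
      (mem_ball_zero_iff.2 ((hN n).1 (Finset.mem_range.1 hn)))]
    ring
  have h2 : ∮ z in C(0, R), (weyl σ r₁ r₂ z * f z - P z) = 0 := by
    refine circleIntegral_eq_zero_of_removable hR.le ((Finset.range N).image lam) ?_ ?_ ?_
    · intro p hp
      obtain ⟨n, hn, rfl⟩ := Finset.mem_image.1 hp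
      exact mem_ball_zero_iff.2 ((hN n).1 (Finset.mem_range.1 hn))
    · intro z hz hzs
      have hz' : ∀ n < N, lam n ≠ z := fun n hn he =>
        hzs (Finset.mem_image.2 ⟨n, Finset.mem_range.2 hn, he⟩)
      refine (hMd z hz hz').sub (DifferentiableAt.fun_sum fun n hn => ?_)
      have hd : DifferentiableAt ℂ (fun z => (z - lam n) ^ (pos lam n + 1)) z := by fun_prop
      have hd' := (hf z).fun_div hd
        (pow_ne_zero _ (sub_ne_zero.2 (hz' n (Finset.mem_range.1 hn)).symm))
      exact hd'.const_mul (α n)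
    · intro p hp
      obtain ⟨n, hn, rfl⟩ := Finset.mem_image.1 hp
      have hnN := (hN n).1 (Finset.mem_range.1 hn)
      obtain ⟨g, hg, hw⟩ := h.principalPart _ (pos_blockStart lam n)
      rw [lam_blockStart lam n, (blockStart_congr (lam_blockStart lam n)).2] at hw
      rw [lam_blockStart lam n] at hg
      have hQ : AnalyticAt ℂ (fun z => ∑ k ∈ Finset.range N with ¬ lam k = lam n,
          α k * (f z / (z - lam k) ^ (pos lam k + 1))) (lam n) := by
        refine Finset.analyticAt_fun_sum _ fun k hk => ?_
        have hk' := (Finset.mem_filter.1 hk).2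
        have hd : AnalyticAt ℂ (fun z => (z - lam k) ^ (pos lam k + 1)) (lam n) := by fun_prop
        refine analyticAt_const.fun_mul ((hf.analyticAt _).fun_div hd ?_)
        exact pow_ne_zero _ (sub_ne_zero.2 fun h => hk' h.symm)
      refine ⟨fun z => g z * f z - ∑ k ∈ Finset.range N with ¬ lam k = lam n,
        α k * (f z / (z - lam k) ^ (pos lam k + 1)), ?_, ?_⟩
      · exact (hg.fun_mul (hf.analyticAt _)).fun_sub hQ
      · filter_upwards [hw] with z hz
        have h3 := hb.sum_filter (N := N) (n := n) (fun k hk => (hN k).2 (by rw [hk]; exact hnN))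
          (fun k => α k * (f z / (z - lam k) ^ (pos lam k + 1)))
        rw [hz, hP]
        simp only
        rw [← Finset.sum_filter_add_sum_filter_not (Finset.range N) (fun k => lam k = lam n), h3,
          add_mul, Finset.sum_mul]
        have h4 : ∑ j ∈ Finset.range (mult lam n), α (blockStart lam n + j) *
            (f z / (z - lam (blockStart lam n + j)) ^ (pos lam (blockStart lam n + j) + 1)) =
            ∑ j ∈ Finset.range (mult lam n), α (blockStart lam n + j) / (z - lam n) ^ (j + 1) *
              f z := by
          refine Finset.sum_congr rfl fun j hj => ?_
          obtain ⟨e1, e2⟩ := hb.lam_blockStart_add n (Finset.mem_range.1 hj)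
          rw [e1, e2]
          ring
        rw [h4]
        ring
  rw [circleIntegral.integral_sub, h1, sub_eq_zero] at h2
  · exact h2
  · exact ContinuousOn.circleIntegrable hR.le fun z hz => (hMd z
      (Metric.sphere_subset_closedBall hz) fun n _ => hsph z hz n).continuousAt.continuousWithinAt
  · exact CircleIntegrable.fun_sum _ hPi

theorem exists_psi_bounds (hσ : MemLp σ 2 (volume.restrict (Ioo 0 Real.pi)))
    (hr : IsAdmissible r₁ r₂) : ∃ K : ℝ, 0 < K ∧ ∀ ρ : ℂ, 1 ≤ ‖ρ‖ → ∀ x ∈ Icc 0 Real.pi,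
      ‖(psi σ r₁ r₂ (ρ ^ 2)).1 x‖ ≤
        K * ‖ρ‖ ^ (2 * r₁.natDegree) * Real.exp (|ρ.im| * (Real.pi - x)) ∧
      ‖(psi σ r₁ r₂ (ρ ^ 2)).2 x‖ ≤
        K * ‖ρ‖ ^ (2 * r₁.natDegree + 1) * Real.exp (|ρ.im| * (Real.pi - x)) := by
  obtain ⟨K, hK, hb⟩ := exists_solution_bounds (memLp_reflectPotential hσ)
  obtain ⟨A, hA, hA'⟩ := exists_norm_eval_le r₁ le_rfl
  obtain ⟨B, hB, hB'⟩ := exists_norm_eval_le r₂ hr.natDegree_le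
  refine ⟨(A + B + 1) * K, by positivity, fun ρ hρ x hx => ?_⟩
  have hsq : 1 ≤ ‖ρ ^ 2‖ := by
    rw [norm_pow]
    exact one_le_pow₀ hρ
  have h1 := hA' _ hsq
  have h2 := hB' _ hsq
  rw [norm_pow, ← pow_mul] at h1 h2
  have hx' : Real.pi - x ∈ Icc 0 Real.pi := ⟨by linarith [hx.2], by linarith [hx.1]⟩
  obtain ⟨b1, b2, b3, b4⟩ := hb ρ hρ _ hx'
  obtain ⟨e1, e2⟩ := psi_eq_reflect hσ r₁ r₂ (ρ ^ 2) hx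
  set E := Real.exp (|ρ.im| * (Real.pi - x))
  have hE : 0 < E := Real.exp_pos _
  set q := ‖ρ‖ ^ (2 * r₁.natDegree) with hq
  have hq0 : 0 ≤ q := by positivity
  have hn : 0 ≤ K * q * E := by positivity
  constructor
  · rw [e1]
    calc _ ≤ A * q * (K * E) + B * q * (K * E) := by
          refine (norm_add_le _ _).trans (add_le_add ?_ ?_) <;> rw [norm_mul] <;> gcongr
      _ ≤ _ := by nlinarith
  · rw [e2, norm_neg, pow_succ ‖ρ‖, ← hq]
    have b4' : ‖(sinSol (reflectPotential σ) (ρ ^ 2)).2 (Real.pi - x)‖ ≤ K * ‖ρ‖ * E := by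
      refine b4.trans ?_
      have : K * 1 * E ≤ K * ‖ρ‖ * E := by gcongr
      linarith
    calc _ ≤ A * q * (K * ‖ρ‖ * E) + B * q * (K * ‖ρ‖ * E) := by
          refine (norm_add_le _ _).trans (add_le_add ?_ ?_) <;> rw [norm_mul] <;> gcongr
      _ ≤ _ := by nlinarith [mul_nonneg hn (norm_nonneg ρ)]

theorem psi_eq (hσ : MemLp σ 2 (volume.restrict (Ioo 0 Real.pi))) (lam : ℂ) {x : ℝ}
    (hx : x ∈ Icc 0 Real.pi) :
    (psi σ r₁ r₂ lam).1 x = weylNum σ r₁ r₂ lam * (phi σ lam).1 x -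
        charFun σ r₁ r₂ lam * (sinSol σ lam).1 x ∧
      (psi σ r₁ r₂ lam).2 x = weylNum σ r₁ r₂ lam * (phi σ lam).2 x -
        charFun σ r₁ r₂ lam * (sinSol σ lam).2 x := by
  obtain ⟨h1, h2⟩ := psi_zero hσ r₁ r₂ lam
  obtain ⟨e1, e2⟩ := (psi_spec hσ r₁ r₂ lam).1.eq_fundamental hσ hx
  rw [e1, e2, h1, h2]
  constructor <;> ring

/-- The integrand of the contour integral. -/
def contourFun (hσ : MemLp σ 2 (volume.restrict (Ioo 0 Real.pi))) (r₁ r₂ : ℂ[X]) (x : ℝ)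
    (μ μ' z : ℂ) : ℂ :=
  weyl σ r₁ r₂ z * (pair x (phiVec hσ x z) (phiVec hσ x μ) * pair x (phiVec hσ x z) (phiVec hσ x μ'))
    + pair x (sinVec hσ x z) (phiVec hσ x μ) * pair x (phiVec hσ x z) (phiVec hσ x μ')
    - pair x (phiVec hσ x z) (phiVec hσ x μ') / (z - μ) ^ (0 + 1)

/-- The function `S + M φ = -ψ/Δ` is the Weyl solution `Φ`, so the Lagrange identities turn
`contourFun` into `⟨Φ(z), φ(μ)⟩ ⟨φ(z), φ(μ')⟩ / ((z - μ)(z - μ'))`. The defining form displays the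
residues; this form displays the decay, since the growth of `φ(z)` is compensated by the decay of
`Φ(z)`. -/
theorem contourFun_eq (hσ : MemLp σ 2 (volume.restrict (Ioo 0 Real.pi))) {x : ℝ}
    (hx : x ∈ Icc 0 Real.pi) {μ μ' z : ℂ} (hz : z ≠ μ) (h0 : charFun σ r₁ r₂ z ≠ 0) :
    contourFun hσ r₁ r₂ x μ μ' z * (charFun σ r₁ r₂ z * ((z - μ) * (z - μ'))) =
      -(((psi σ r₁ r₂ z).1 x * (phi σ μ).2 x - (psi σ r₁ r₂ z).2 x * (phi σ μ).1 x) *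
        ((phi σ z).1 x * (phi σ μ').2 x - (phi σ z).2 x * (phi σ μ').1 x)) := by
  have hz' : z - μ ≠ 0 := sub_ne_zero.2 hz
  obtain ⟨e1, e2⟩ := psi_eq (r₁ := r₁) (r₂ := r₂) hσ z hx
  have w1 := sub_mul_pair_phiVec hσ hx z μ
  have w2 := sub_mul_pair_phiVec hσ hx z μ'
  have w3 := sub_mul_pair_sinVec hσ hx z μ
  have h1 : (psi σ r₁ r₂ z).1 x * (phi σ μ).2 x - (psi σ r₁ r₂ z).2 x * (phi σ μ).1 x =
      weylNum σ r₁ r₂ z * ((z - μ) * pair x (phiVec hσ x z) (phiVec hσ x μ)) -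
        charFun σ r₁ r₂ z * ((z - μ) * pair x (sinVec hσ x z) (phiVec hσ x μ) - 1) := by
    rw [w1, w3, e1, e2]
    ring
  rw [h1, ← w2, contourFun, weyl_eq hσ, zero_add, pow_one]
  field_simp
  ring

/-- The term with `M` contributes the eigenvalues, the term with `S` is entire and contributes
nothing, and the simple pole at `μ` contributes the subtracted pairing. -/
theorem circleIntegral_contourFun (hσ : MemLp σ 2 (volume.restrict (Ioo 0 Real.pi)))
    (h : IsSpectralData σ r₁ r₂ lam α) {x : ℝ} (μ μ' : ℂ) {R : ℝ}
    (hμ : ‖μ‖ < R) {N : ℕ} (hN : ∀ n, n < N ↔ ‖lam n‖ < R) (hR' : ∀ n, ‖lam n‖ ≠ R) :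
    ∮ z in C(0, R), contourFun hσ r₁ r₂ x μ μ' z = 2 * Real.pi * Complex.I *
      (∑ n ∈ Finset.range N, α n * (iteratedDeriv (pos lam n) (fun z =>
        pair x (phiVec hσ x z) (phiVec hσ x μ) * pair x (phiVec hσ x z) (phiVec hσ x μ')) (lam n) /
          (pos lam n).factorial) - pair x (phiVec hσ x μ) (phiVec hσ x μ')) := by
  have hR : 0 < R := (norm_nonneg _).trans_lt hμ
  have hd : ∀ μ, Differentiable ℂ fun z => pair x (phiVec hσ x z) (phiVec hσ x μ) := fun μ =>
    ((pair x).flip (phiVec hσ x μ)).differentiable.comp (differentiable_phiVec hσ x)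
  have hs : Differentiable ℂ fun z => pair x (sinVec hσ x z) (phiVec hσ x μ) :=
    ((pair x).flip (phiVec hσ x μ)).differentiable.comp (differentiable_sinVec hσ x)
  have hsph : ∀ z ∈ Metric.sphere (0 : ℂ) R, charFun σ r₁ r₂ z ≠ 0 ∧ z - μ ≠ 0 := by
    intro z hz
    rw [mem_sphere_zero_iff_norm] at hz
    refine ⟨fun h0 => ?_, fun h0 => ?_⟩
    · obtain ⟨n, rfl⟩ := h.exists_eq hσ h0
      exact hR' n hz
    · rw [sub_eq_zero.1 h0] at hz
      exact hμ.ne hz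
  have i1 : CircleIntegrable (fun z => weyl σ r₁ r₂ z * (pair x (phiVec hσ x z) (phiVec hσ x μ) *
      pair x (phiVec hσ x z) (phiVec hσ x μ'))) 0 R := by
    refine ContinuousOn.circleIntegrable hR.le ?_
    simp only [weyl_eq hσ]
    exact (((differentiable_weylNum hσ r₁ r₂).continuous.continuousOn.div
      (differentiable_charFun hσ r₁ r₂).continuous.continuousOn fun z hz => (hsph z hz).1).neg).mul
      ((hd μ).fun_mul (hd μ')).continuous.continuousOn
  have i2 : CircleIntegrable (fun z => pair x (sinVec hσ x z) (phiVec hσ x μ) *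
      pair x (phiVec hσ x z) (phiVec hσ x μ')) 0 R :=
    ContinuousOn.circleIntegrable hR.le (hs.fun_mul (hd μ')).continuous.continuousOn
  have i3 : CircleIntegrable (fun z => pair x (phiVec hσ x z) (phiVec hσ x μ') /
      (z - μ) ^ (0 + 1)) 0 R :=
    ContinuousOn.circleIntegrable hR.le ((hd μ').continuous.continuousOn.div (by fun_prop)
      fun z hz => pow_ne_zero _ (hsph z hz).2)
  simp only [contourFun]
  rw [circleIntegral.integral_sub (CircleIntegrable.fun_add i1 i2) i3,
    circleIntegral.integral_add i1 i2,
    circleIntegral_weyl_mul hσ h ((hd μ).fun_mul (hd μ')) hR hN hR',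
    circleIntegral_div_sub_pow (hd μ') (mem_ball_zero_iff.2 hμ),
    Complex.circleIntegral_eq_zero_of_differentiable_on_off_countable hR.le countable_empty
      (hs.fun_mul (hd μ')).continuous.continuousOn (fun z _ => (hs.fun_mul (hd μ')) z)]
  simp
  ring

end Contour


/-! ### Growing circles and the limit of the residue sums. -/

section ContourLimit

variable {σ : ℝ → ℂ} {r₁ r₂ : ℂ[X]} {lam α : ℕ → ℂ}

theorem norm_rho_sq (z : ℂ) : ‖rho z‖ ^ 2 = ‖z‖ := by rw [← norm_pow, rho_sq]

/-- With `d = deg r₁`, the brackets have sizes `|ρ|^(2d+1) exp(|Im ρ|(π - x))` and `|ρ| exp(|Im ρ|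
x)`, against `|ρ|^(2d+1) exp(|Im ρ| π) |ρ|⁴` in the denominator. The exponentials cancel and `|ρ|⁻³`
remains, which beats the circumference of order `|ρ|²`. The factor `64 = 16 · 2 · 2` comes from the
three lower bounds. -/
theorem exists_norm_contourFun_le (hσ : MemLp σ 2 (volume.restrict (Ioo 0 Real.pi)))
    (hr : IsAdmissible r₁ r₂) {x : ℝ} (hx : x ∈ Icc 0 Real.pi) (μ μ' : ℂ) :
    ∃ C : ℝ, ∀ᶠ N : ℕ in atTop, ∀ z ∈ Metric.sphere (0 : ℂ) (((N : ℝ) + 1 / 2) ^ 2),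
      ‖contourFun hσ r₁ r₂ x μ μ' z‖ ≤ C / ((N : ℝ) + 1 / 2) ^ 3 := by
  obtain ⟨K, hK, hb⟩ := exists_psi_bounds hσ hr
  obtain ⟨L, hL, hb'⟩ := exists_solution_bounds hσ
  set A := ‖(phi σ μ).1 x‖ + ‖(phi σ μ).2 x‖ with hA
  set A' := ‖(phi σ μ').1 x‖ + ‖(phi σ μ').2 x‖ with hA'
  refine ⟨64 * (K * A * (L * A')), ?_⟩
  filter_upwards [eventually_charFun_ge hσ hr,
    tendsto_natCast_atTop_atTop.eventually_ge_atTop (max 1 (max (2 * ‖μ‖) (2 * ‖μ'‖)))]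
    with N hΔ hN z hz
  have hN1 : (1 : ℝ) ≤ N := (le_max_left _ _).trans hN
  have hNμ : 2 * ‖μ‖ ≤ N := ((le_max_left _ _).trans (le_max_right _ _)).trans hN
  have hNμ' : 2 * ‖μ'‖ ≤ N := ((le_max_right _ _).trans (le_max_right _ _)).trans hN
  set ρ := rho z with hρ
  have hρsq : ρ ^ 2 = z := rho_sq z
  rw [mem_sphere_zero_iff_norm, ← hρsq, norm_pow] at hz
  have hρn : ‖ρ‖ = N + 1 / 2 := (pow_left_inj₀ (norm_nonneg _) (by positivity) two_ne_zero).1 hz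
  have hΔ := hΔ ρ hρn
  rw [← hρn]
  have hρ1 : 1 ≤ ‖ρ‖ := by linarith
  have hρ0 : 0 < ‖ρ‖ := by linarith
  obtain ⟨p1, p2⟩ := hb ρ hρ1 x hx
  obtain ⟨q1, q2, -, -⟩ := hb' ρ hρ1 x hx
  have hE : Real.exp (|ρ.im| * (Real.pi - x)) * Real.exp (|ρ.im| * x) =
      Real.exp (|ρ.im| * Real.pi) := by
    rw [← Real.exp_add]
    congr 1
    ring
  have hE1 := Real.exp_pos (|ρ.im| * (Real.pi - x))
  have hE2 := Real.exp_pos (|ρ.im| * x)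
  set E₁ := Real.exp (|ρ.im| * (Real.pi - x))
  set E₂ := Real.exp (|ρ.im| * x)
  set E := Real.exp (|ρ.im| * Real.pi)
  rw [hρsq] at p1 p2 q1 q2 hΔ
  set q := ‖ρ‖ ^ (2 * r₁.natDegree) with hq
  have hq0 : 0 < q := by positivity
  rw [pow_succ, ← hq] at p2 hΔ
  have hΔ0 : 0 < ‖charFun σ r₁ r₂ z‖ := lt_of_lt_of_le (by rw [← hE]; positivity) hΔ
  have hsub : ∀ w : ℂ, 2 * ‖w‖ ≤ N → 1 / 2 * ‖ρ‖ ^ 2 ≤ ‖z - w‖ := by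
    intro w hw
    have h1 := norm_sub_norm_le z w
    rw [← hρsq, norm_pow] at h1
    rw [← hρsq]
    nlinarith
  have hzμ : z ≠ μ := fun h => by
    have := hsub μ hNμ
    rw [h, sub_self, norm_zero] at this
    nlinarith
  have key := congrArg norm (contourFun_eq (r₁ := r₁) (r₂ := r₂) (μ' := μ') hσ hx hzμ
    (norm_pos_iff.1 hΔ0))
  rw [norm_mul, norm_mul, norm_mul, norm_neg, norm_mul] at key
  have hpsi : ‖(psi σ r₁ r₂ z).1 x * (phi σ μ).2 x - (psi σ r₁ r₂ z).2 x * (phi σ μ).1 x‖ ≤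
      K * (q * ‖ρ‖) * E₁ * A := by
    refine (norm_sub_le _ _).trans ?_
    rw [norm_mul, norm_mul]
    have p1' : ‖(psi σ r₁ r₂ z).1 x‖ ≤ K * (q * ‖ρ‖) * E₁ := p1.trans (by
      gcongr
      exact le_mul_of_one_le_right hq0.le hρ1)
    rw [hA]
    linarith [mul_le_mul_of_nonneg_right p1' (norm_nonneg ((phi σ μ).2 x)),
      mul_le_mul_of_nonneg_right p2 (norm_nonneg ((phi σ μ).1 x))]
  have hphi : ‖(phi σ z).1 x * (phi σ μ').2 x - (phi σ z).2 x * (phi σ μ').1 x‖ ≤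
      L * ‖ρ‖ * E₂ * A' := by
    refine (norm_sub_le _ _).trans ?_
    rw [norm_mul, norm_mul]
    have q1' : ‖(phi σ z).1 x‖ ≤ L * ‖ρ‖ * E₂ := q1.trans (by
      gcongr
      exact le_mul_of_one_le_right hL.le hρ1)
    rw [hA']
    linarith [mul_le_mul_of_nonneg_right q1' (norm_nonneg ((phi σ μ').2 x)),
      mul_le_mul_of_nonneg_right q2 (norm_nonneg ((phi σ μ').1 x))]
  have hupper : ‖contourFun hσ r₁ r₂ x μ μ' z‖ *
      (‖charFun σ r₁ r₂ z‖ * (‖z - μ‖ * ‖z - μ'‖)) ≤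
      K * (q * ‖ρ‖) * E₁ * A * (L * ‖ρ‖ * E₂ * A') := by
    rw [key]
    gcongr
  have hlower : 1 / 16 * (q * ‖ρ‖) * E * (1 / 2 * ‖ρ‖ ^ 2 * (1 / 2 * ‖ρ‖ ^ 2)) ≤
      ‖charFun σ r₁ r₂ z‖ * (‖z - μ‖ * ‖z - μ'‖) := by
    have h1 := hsub μ hNμ
    have h2 := hsub μ' hNμ'
    gcongr
  rw [le_div_iff₀ (by positivity)]
  have h3 := (mul_le_mul_of_nonneg_left hlower
    (norm_nonneg (contourFun hσ r₁ r₂ x μ μ' z))).trans hupper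
  rw [← hE] at h3
  have hpos : 0 < q * ‖ρ‖ ^ 2 * E₁ * E₂ := by positivity
  refine le_of_mul_le_mul_right ?_ hpos
  calc ‖contourFun hσ r₁ r₂ x μ μ' z‖ * ‖ρ‖ ^ 3 * (q * ‖ρ‖ ^ 2 * E₁ * E₂) =
      64 * (‖contourFun hσ r₁ r₂ x μ μ' z‖ *
        (1 / 16 * (q * ‖ρ‖) * (E₁ * E₂) * (1 / 2 * ‖ρ‖ ^ 2 * (1 / 2 * ‖ρ‖ ^ 2)))) := by ring
    _ ≤ 64 * (K * (q * ‖ρ‖) * E₁ * A * (L * ‖ρ‖ * E₂ * A')) :=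
        mul_le_mul_of_nonneg_left h3 (by norm_num)
    _ = _ := by ring

/-- In the `ρ`-plane late eigenvalues lie within `1/2` of the integers `n - deg r₁` and early ones
in a bounded set, so the radius `N + 1/2` separates the index `N + deg r₁` from the next one.
Counting starts at `0`, hence the `+ 1`. -/
theorem IsSpectralData.eventually_lt_iff (h : IsSpectralData σ r₁ r₂ lam α) :
    ∀ᶠ N : ℕ in atTop, (∀ n, n < N + r₁.natDegree + 1 ↔ ‖lam n‖ < ((N : ℝ) + 1 / 2) ^ 2) ∧
      ∀ n, ‖lam n‖ ≠ ((N : ℝ) + 1 / 2) ^ 2 := by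
  obtain ⟨n₁, hn₁⟩ := eventually_atTop.1
    ((h.asymptotics.norm.eventually (gt_mem_nhds (by simp : ‖(0 : ℂ)‖ < 1 / 2))).and
      (eventually_ge_atTop r₁.natDegree))
  filter_upwards [tendsto_natCast_atTop_atTop.eventually_ge_atTop
    (∑ k ∈ Finset.range n₁, ‖rho (lam k)‖), eventually_ge_atTop n₁] with N hN hN'
  have hsmall : ∀ n < n₁, ‖rho (lam n)‖ < (N : ℝ) + 1 / 2 := by
    intro n hn
    have := Finset.single_le_sum (f := fun k => ‖rho (lam k)‖) (fun _ _ => norm_nonneg _)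
      (Finset.mem_range.2 hn)
    linarith
  have hlarge : ∀ n, n₁ ≤ n → |‖rho (lam n)‖ - ((n : ℝ) - r₁.natDegree)| < 1 / 2 := by
    intro n hn
    obtain ⟨h1, h2⟩ := hn₁ n hn
    rw [← Nat.cast_sub h2] at h1
    have h4 := abs_norm_sub_norm_le (rho (lam n)) ((n - r₁.natDegree : ℕ) : ℂ)
    rw [Complex.norm_natCast, Nat.cast_sub h2] at h4
    rw [Nat.cast_sub h2] at h1
    rw [Nat.cast_sub h2] at h4
    exact h4.trans_lt h1
  have hlt : ∀ n, n < N + r₁.natDegree + 1 → ‖rho (lam n)‖ < (N : ℝ) + 1 / 2 := by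
    intro n hn
    rcases lt_or_ge n n₁ with hn' | hn'
    · exact hsmall n hn'
    · have h1 := abs_lt.1 (hlarge n hn')
      have h2 : (n : ℝ) ≤ N + r₁.natDegree := by exact_mod_cast Nat.lt_succ_iff.1 hn
      linarith
  have hgt : ∀ n, ¬ n < N + r₁.natDegree + 1 → (N : ℝ) + 1 / 2 < ‖rho (lam n)‖ := by
    intro n hn
    have h1 := abs_lt.1 (hlarge n (by omega))
    have h2 : (N : ℝ) + r₁.natDegree + 1 ≤ n := by exact_mod_cast not_lt.1 hn
    linarith
  refine ⟨fun n => ⟨fun hn => ?_, fun hn => ?_⟩, fun n hn => ?_⟩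
  · rw [← norm_rho_sq]
    have := hlt n hn
    gcongr
  · by_contra hn'
    rw [← norm_rho_sq] at hn
    have h1 := hgt n hn'
    exact hn.not_gt (by gcongr)
  · rw [← norm_rho_sq] at hn
    have h1 := (pow_left_inj₀ (norm_nonneg _) (by positivity) two_ne_zero).1 hn
    by_cases hn' : n < N + r₁.natDegree + 1
    · exact (hlt n hn').ne h1
    · exact (hgt n hn').ne' h1

/-- The contour integral identity: the residues of the Weyl function reproduce
`∫₀ˣ φ(·, μ) φ(·, μ')`. -/
theorem tendsto_sum_residues (hσ : MemLp σ 2 (volume.restrict (Ioo 0 Real.pi)))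
    (hr : IsAdmissible r₁ r₂) (h : IsSpectralData σ r₁ r₂ lam α) {x : ℝ} (hx : x ∈ Icc 0 Real.pi)
    (μ μ' : ℂ) :
    Tendsto (fun N => ∑ n ∈ Finset.range N, α n * (iteratedDeriv (pos lam n) (fun z =>
      pair x (phiVec hσ x z) (phiVec hσ x μ) * pair x (phiVec hσ x z) (phiVec hσ x μ')) (lam n) /
        (pos lam n).factorial)) atTop (𝓝 (pair x (phiVec hσ x μ) (phiVec hσ x μ'))) := by
  rw [← tendsto_add_atTop_iff_nat (r₁.natDegree + 1), tendsto_iff_norm_sub_tendsto_zero]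
  obtain ⟨C, hC⟩ := exists_norm_contourFun_le hσ hr hx μ μ'
  have hlim : Tendsto (fun N : ℕ => C / ((N : ℝ) + 1 / 2)) atTop (𝓝 0) :=
    (tendsto_atTop_add_const_right _ _ tendsto_natCast_atTop_atTop).const_div_atTop _
  refine squeeze_zero' (Eventually.of_forall fun _ => norm_nonneg _) ?_ hlim
  filter_upwards [hC, h.eventually_lt_iff, tendsto_natCast_atTop_atTop.eventually_ge_atTop ‖μ‖]
    with N hCN hN hμ
  have hμ' : ‖μ‖ < ((N : ℝ) + 1 / 2) ^ 2 := by
    nlinarith [norm_nonneg μ]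
  have h1 := circleIntegral_contourFun hσ h (x := x) μ μ' hμ' hN.1 hN.2
  have h2 := circleIntegral.norm_integral_le_of_norm_le_const (by positivity) hCN
  rw [h1, norm_mul] at h2
  have h3 : ‖(2 * Real.pi * Complex.I : ℂ)‖ = 2 * Real.pi := by
    simp [abs_of_pos Real.pi_pos]
  rw [h3] at h2
  have h4 : (0 : ℝ) < 2 * Real.pi := by positivity
  refine le_of_mul_le_mul_left (h2.trans (le_of_eq ?_)) h4
  have : (N : ℝ) + 1 / 2 ≠ 0 := by positivity
  field_simp

end ContourLimit


/-! ### The transformation operator -/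

section Model

theorem memLp_zero_potential : MemLp (0 : ℝ → ℂ) 2 (volume.restrict (Ioo 0 Real.pi)) :=
  MemLp.zero

theorem phi_zero (ρ : ℂ) {t : ℝ} (ht : t ∈ Icc 0 Real.pi) :
    (phi 0 (ρ ^ 2)).1 t = Complex.cos (ρ * t) := by
  obtain ⟨h1, h2, h3⟩ := phi_spec memLp_zero_potential (ρ ^ 2)
  have hlin : ∀ s : ℝ, HasDerivAt (fun s : ℝ => ρ * (s : ℂ)) ρ s := fun s => by
    simpa using (Complex.ofRealCLM.hasDerivAt (x := s)).const_mul ρ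
  have hd1 : ∀ s : ℝ, HasDerivAt (fun s : ℝ => Complex.cos (ρ * s))
      (-ρ * Complex.sin (ρ * s)) s := fun s => by
    refine ((Complex.hasDerivAt_cos (ρ * (s : ℂ))).comp s (hlin s)).congr_deriv ?_
    ring
  have hd2 : ∀ s : ℝ, HasDerivAt (fun s : ℝ => -ρ * Complex.sin (ρ * s))
      (-(ρ ^ 2 * Complex.cos (ρ * s))) s := fun s => by
    refine (((Complex.hasDerivAt_sin (ρ * (s : ℂ))).comp s (hlin s)).const_mul (-ρ)).congr_deriv ?_
    ring
  have hs : IsSolution 0 (ρ ^ 2) (fun s => Complex.cos (ρ * s))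
      (fun s => -ρ * Complex.sin (ρ * s)) := by
    refine ⟨Continuous.continuousOn (by fun_prop), Continuous.continuousOn (by fun_prop),
      fun x _ => ?_, fun x _ => ?_⟩
    · have := intervalIntegral.integral_eq_sub_of_hasDerivAt (a := 0) (b := x)
        (fun s _ => hd1 s) (Continuous.intervalIntegrable (by fun_prop) _ _)
      simp only [Pi.zero_apply, zero_mul, add_zero, this]
      ring
    · have := intervalIntegral.integral_eq_sub_of_hasDerivAt (a := 0) (b := x)
        (fun s _ => hd2 s) (Continuous.intervalIntegrable (by fun_prop) _ _)
      rw [intervalIntegral.integral_neg] at this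
      simp only [Pi.zero_apply, zero_mul, add_zero, zero_add, ne_eq, OfNat.ofNat_ne_zero,
        not_false_eq_true, zero_pow]
      linear_combination -this
  exact (h1.unique memLp_zero_potential hs (by simp [h2]) (by simp [h3]) ht).1

/-- `cos (√lam ·)` as an element of `L²(0, x)`. -/
def cosVec (x : ℝ) (lam : ℂ) : IntervalL2 x := phiVec memLp_zero_potential x lam

theorem differentiable_cosVec (x : ℝ) : Differentiable ℂ (cosVec x) :=
  differentiable_phiVec memLp_zero_potential x

theorem phiVec_ae {σ : ℝ → ℂ} (hσ : MemLp σ 2 (volume.restrict (Ioo 0 Real.pi))) {x : ℝ}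
    (hx : x ∈ Icc 0 Real.pi) (lam : ℂ) :
    ∀ᵐ t ∂volume, t ∈ Ioc 0 x → phiVec hσ x lam t = (phi σ lam).1 t := by
  filter_upwards [(ae_restrict_iff' measurableSet_Ioc).1 (curveL2_ae x (solCurve hσ 1 0 lam))]
    with t h ht
  rw [phiVec, h ht, extend_solCurve hσ _ _ _ ⟨ht.1.le, ht.2.trans hx.2⟩]
  rfl

theorem cosVec_ae {x : ℝ} (hx : x ∈ Icc 0 Real.pi) (ρ : ℂ) :
    ∀ᵐ t ∂volume, t ∈ Ioc 0 x → cosVec x (ρ ^ 2) t = Complex.cos (ρ * t) := by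
  filter_upwards [phiVec_ae memLp_zero_potential hx (ρ ^ 2)] with t h ht
  rw [cosVec, h ht, phi_zero ρ ⟨ht.1.le, ht.2.trans hx.2⟩]

end Model

/-! ### Even extension to the line and the cosine transform. -/

section Extension

variable {x : ℝ}

theorem memLp_zeroExt (F : IntervalL2 x) : MemLp ((Ioc 0 x).indicator F) 2 (volume : Measure ℝ) :=
  (memLp_indicator_iff_restrict measurableSet_Ioc).2 (Lp.memLp F)

/-- Extension by zero. -/
def zeroExt (x : ℝ) : IntervalL2 x →ₗᵢ[ℂ] LineL2 where
  toFun F := (memLp_zeroExt F).toLp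
  map_add' F G := by
    rw [← MemLp.toLp_add]
    refine MemLp.toLp_congr _ _ ?_
    filter_upwards [(ae_restrict_iff' measurableSet_Ioc).1 (Lp.coeFn_add F G)] with s hs
    by_cases h : s ∈ Ioc 0 x
    · rw [Pi.add_apply, indicator_of_mem h, indicator_of_mem h, indicator_of_mem h, hs h,
        Pi.add_apply]
    · simp [indicator_of_notMem h]
  map_smul' c F := by
    rw [RingHom.id_apply, ← MemLp.toLp_const_smul]
    refine MemLp.toLp_congr _ _ ?_
    filter_upwards [(ae_restrict_iff' measurableSet_Ioc).1 (Lp.coeFn_smul c F)] with s hs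
    by_cases h : s ∈ Ioc 0 x
    · simp [indicator_of_mem h, hs h, -mem_Ioc]
    · simp [indicator_of_notMem h]
  norm_map' F := by
    refine (sq_eq_sq₀ (norm_nonneg _) (norm_nonneg _)).1 ?_
    rw [norm_sq_eq_integral, norm_sq_eq_integral, ← integral_indicator measurableSet_Ioc]
    refine integral_congr_ae ?_
    filter_upwards [(memLp_zeroExt F).coeFn_toLp] with s hs
    change ‖(memLp_zeroExt F).toLp _ s‖ ^ 2 = _
    rw [hs]
    by_cases h : s ∈ Ioc 0 x
    · simp [indicator_of_mem h, -mem_Ioc]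
    · simp [indicator_of_notMem h]

theorem zeroExt_ae (F : IntervalL2 x) : zeroExt x F =ᵐ[volume] (Ioc 0 x).indicator F :=
  (memLp_zeroExt F).coeFn_toLp

theorem zeroExt_mem (F : IntervalL2 x) : zeroExt x F ∈ supportedIn (Icc (-x) x) := by
  rw [mem_supportedIn measurableSet_Icc]
  filter_upwards [zeroExt_ae F] with s hs h
  rw [hs, indicator_of_notMem]
  exact fun h' => h ⟨by linarith [h'.1, h'.2], h'.2⟩

/-- `h(s) + h(-s)`. -/
def symmetrize : LineL2 →L[ℂ] LineL2 :=
  ContinuousLinearMap.id ℂ _ + mirror.toContinuousLinearMap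

theorem symmetrize_apply (h : LineL2) : symmetrize h = h + mirror h := rfl

theorem symmetrize_ae (h : LineL2) : symmetrize h =ᵐ[volume] fun s => h s + h (-s) := by
  filter_upwards [Lp.coeFn_add h (mirror h), mirror_ae h] with s h1 h2
  rw [symmetrize_apply, h1, Pi.add_apply, h2]

theorem norm_symmetrize_le (h : LineL2) : ‖symmetrize h‖ ≤ 2 * ‖h‖ := by
  rw [symmetrize_apply]
  refine (norm_add_le _ _).trans ?_
  rw [LinearIsometry.norm_map]
  linarith

theorem symmetrize_mem {h : LineL2} (hh : h ∈ supportedIn (Icc (-x) x)) :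
    symmetrize h ∈ supportedIn (Icc (-x) x) := by
  refine add_mem hh (mirror_mem measurableSet_Icc measurableSet_Icc (fun s hs => ?_) hh)
  exact ⟨by linarith [hs.2], by linarith [hs.1]⟩

/-- An even function only sees the even part of the exponential. Pairings with cosines thereby
become Fourier integrals, for which Parseval's identity and the local means are available. -/
theorem fourierInt_symmetrize_zeroExt (hx : x ∈ Icc 0 Real.pi) (F : IntervalL2 x) (ρ : ℂ) :
    fourierInt ρ (symmetrize (zeroExt x F)) = 2 * pair x F (cosVec x (ρ ^ 2)) := by
  have hI : Icc (-x) x ⊆ Icc (-10) 10 := Icc_subset_Icc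
    (by linarith [Real.pi_lt_four, hx.2]) (by linarith [Real.pi_lt_four, hx.2])
  have h1 : ∀ ρ, fourierInt ρ (zeroExt x F) =
      ∫ s in Ioc 0 x, F s * Complex.exp (Complex.I * ρ * s) := by
    intro ρ
    rw [fourierInt_eq_integral ρ measurableSet_Icc hI (zeroExt_mem F),
      ← integral_indicator measurableSet_Ioc]
    refine integral_congr_ae ?_
    filter_upwards [zeroExt_ae F] with s hs
    rw [hs]
    by_cases h : s ∈ Ioc 0 x
    · simp [indicator_of_mem h, -mem_Ioc]
    · simp [indicator_of_notMem h]
  have hi : ∀ ρ : ℂ, Integrable (fun s : ℝ => F s * Complex.exp (Complex.I * ρ * s))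
      (volume.restrict (Ioc 0 x)) := by
    intro ρ
    have h2 : MemLp (fun s : ℝ => Complex.exp (Complex.I * ρ * s)) 2
        (volume.restrict (Ioc 0 x)) :=
      (memLp_Icc_of_continuous (by fun_prop) 0 x).mono_measure
        (Measure.restrict_mono Ioc_subset_Icc_self le_rfl)
    exact (Lp.memLp F).integrable_mul h2
  rw [symmetrize_apply, map_add, fourierInt_mirror, h1, h1, ← integral_add (hi _) (hi _),
    pair_apply, ← integral_const_mul]
  refine setIntegral_congr_ae measurableSet_Ioc ?_
  filter_upwards [cosVec_ae hx ρ] with s hs h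
  rw [hs h, Complex.cos, ← mul_add]
  have e1 : Complex.I * -ρ * (s : ℂ) = -(ρ * s) * Complex.I := by ring
  have e2 : Complex.I * ρ * (s : ℂ) = ρ * s * Complex.I := by ring
  rw [e1, e2]
  ring

theorem norm_cutoff_zeroExt_sq (F : IntervalL2 x) {t : ℝ} (ht : 0 ≤ t) (htx : t ≤ x) :
    ‖cutoff (zeroExt x F) t‖ ^ 2 = ∫ s in (0 : ℝ)..t, ‖F s‖ ^ 2 := by
  have h0 : cutoff (zeroExt x F) 0 = 0 := by
    refine Lp.ext ?_
    filter_upwards [cutoff_ae (zeroExt x F) 0, Lp.coeFn_zero ℂ 2 (volume : Measure ℝ)] with s h1 h2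
    rw [h1, h2, Ioc_self]
    simp
  have h1 := norm_cutoff_sub_sq (zeroExt x F) le_rfl ht
  rw [h0, sub_zero, intervalIntegral.integral_same, sub_zero] at h1
  rw [h1, intervalIntegral.integral_of_le ht, intervalIntegral.integral_of_le ht]
  refine setIntegral_congr_ae measurableSet_Ioc ?_
  filter_upwards [zeroExt_ae F] with s hs h
  have h' : s ∈ Ioc 0 x := ⟨h.1, h.2.trans htx⟩
  rw [hs, indicator_of_mem h']

end Extension

/-! ### The operator that carries cosines to solutions. -/

section Transmutation

variable {x : ℝ}

/-- The bilinear pairing `∫ f g` on the line. -/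
def linePair : LineL2 →L[ℂ] LineL2 →L[ℂ] ℂ :=
  (ContinuousLinearMap.mul ℂ ℂ).lpPairing (volume : Measure ℝ) 2 2

theorem linePair_apply (f g : LineL2) : linePair f g = ∫ s, f s * g s := by
  rw [linePair, ContinuousLinearMap.lpPairing_eq_integral]
  rfl

theorem norm_linePair_le (f g : LineL2) : ‖linePair f g‖ ≤ ‖f‖ * ‖g‖ := by
  have h : linePair f g = inner ℂ (star f) g := by
    rw [linePair_apply, L2.inner_def]
    refine integral_congr_ae ?_
    filter_upwards [Lp.coeFn_star f] with s hs
    rw [hs]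
    simp [mul_comm]
  rw [h]
  refine (norm_inner_le_norm _ _).trans ?_
  gcongr
  refine Lp.norm_le_norm_of_ae_le ?_
  filter_upwards [Lp.coeFn_star f] with s hs
  rw [hs]
  simp

/-- The integral operator with kernel `k(t)(s)` acting on even functions. -/
def kernelOp (k : Curve LineL2) (x : ℝ) : IntervalL2 x →L[ℂ] Curve ℂ :=
  LinearMap.mkContinuous
    { toFun := fun F => ContinuousLinearMap.compLeftContinuous ℂ _
        (linePair.flip (symmetrize (zeroExt x F))) k
      map_add' := fun F G => by
        ext t
        change linePair (k t) (symmetrize (zeroExt x (F + G))) =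
          linePair (k t) (symmetrize (zeroExt x F)) + linePair (k t) (symmetrize (zeroExt x G))
        simp only [map_add]
      map_smul' := fun c F => by
        ext t
        change linePair (k t) (symmetrize (zeroExt x (c • F))) =
          c • linePair (k t) (symmetrize (zeroExt x F))
        simp only [map_smul] }
    (2 * ‖k‖) fun F => by
      refine (ContinuousMap.norm_le _ (by positivity)).2 fun t => ?_
      change ‖linePair (k t) (symmetrize (zeroExt x F))‖ ≤ _
      refine (norm_linePair_le _ _).trans ?_
      have h1 := norm_symmetrize_le (zeroExt x F)
      rw [LinearIsometry.norm_map] at h1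
      calc _ ≤ ‖k‖ * (2 * ‖F‖) := by
            gcongr
            exact k.norm_coe_le_norm t
        _ = _ := by ring

theorem kernelOp_apply (k : Curve LineL2) (F : IntervalL2 x) (t : Icc (0 : ℝ) Real.pi) :
    kernelOp k x F t = linePair (k t) (symmetrize (zeroExt x F)) := rfl

variable {k : Curve LineL2}

/-- Since `k t` lives on `[-t, t]`, only the part of `F` on `(0, t]` enters. This Volterra property
makes the iterates decay factorially in `integral_norm_iterate_le`. -/
theorem norm_kernelOp_sq_le
    (hk : ∀ t : Icc (0 : ℝ) Real.pi, k t ∈ supportedIn (Icc (-t) t)) (F : IntervalL2 x) (t : Icc (0 : ℝ) Real.pi)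
    (ht : (t : ℝ) ≤ x) :
    ‖kernelOp k x F t‖ ^ 2 ≤ (2 * ‖k‖) ^ 2 * ∫ s in (0 : ℝ)..t, ‖F s‖ ^ 2 := by
  have h1 : kernelOp k x F t = linePair (k t) (symmetrize (cutoff (zeroExt x F) t)) := by
    rw [kernelOp_apply, linePair_apply, linePair_apply]
    refine integral_congr_ae ?_
    have hn := (Measure.measurePreserving_neg volume).quasiMeasurePreserving.ae
      (cutoff_ae (zeroExt x F) t)
    have hn' := (Measure.measurePreserving_neg volume).quasiMeasurePreserving.ae (zeroExt_ae F)
    filter_upwards [(mem_supportedIn measurableSet_Icc).1 (hk t), symmetrize_ae (zeroExt x F),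
      symmetrize_ae (cutoff (zeroExt x F) t), cutoff_ae (zeroExt x F) t, hn, zeroExt_ae F, hn']
      with s g1 g2 g3 g4 g5 g6 g7
    by_cases h : s ∈ Icc (-(t : ℝ)) t
    · have e : ∀ u : ℝ, u ≤ t → (Ioc 0 x).indicator F u =
          (Ioc 0 (t : ℝ)).indicator ((Ioc 0 x).indicator F) u := by
        intro u hu
        by_cases h0 : 0 < u
        · rw [indicator_of_mem (s := Ioc 0 (t : ℝ)) ⟨h0, hu⟩]
        · rw [indicator_of_notMem fun h => h0 h.1, indicator_of_notMem fun h => h0 h.1]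
      have i1 : ∀ u : ℝ, zeroExt x F u = (Ioc 0 x).indicator F u →
          (Ioc 0 (t : ℝ)).indicator (zeroExt x F) u =
            (Ioc 0 (t : ℝ)).indicator ((Ioc 0 x).indicator F) u := by
        intro u hu
        by_cases h0 : u ∈ Ioc 0 (t : ℝ)
        · rw [indicator_of_mem h0, indicator_of_mem h0, hu]
        · rw [indicator_of_notMem h0, indicator_of_notMem h0]
      rw [g2, g3, g4, g5, i1 _ g6, i1 _ g7, g6, g7, ← e s h.2, ← e (-s) (by linarith [h.1])]
    · rw [g1 h, zero_mul, zero_mul]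
  rw [h1, ← norm_cutoff_zeroExt_sq F t.2.1 ht, ← mul_pow]
  refine pow_le_pow_left₀ (norm_nonneg _) ((norm_linePair_le _ _).trans ?_) 2
  have h2 := norm_symmetrize_le (cutoff (zeroExt x F) t)
  calc _ ≤ ‖k‖ * (2 * ‖cutoff (zeroExt x F) t‖) := by
        gcongr
        exact k.norm_coe_le_norm t
    _ = _ := by ring

theorem integral_norm_iterate_le
    (hk : ∀ t : Icc (0 : ℝ) Real.pi, k t ∈ supportedIn (Icc (-t) t)) (hx : x ∈ Icc 0 Real.pi) (F : IntervalL2 x) (n : ℕ) :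
    ∀ t ∈ Icc 0 x, ∫ s in (0 : ℝ)..t, ‖((curveL2 x ∘L kernelOp k x) ^ n) F s‖ ^ 2 ≤
      ((2 * ‖k‖) ^ 2) ^ n * t ^ n / n.factorial * ‖F‖ ^ 2 := by
  induction n with
  | zero =>
    intro t ht
    simp only [pow_zero, Nat.factorial_zero, Nat.cast_one, mul_one, div_one, one_mul]
    rw [norm_sq_eq_integral, intervalIntegral.integral_of_le ht.1]
    exact setIntegral_mono_set (integrable_norm_sq F) (Eventually.of_forall fun s => by positivity)
      (Ioc_subset_Ioc_right ht.2).eventuallyLE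
  | succ n ih =>
    intro t ht
    set G := ((curveL2 x ∘L kernelOp k x) ^ n) F with hG
    have h1 : ((curveL2 x ∘L kernelOp k x) ^ (n + 1)) F = curveL2 x (kernelOp k x G) := by
      rw [pow_succ']
      rfl
    have h2 : ∫ s in (0 : ℝ)..t, ‖((curveL2 x ∘L kernelOp k x) ^ (n + 1)) F s‖ ^ 2 =
        ∫ s in (0 : ℝ)..t, ‖extend (kernelOp k x G) s‖ ^ 2 := by
      rw [h1, intervalIntegral.integral_of_le ht.1, intervalIntegral.integral_of_le ht.1]
      refine setIntegral_congr_ae measurableSet_Ioc ?_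
      filter_upwards [(ae_restrict_iff' measurableSet_Ioc).1 (curveL2_ae x (kernelOp k x G))]
        with s hs h
      rw [hs ⟨h.1, h.2.trans ht.2⟩]
    rw [h2]
    have h3 : ∀ s ∈ Icc 0 t, ‖extend (kernelOp k x G) s‖ ^ 2 ≤
        (2 * ‖k‖) ^ 2 * (((2 * ‖k‖) ^ 2) ^ n * s ^ n / n.factorial * ‖F‖ ^ 2) := by
      intro s hs
      have hs' : s ∈ Icc 0 Real.pi := ⟨hs.1, (hs.2.trans ht.2).trans hx.2⟩
      rw [extend, IccExtend_of_mem _ _ hs']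
      refine (norm_kernelOp_sq_le hk G ⟨s, hs'⟩ (hs.2.trans ht.2)).trans ?_
      gcongr
      exact ih s ⟨hs.1, hs.2.trans ht.2⟩
    refine (intervalIntegral.integral_mono_on ht.1 (Continuous.intervalIntegrable
      ((continuous_extend _).norm.pow 2) _ _) (Continuous.intervalIntegrable (by fun_prop) _ _)
      h3).trans (le_of_eq ?_)
    rw [intervalIntegral.integral_const_mul, intervalIntegral.integral_mul_const,
      intervalIntegral.integral_div, intervalIntegral.integral_const_mul, integral_pow,
      Nat.factorial_succ]
    have := Nat.factorial_ne_zero n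
    push_cast
    field_simp
    ring

theorem isUnit_one_add_kernelOp
    (hk : ∀ t : Icc (0 : ℝ) Real.pi, k t ∈ supportedIn (Icc (-t) t)) (hx : x ∈ Icc 0 Real.pi) :
    IsUnit (1 + curveL2 x ∘L kernelOp k x) := by
  set T := curveL2 x ∘L kernelOp k x with hT
  have h1 : ∀ n : ℕ, ‖T ^ n‖ ^ 2 ≤ ((2 * ‖k‖) ^ 2 * Real.pi) ^ n / n.factorial := by
    intro n
    have h2 : ‖T ^ n‖ ≤ √(((2 * ‖k‖) ^ 2 * Real.pi) ^ n / n.factorial) := by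
      refine ContinuousLinearMap.opNorm_le_bound _ (Real.sqrt_nonneg _) fun F => ?_
      refine abs_le_of_sq_le_sq' ?_ (by positivity) |>.2
      rw [mul_pow, Real.sq_sqrt (by have := Real.pi_pos; positivity), norm_sq_eq_integral,
        ← intervalIntegral.integral_of_le hx.1]
      refine (integral_norm_iterate_le hk hx F n x (right_mem_Icc.2 hx.1)).trans ?_
      rw [mul_pow _ Real.pi]
      have := hx.1
      have := hx.2
      gcongr
    calc ‖T ^ n‖ ^ 2 ≤ √(((2 * ‖k‖) ^ 2 * Real.pi) ^ n / n.factorial) ^ 2 := by gcongr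
      _ = _ := Real.sq_sqrt (by have := Real.pi_pos; positivity)
  obtain ⟨n, hn⟩ := ((FloorSemiring.tendsto_pow_div_factorial_atTop
    ((2 * ‖k‖) ^ 2 * Real.pi)).eventually (gt_mem_nhds one_pos)).exists
  have h2 : ‖(-T) ^ n‖ < 1 := by
    have h3 : ‖(-T) ^ n‖ = ‖T ^ n‖ := by
      rcases neg_one_pow_eq_or (IntervalL2 x →L[ℂ] IntervalL2 x) n with h | h <;>
        simp [neg_pow T n, h]
    rw [h3]
    by_contra h4
    push Not at h4
    have := (h1 n).trans_lt hn
    nlinarith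
  have h3 := isUnit_one_sub_of_norm_pow_lt_one (-T) n h2
  rwa [sub_neg_eq_add] at h3

/-- Both `φ(·, ρ²)` and `cos(ρt)` are even in `ρ`, so averaging the representation over `±ρ`
replaces the exponential under the Fourier integral by `cos(ρs)`. This exhibits `φ` as the image of
the cosine under `1 + curveL2 x ∘L kernelOp k x`, one operator for all `ρ`. -/
theorem exists_transmutation {σ : ℝ → ℂ} (hσ : MemLp σ 2 (volume.restrict (Ioo 0 Real.pi)))
    (hx : x ∈ Icc 0 Real.pi) : ∃ T : IntervalL2 x ≃L[ℂ] IntervalL2 x,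
      ∀ lam, T (cosVec x lam) = phiVec hσ x lam := by
  obtain ⟨C, k, l, -, hkl, hφ⟩ := exists_phi_representation hσ
  have hk := fun t => (hkl t).1
  obtain ⟨u, hu⟩ := isUnit_one_add_kernelOp hk hx
  refine ⟨ContinuousLinearEquiv.unitsEquiv ℂ _ u, fun lam => ?_⟩
  obtain ⟨ρ, rfl⟩ : ∃ ρ, ρ ^ 2 = lam := ⟨rho lam, rho_sq lam⟩
  rw [ContinuousLinearEquiv.unitsEquiv_apply, hu]
  change cosVec x (ρ ^ 2) + curveL2 x (kernelOp k x (cosVec x (ρ ^ 2))) = _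
  refine Lp.ext ?_
  have key : ∀ t ∈ Ioc 0 x, extend (kernelOp k x (cosVec x (ρ ^ 2))) t =
      (phi σ (ρ ^ 2)).1 t - Complex.cos (ρ * t) := by
    intro t ht
    have ht' : t ∈ Icc 0 Real.pi := ⟨ht.1.le, ht.2.trans hx.2⟩
    have hI : Icc (-t) t ⊆ Icc (-10) 10 := Icc_subset_Icc
      (by linarith [Real.pi_lt_four, ht'.2]) (by linarith [Real.pi_lt_four, ht'.2])
    have hkt : extend k t = k ⟨t, ht'⟩ := IccExtend_of_mem _ _ ht'
    have h1 : ∀ ρ : ℂ, fourierInt ρ (k ⟨t, ht'⟩) = (phi σ (ρ ^ 2)).1 t - Complex.cos (ρ * t) := by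
      intro ρ
      rw [(hφ ρ t ht').1, hkt]
      ring
    have h2 : (phi σ (ρ ^ 2)).1 t - Complex.cos (ρ * t) =
        (fourierInt ρ (k ⟨t, ht'⟩) + fourierInt (-ρ) (k ⟨t, ht'⟩)) / 2 := by
      rw [h1, h1, neg_sq, neg_mul, Complex.cos_neg]
      ring
    have hint : ∀ ρ : ℂ, IntegrableOn (fun s : ℝ => k ⟨t, ht'⟩ s *
        Complex.exp (Complex.I * ρ * s)) (Icc (-t) t) := fun ρ =>
      (integrableOn_LineL2 _ _ _).mul_continuousOn (Continuous.continuousOn (by fun_prop))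
        isCompact_Icc
    rw [h2, fourierInt_eq_setIntegral ρ measurableSet_Icc hI (hk ⟨t, ht'⟩),
      fourierInt_eq_setIntegral (-ρ) measurableSet_Icc hI (hk ⟨t, ht'⟩),
      ← integral_add (hint _) (hint _), ← integral_div, extend, IccExtend_of_mem _ _ ht',
      kernelOp_apply, linePair_apply, ← integral_indicator measurableSet_Icc]
    refine integral_congr_ae ?_
    have hn := (Measure.measurePreserving_neg volume).quasiMeasurePreserving.ae
      (zeroExt_ae (cosVec x (ρ ^ 2)))
    have hn' := (Measure.measurePreserving_neg volume).quasiMeasurePreserving.ae (cosVec_ae hx ρ)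
    have hne : ∀ᵐ s : ℝ, s ≠ 0 := (countable_singleton (0 : ℝ)).ae_notMem volume
    filter_upwards [(mem_supportedIn measurableSet_Icc).1 (hk ⟨t, ht'⟩),
      symmetrize_ae (zeroExt x (cosVec x (ρ ^ 2))), zeroExt_ae (cosVec x (ρ ^ 2)), hn,
      cosVec_ae hx ρ, hn', hne] with s g1 g2 g3 g4 g5 g6 g7
    by_cases h : s ∈ Icc (-t) t
    · have hcos : symmetrize (zeroExt x (cosVec x (ρ ^ 2))) s = Complex.cos (ρ * s) := by
        rw [g2, g3, g4]
        rcases lt_or_gt_of_ne g7 with h0 | h0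
        · have hm : -s ∈ Ioc 0 x := ⟨by linarith, by linarith [h.1, ht.2]⟩
          rw [indicator_of_notMem fun h' => (h'.1.trans h0).false, indicator_of_mem hm, zero_add,
            g6 hm]
          push_cast
          rw [mul_neg, Complex.cos_neg]
        · have hm : s ∈ Ioc 0 x := ⟨h0, by linarith [h.2, ht.2]⟩
          rw [indicator_of_mem hm, indicator_of_notMem fun h' => by linarith [h'.1], add_zero,
            g5 hm]
      rw [indicator_of_mem h, hcos, Complex.cos]
      have e1 : Complex.I * -ρ * (s : ℂ) = -(ρ * s) * Complex.I := by ring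
      have e2 : Complex.I * ρ * (s : ℂ) = ρ * s * Complex.I := by ring
      rw [e1, e2]
      ring
    · rw [indicator_of_notMem h, g1 h, zero_mul]
  filter_upwards [Lp.coeFn_add (cosVec x (ρ ^ 2)) (curveL2 x (kernelOp k x (cosVec x (ρ ^ 2)))),
    curveL2_ae x (kernelOp k x (cosVec x (ρ ^ 2))), ae_restrict_of_ae (cosVec_ae hx ρ),
    ae_restrict_of_ae (phiVec_ae hσ hx (ρ ^ 2)), ae_restrict_mem measurableSet_Ioc]
    with t h1 h2 h3 h4 ht
  rw [h1, Pi.add_apply, h2, key t ht, h3 ht, h4 ht]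
  ring

end Transmutation


/-! ### Cosine series in `L²(0, x)` -/

section CosineSeries

variable {x : ℝ}

theorem symmetrize_zeroExt_mem (hx : x ∈ Icc 0 Real.pi) (F : IntervalL2 x) :
    symmetrize (zeroExt x F) ∈ supportedIn (Icc (-Real.pi) Real.pi) :=
  supportedIn_mono measurableSet_Icc measurableSet_Icc
    (Icc_subset_Icc (neg_le_neg hx.2) hx.2) (symmetrize_mem (zeroExt_mem F))

theorem norm_symmetrize_zeroExt_sq (F : IntervalL2 x) :
    ‖symmetrize (zeroExt x F)‖ ^ 2 = 2 * ‖F‖ ^ 2 := by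
  have h1 : ‖symmetrize (zeroExt x F)‖ ^ 2 =
      ‖zeroExt x F‖ ^ 2 + ‖mirror (zeroExt x F)‖ ^ 2 := by
    rw [norm_sq_eq_integral, norm_sq_eq_integral, norm_sq_eq_integral,
      ← integral_add (integrable_norm_sq _) (integrable_norm_sq _)]
    refine integral_congr_ae ?_
    have hn := (Measure.measurePreserving_neg volume).quasiMeasurePreserving.ae (zeroExt_ae F)
    filter_upwards [symmetrize_ae (zeroExt x F), mirror_ae (zeroExt x F), zeroExt_ae F, hn]
      with s g1 g2 g3 g4
    rw [g1, g2, g3, g4]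
    by_cases h : s ∈ Ioc 0 x
    · rw [indicator_of_notMem (a := -s) fun h' => by linarith [h.1, h'.1]]
      simp
    · rw [indicator_of_notMem h]
      simp
  rw [h1, mirror.norm_map, (zeroExt x).norm_map]
  ring

/-- Parseval's identity for the even extension, with `n` and `-n` combined. Combining them counts `n
= 0` twice, which accounts for the additional term on the right. -/
theorem hasSum_cosine_sq (hx : x ∈ Icc 0 Real.pi) (F : IntervalL2 x) :
    HasSum (fun n : ℕ => 2 / Real.pi * ‖pair x F (cosVec x ((n : ℂ) ^ 2))‖ ^ 2)
      (‖F‖ ^ 2 + 1 / Real.pi * ‖pair x F (cosVec x 0)‖ ^ 2) := by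
  have h1 := hasSum_norm_fourierInt_sq (symmetrize_zeroExt_mem hx F)
  simp only [fourierInt_symmetrize_zeroExt hx, norm_symmetrize_zeroExt_sq] at h1
  have h2 := h1.nat_add_neg.mul_left (1 / (4 * Real.pi))
  have hpi := Real.pi_pos
  simp only [norm_mul, mul_pow, Int.cast_natCast, Int.cast_neg, neg_sq, RCLike.norm_ofNat,
    Int.cast_zero, ne_eq, OfNat.ofNat_ne_zero, not_false_eq_true, zero_pow] at h2
  have h3 : ‖F‖ ^ 2 + 1 / Real.pi * ‖pair x F (cosVec x 0)‖ ^ 2 = 1 / (4 * Real.pi) *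
      (2 * Real.pi * (2 * ‖F‖ ^ 2) + 2 ^ 2 * ‖pair x F (cosVec x 0)‖ ^ 2) := by
    field_simp
    ring
  rw [h3]
  refine h2.congr_fun fun n => ?_
  field_simp
  ring

theorem eq_zero_of_pair_cosVec (hx : x ∈ Icc 0 Real.pi) {F : IntervalL2 x}
    (h : ∀ n : ℕ, pair x F (cosVec x ((n : ℂ) ^ 2)) = 0) : F = 0 := by
  have h1 := hasSum_cosine_sq hx F
  have h0 := h 0
  simp only [Nat.cast_zero, ne_eq, OfNat.ofNat_ne_zero, not_false_eq_true, zero_pow] at h0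
  simp only [h, h0, norm_zero, ne_eq, OfNat.ofNat_ne_zero, not_false_eq_true, zero_pow, mul_zero,
    add_zero] at h1
  exact norm_eq_zero.1 (pow_eq_zero_iff two_ne_zero |>.1 (h1.unique hasSum_zero))

theorem star_cosVec (hx : x ∈ Icc 0 Real.pi) (n : ℕ) :
    star (cosVec x ((n : ℂ) ^ 2)) = cosVec x ((n : ℂ) ^ 2) := by
  refine Lp.ext ?_
  filter_upwards [Lp.coeFn_star (cosVec x ((n : ℂ) ^ 2)), ae_restrict_of_ae (cosVec_ae hx n),
    ae_restrict_mem measurableSet_Ioc] with t h1 h2 ht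
  rw [h1, Pi.star_apply, h2 ht]
  change conj (Complex.cos _) = _
  rw [← Complex.cos_conj, map_mul, Complex.conj_ofReal, Complex.conj_natCast]

/-- Polarising `hasSum_cosine_sq` gives a sesquilinear identity. The cosines at `n ^ 2` are real, so
inserting `star F` makes it bilinear. -/
theorem hasSum_cosine (hx : x ∈ Icc 0 Real.pi) (F G : IntervalL2 x) :
    HasSum (fun n : ℕ => 2 / Real.pi * (pair x F (cosVec x ((n : ℂ) ^ 2)) *
      pair x G (cosVec x ((n : ℂ) ^ 2))))
      (pair x F G + 1 / Real.pi * (pair x F (cosVec x 0) * pair x G (cosVec x 0))) := by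
  have hcos : ∀ (F : IntervalL2 x) (n : ℕ), conj (pair x (star F) (cosVec x ((n : ℂ) ^ 2))) =
      pair x F (cosVec x ((n : ℂ) ^ 2)) := by
    intro F n
    rw [pair_star_left, inner_conj_symm, ← pair_star_left, star_cosVec hx, pair_comm]
  have key : ∀ F G : IntervalL2 x, HasSum (fun n : ℕ => 2 / Real.pi *
      inner ℂ (pair x F (cosVec x ((n : ℂ) ^ 2))) (pair x G (cosVec x ((n : ℂ) ^ 2))))
      (inner ℂ F G + 1 / Real.pi *
        inner ℂ (pair x F (cosVec x 0)) (pair x G (cosVec x 0))) := by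
    intro F G
    have hc : ∀ F, HasSum (fun n : ℕ => 2 / (Real.pi : ℂ) *
        ((‖pair x F (cosVec x ((n : ℂ) ^ 2))‖ : ℝ) : ℂ) ^ 2)
        (((‖F‖ : ℝ) : ℂ) ^ 2 + 1 / Real.pi * ((‖pair x F (cosVec x 0)‖ : ℝ) : ℂ) ^ 2) := by
      intro F
      have := Complex.hasSum_ofReal.2 (hasSum_cosine_sq hx F)
      push_cast at this
      exact this
    have h1 := ((((hc (F + G)).sub (hc (F - G))).add (((hc (F - Complex.I • G)).sub
      (hc (F + Complex.I • G))).mul_right Complex.I)).div_const 4)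
    simp only [map_add, map_sub, map_smul, add_apply, sub_apply, smul_apply] at h1
    have h3 := fun {E : Type} [NormedAddCommGroup E] [InnerProductSpace ℂ E] (u v : E) =>
      inner_eq_sum_norm_sq_div_four (𝕜 := ℂ) u v
    simp only [RCLike.I_to_complex, Complex.coe_algebraMap] at h3
    rw [h3 F G, h3 (pair x F (cosVec x 0)) (pair x G (cosVec x 0))]
    refine Eq.mp (congrArg (HasSum _) ?_) (h1.congr_fun fun n => ?_)
    · ring
    · rw [h3]
      ring
  have h2 := key (star F) G
  have h0 := hcos F 0
  simp only [Nat.cast_zero, ne_eq, OfNat.ofNat_ne_zero, not_false_eq_true, zero_pow] at h0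
  rw [← pair_star_left, star_star] at h2
  simp only [RCLike.inner_apply, hcos, h0] at h2
  simpa only [mul_comm (pair x F _)] using h2

theorem dense_span_cosVec (hx : x ∈ Icc 0 Real.pi) :
    Dense (Submodule.span ℂ (range (cosVec x)) : Set (IntervalL2 x)) := by
  rw [Submodule.dense_iff_topologicalClosure_eq_top, Submodule.topologicalClosure_eq_top_iff,
    Submodule.eq_bot_iff]
  intro F hF
  refine eq_zero_of_pair_cosVec hx fun n => ?_
  have h1 := (Submodule.mem_orthogonal _ _).1 hF _ (Submodule.subset_span ⟨(n : ℂ) ^ 2, rfl⟩)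
  rwa [← pair_star_left, star_cosVec hx, pair_comm] at h1

/-- The Bessel terms of `F`. -/
def cosMass (F : IntervalL2 x) (n : ℤ) : ℝ :=
  localMass (fun ρ => fourierInt ρ (symmetrize (zeroExt x F))) n

theorem cosMass_nonneg (F : IntervalL2 x) (n : ℤ) : 0 ≤ cosMass F n := localMass_nonneg _ _

theorem exists_sum_cosMass_le (hx : x ∈ Icc 0 Real.pi) : ∃ C : ℝ, 0 ≤ C ∧ ∀ (F : IntervalL2 x)
    (s : Finset ℤ), ∑ n ∈ s, cosMass F n ≤ C * ‖F‖ ^ 2 := by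
  refine ⟨6 * Real.pi * Real.exp (6 * Real.pi) * 2, by positivity, fun F s => ?_⟩
  refine (sum_localMass_fourierInt_le (symmetrize_zeroExt_mem hx F) s).trans (le_of_eq ?_)
  rw [norm_symmetrize_zeroExt_sq]
  ring

theorem norm_sub_le_localMass {F : ℂ → ℂ} (hF : Differentiable ℂ F) {c w w' : ℂ}
    (hw : ‖w - c‖ ≤ 1) (hw' : ‖w' - c‖ ≤ 1) :
    ‖F w - F w'‖ ≤ √(localMass F c) * ‖w - w'‖ :=
  (convex_closedBall c 1).norm_image_sub_le_of_norm_deriv_le (𝕜 := ℂ) (fun _ _ => hF _)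
    (fun _ hz => Real.le_sqrt_of_sq_le (norm_deriv_sq_le_localMass hF
      (mem_closedBall_iff_norm.1 hz)))
    (mem_closedBall_iff_norm.2 hw') (mem_closedBall_iff_norm.2 hw)

theorem pair_cosVec_sq (hx : x ∈ Icc 0 Real.pi) (F : IntervalL2 x) (w : ℂ) :
    pair x F (cosVec x (w ^ 2)) = fourierInt w (symmetrize (zeroExt x F)) / 2 := by
  rw [fourierInt_symmetrize_zeroExt hx]
  ring

theorem norm_pair_cosVec_le (hx : x ∈ Icc 0 Real.pi) (F : IntervalL2 x) {n : ℤ} {w : ℂ}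
    (hw : ‖w - n‖ ≤ 1) : ‖pair x F (cosVec x (w ^ 2))‖ ≤ √(cosMass F n) := by
  rw [pair_cosVec_sq hx, norm_div, RCLike.norm_ofNat]
  have h1 : ‖fourierInt w (symmetrize (zeroExt x F))‖ ≤ √(cosMass F n) :=
    Real.le_sqrt_of_sq_le (norm_sq_le_localMass (differentiable_fourierInt _) (by linarith))
  linarith [norm_nonneg (fourierInt w (symmetrize (zeroExt x F)))]

theorem norm_pair_cosVec_sub_le (hx : x ∈ Icc 0 Real.pi) (F : IntervalL2 x) {n : ℤ} {w w' : ℂ}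
    (hw : ‖w - n‖ ≤ 1) (hw' : ‖w' - n‖ ≤ 1) :
    ‖pair x F (cosVec x (w ^ 2) - cosVec x (w' ^ 2))‖ ≤ √(cosMass F n) * ‖w - w'‖ := by
  rw [map_sub, pair_cosVec_sq hx, pair_cosVec_sq hx, ← sub_div, norm_div, RCLike.norm_ofNat]
  have h1 : ‖fourierInt w (symmetrize (zeroExt x F)) - fourierInt w' (symmetrize (zeroExt x F))‖ ≤
      √(cosMass F n) * ‖w - w'‖ :=
    norm_sub_le_localMass (differentiable_fourierInt (symmetrize (zeroExt x F))) hw hw'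
  linarith [norm_nonneg (fourierInt w (symmetrize (zeroExt x F)) -
    fourierInt w' (symmetrize (zeroExt x F)))]

end CosineSeries


/-! ### The vectors behind the main equation -/

theorem iteratedDeriv_clm_comp {E F : Type*} [NormedAddCommGroup E] [NormedSpace ℂ E]
    [NormedAddCommGroup F] [NormedSpace ℂ F] [CompleteSpace E] (L : E →L[ℂ] F) {f : ℂ → E}
    (hf : Differentiable ℂ f) (n : ℕ) (w : ℂ) :
    iteratedDeriv n (fun z => L (f z)) w = L (iteratedDeriv n f w) := by
  induction n generalizing w with
  | zero => simp
  | succ n ih =>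
    have h : iteratedDeriv n (fun z => L (f z)) = fun z => L (iteratedDeriv n f z) := funext ih
    rw [iteratedDeriv_succ, h, iteratedDeriv_succ]
    have hd : DifferentiableAt ℂ (iteratedDeriv n f) w :=
      (hf.contDiff (n := n + 1)).differentiable_iteratedDeriv n (by exact_mod_cast n.lt_succ_self) w
    exact (L.hasFDerivAt.comp_hasDerivAt w hd.hasDerivAt).deriv

section MainVectors

variable {x : ℝ}

/-- The Taylor coefficient of `cos(√lam ·)` that belongs to the index `n`. -/
def taylorVec (lam : ℕ → ℂ) (x : ℝ) (n : ℕ) : IntervalL2 x :=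
  (1 / ((pos lam n).factorial : ℂ)) • iteratedDeriv (pos lam n) (cosVec x) (lam n)

/-- The vector with `Ã_{k}(x, z) = pair x (cosVec x z) (coefVec lam α x k)`. -/
def coefVec (lam α : ℕ → ℂ) (x : ℝ) (k : ℕ) : IntervalL2 x :=
  ∑ p ∈ Finset.Ico k (blockStart lam k + mult lam k),
    α p • ((1 / ((p - k).factorial : ℂ)) • iteratedDeriv (p - k) (cosVec x) (lam k))

theorem DT_eq_pair (hx : x ∈ Icc 0 Real.pi) (z μ : ℂ) :
    DT x z μ = pair x (cosVec x z) (cosVec x μ) := by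
  rw [pair_apply, DT, intervalIntegral.integral_of_le hx.1]
  refine setIntegral_congr_ae measurableSet_Ioc ?_
  filter_upwards [cosVec_ae hx (rho z), cosVec_ae hx (rho μ)] with t h1 h2 ht
  rw [rho_sq] at h1 h2
  rw [h1 ht, h2 ht, phiT, phiT]

theorem AT_eq_pair (hx : x ∈ Icc 0 Real.pi) (lam α : ℕ → ℂ) (k : ℕ) (z : ℂ) :
    AT lam α x k z = pair x (cosVec x z) (coefVec lam α x k) := by
  simp only [AT, DT_eq_pair hx, coefVec, map_sum, map_smul, smul_eq_mul]
  refine Finset.sum_congr rfl fun p _ => ?_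
  rw [iteratedDeriv_clm_comp _ (differentiable_cosVec x)]

theorem iteratedDeriv_pair_cosVec (F : IntervalL2 x) (n : ℕ) (w : ℂ) :
    iteratedDeriv n (fun z => pair x (cosVec x z) F) w =
      pair x (iteratedDeriv n (cosVec x) w) F := by
  simp only [pair_comm _ F]
  exact iteratedDeriv_clm_comp _ (differentiable_cosVec x) n w

theorem QT_eq_pair (hx : x ∈ Icc 0 Real.pi) (lam α : Fin 2 → ℕ → ℂ) (n : ℕ) (i : Fin 2) (k : ℕ)
    (j : Fin 2) :
    QT lam α x n i k j = pair x (taylorVec (lam i) x n) (coefVec (lam j) (α j) x k) := by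
  simp only [QT, taylorVec, map_smul, smul_apply, smul_eq_mul]
  rw [← iteratedDeriv_pair_cosVec]
  congr 2
  exact funext fun z => AT_eq_pair hx _ _ _ _

/-- The vectors of the rows of `H̃(x)`. -/
def rowVec (lam α : Fin 2 → ℕ → ℂ) (x : ℝ) (u : ℕ × Fin 2) : IntervalL2 x :=
  ![(chi lam α u.1 : ℂ) • (taylorVec (lam 0) x u.1 - taylorVec (lam 1) x u.1),
    taylorVec (lam 1) x u.1] u.2

/-- The vectors of the columns of `H̃(x)`. -/
def colVec (lam α : Fin 2 → ℕ → ℂ) (x : ℝ) (v : ℕ × Fin 2) : IntervalL2 x :=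
  ![(xi lam α v.1 : ℂ) • coefVec (lam 0) (α 0) x v.1,
    coefVec (lam 0) (α 0) x v.1 - coefVec (lam 1) (α 1) x v.1] v.2

/-- `D̃` is a pairing of cosines, Taylor coefficients pass through the pairing, and the left and
right `2 × 2` matrices act on its two arguments separately. The infinite matrix therefore factors
through `L²(0, x)`. -/
theorem HT_eq_pair (hx : x ∈ Icc 0 Real.pi) (lam α : Fin 2 → ℕ → ℂ) (u v : ℕ × Fin 2) :
    HT lam α x u v = pair x (rowVec lam α x u) (colVec lam α x v) := by
  obtain ⟨n, i⟩ := u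
  obtain ⟨k, j⟩ := v
  simp only [HT, QT_eq_pair hx, transMatrix, rowVec, colVec]
  fin_cases i <;> fin_cases j <;>
    simp [Matrix.mul_apply, Fin.sum_univ_two] <;> ring

/-! ### Bounds for the rows and columns -/

/-- Two sequences of spectral data with the same asymptotics, whose difference is square
summable. -/
structure IsComparable (M : ℕ) (lam α : Fin 2 → ℕ → ℂ) : Prop where
  simple : ∀ᶠ n in atTop, ∀ i, ∀ k, lam i k = lam i n → k = n
  rho_le : ∀ᶠ n : ℕ in atTop, ∀ i, ‖rho (lam i n) - (((n : ℤ) - M : ℤ) : ℂ)‖ ≤ 1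
  alpha_le : ∃ A : ℝ, 0 ≤ A ∧ ∀ᶠ n in atTop, ∀ i, ‖α i n‖ ≤ A
  summable : Summable fun n => xi lam α n ^ 2

theorem xi_nonneg (lam α : Fin 2 → ℕ → ℂ) (n : ℕ) : 0 ≤ xi lam α n := by
  unfold xi
  positivity

theorem chi_nonneg (lam α : Fin 2 → ℕ → ℂ) (n : ℕ) : 0 ≤ chi lam α n := by
  unfold chi
  split_ifs
  exacts [le_rfl, inv_nonneg.2 (xi_nonneg _ _ _)]

theorem chi_mul_le (lam α : Fin 2 → ℕ → ℂ) (n : ℕ) :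
    chi lam α n * ‖rho (lam 0 n) - rho (lam 1 n)‖ ≤ 1 := by
  have h1 : chi lam α n * xi lam α n ≤ 1 := by
    unfold chi
    split_ifs with h
    · simp
    · exact (inv_mul_cancel₀ h).le
  refine (mul_le_mul_of_nonneg_left ?_ (chi_nonneg _ _ _)).trans h1
  unfold xi
  linarith [norm_nonneg (α 0 n - α 1 n)]

theorem exists_le_of_eventually_le {f : ℕ → ℝ} {C : ℝ} (h : ∀ᶠ n in atTop, f n ≤ C) :
    ∃ C', ∀ n, f n ≤ C' := by
  obtain ⟨C', hC'⟩ := (isBoundedUnder_of_eventually_le h).bddAbove_range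
  exact ⟨C', fun n => hC' ⟨n, rfl⟩⟩

theorem taylorVec_of_simple {lam : ℕ → ℂ} {n : ℕ} (h : ∀ k, lam k = lam n → k = n) :
    taylorVec lam x n = cosVec x (lam n) := by
  rw [taylorVec, (block_of_simple h).2.1]
  simp

theorem coefVec_of_simple {lam α : ℕ → ℂ} {n : ℕ} (h : ∀ k, lam k = lam n → k = n) :
    coefVec lam α x n = α n • cosVec x (lam n) := by
  rw [coefVec, (block_of_simple h).1, (block_of_simple h).2.2]
  simp

/-- Test with `F = star G`, for which the pairing is `‖G‖ ^ 2`. -/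
theorem norm_le_of_pair_le {G : IntervalL2 x} {K : ℝ} (hK : 0 ≤ K)
    (h : ∀ F, ‖pair x F G‖ ≤ K * ‖F‖) : ‖G‖ ≤ K := by
  rcases eq_or_ne G 0 with rfl | hG
  · rwa [norm_zero]
  have hs : ‖star G‖ = ‖G‖ := by
    rw [Lp.norm_def, Lp.norm_def]
    congr 1
    refine eLpNorm_congr_norm_ae ?_
    filter_upwards [Lp.coeFn_star G] with t ht
    rw [ht, Pi.star_apply, norm_star]
  have h1 := h (star G)
  rw [pair_star_left, inner_self_eq_norm_sq_to_K, hs] at h1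
  rw [norm_pow, RCLike.norm_ofReal, abs_norm, sq] at h1
  exact le_of_mul_le_mul_right h1 (norm_pos_iff.2 hG)

/-- By duality from a single term of the Bessel sum, which bounds the pairing with any `F` and its
Lipschitz constant in `w`, uniformly in `n`. -/
theorem exists_norm_cosVec_le (hx : x ∈ Icc 0 Real.pi) : ∃ K : ℝ, 0 ≤ K ∧ ∀ (n : ℤ) (w w' : ℂ),
    ‖w - n‖ ≤ 1 → ‖w' - n‖ ≤ 1 → ‖cosVec x (w ^ 2)‖ ≤ K ∧
      ‖cosVec x (w ^ 2) - cosVec x (w' ^ 2)‖ ≤ K * ‖w - w'‖ := by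
  obtain ⟨C, hC0, hC⟩ := exists_sum_cosMass_le hx
  have h1 : ∀ (F : IntervalL2 x) (n : ℤ), √(cosMass F n) ≤ √C * ‖F‖ := by
    intro F n
    have h2 := hC F {n}
    rw [Finset.sum_singleton] at h2
    rw [← Real.sqrt_sq (norm_nonneg F), ← Real.sqrt_mul hC0]
    exact Real.sqrt_le_sqrt h2
  refine ⟨√C, Real.sqrt_nonneg _, fun n w w' hw hw' => ⟨?_, ?_⟩⟩
  · exact norm_le_of_pair_le (Real.sqrt_nonneg _) fun F =>
      (norm_pair_cosVec_le hx F hw).trans (h1 F n)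
  · refine norm_le_of_pair_le (by positivity) fun F =>
      (norm_pair_cosVec_sub_le hx F hw hw').trans ?_
    rw [mul_right_comm]
    gcongr
    exact h1 F n

/-- For late indices the row with `χ_n` is essentially a difference quotient in `ρ`, so the
Lipschitz bound for the cosine compensates `χ_n`. The finitely many remaining indices, where
multiplicities may occur, only enlarge the constant. -/
theorem exists_norm_rowVec_le (hx : x ∈ Icc 0 Real.pi) {M : ℕ} {lam α : Fin 2 → ℕ → ℂ}
    (h : IsComparable M lam α) : ∃ C : ℝ, ∀ u, ‖rowVec lam α x u‖ ≤ C := by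
  obtain ⟨K, hK0, hK⟩ := exists_norm_cosVec_le hx
  have h0 : ∀ᶠ n in atTop, ‖rowVec lam α x (n, 0)‖ + ‖rowVec lam α x (n, 1)‖ ≤ K + K := by
    filter_upwards [h.simple, h.rho_le] with n hs hr
    have e := hK _ _ _ (hr 0) (hr 1)
    have e' := hK _ _ _ (hr 1) (hr 0)
    simp only [rho_sq] at e e'
    simp only [rowVec, Matrix.cons_val_zero, Matrix.cons_val_one, taylorVec_of_simple (hs 0),
      taylorVec_of_simple (hs 1), norm_smul, Complex.norm_real,
      Real.norm_of_nonneg (chi_nonneg lam α n)]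
    refine add_le_add ?_ e'.1
    calc _ ≤ chi lam α n * (K * ‖rho (lam 0 n) - rho (lam 1 n)‖) :=
          mul_le_mul_of_nonneg_left e.2 (chi_nonneg _ _ _)
      _ = K * (chi lam α n * ‖rho (lam 0 n) - rho (lam 1 n)‖) := by ring
      _ ≤ K * 1 := mul_le_mul_of_nonneg_left (chi_mul_le _ _ _) hK0
      _ = K := mul_one K
  obtain ⟨C, hC⟩ := exists_le_of_eventually_le h0
  refine ⟨C, fun ⟨n, i⟩ => ?_⟩
  have h1 := hC n
  have h2 := norm_nonneg (rowVec lam α x (n, 0))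
  have h3 := norm_nonneg (rowVec lam α x (n, 1))
  fin_cases i
  · exact le_trans (by simp) h1
  · exact le_trans (by simp) h1

theorem IsComparable.eventually_norm_pair_colVec_le (hx : x ∈ Icc 0 Real.pi) {M : ℕ}
    {lam α : Fin 2 → ℕ → ℂ} (h : IsComparable M lam α) : ∃ K : ℝ, 0 ≤ K ∧ ∀ᶠ n : ℕ in atTop,
      ∀ F i, ‖pair x F (colVec lam α x (n, i))‖ ≤ K * (xi lam α n * √(cosMass F (n - M))) := by
  obtain ⟨A, hA0, hA⟩ := h.alpha_le
  refine ⟨A + 1, by positivity, ?_⟩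
  filter_upwards [h.simple, h.rho_le, hA] with n hs hr hα F i
  have e : ∀ i, ‖pair x F (cosVec x (lam i n))‖ ≤ √(cosMass F (n - M)) := fun i => by
    have := norm_pair_cosVec_le hx F (hr i)
    rwa [rho_sq] at this
  have e' := norm_pair_cosVec_sub_le hx F (hr 0) (hr 1)
  rw [rho_sq, rho_sq] at e'
  have hx0 := xi_nonneg lam α n
  have hm := Real.sqrt_nonneg (cosMass F (n - M))
  fin_cases i
  · simp only [colVec, Fin.zero_eta, Matrix.cons_val_zero, coefVec_of_simple (hs 0), map_smul,
      smul_eq_mul, norm_mul, Complex.norm_real, Real.norm_of_nonneg hx0]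
    calc _ ≤ xi lam α n * (A * √(cosMass F (n - M))) := by
          gcongr
          exacts [hα 0, e 0]
      _ = A * (xi lam α n * √(cosMass F (n - M))) := by ring
      _ ≤ _ := by
          gcongr
          linarith
  · change ‖pair x F (coefVec (lam 0) (α 0) x n - coefVec (lam 1) (α 1) x n)‖ ≤ _
    rw [coefVec_of_simple (hs 0), coefVec_of_simple (hs 1)]
    -- The difference is split so that each summand carries a factor bounded by `ξ_n`.
    have e1 : α 0 n • cosVec x (lam 0 n) - α 1 n • cosVec x (lam 1 n) =
        α 0 n • (cosVec x (lam 0 n) - cosVec x (lam 1 n)) +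
          (α 0 n - α 1 n) • cosVec x (lam 1 n) := by
      rw [smul_sub, sub_smul]
      abel
    rw [e1, map_add, map_smul, map_smul]
    refine (norm_add_le _ _).trans ?_
    rw [norm_smul, norm_smul]
    have e2 : ‖rho (lam 0 n) - rho (lam 1 n)‖ ≤ xi lam α n := by
      unfold xi
      linarith [norm_nonneg (α 0 n - α 1 n)]
    have e3 : ‖α 0 n - α 1 n‖ ≤ xi lam α n := by
      unfold xi
      linarith [norm_nonneg (rho (lam 0 n) - rho (lam 1 n))]
    calc _ ≤ A * (√(cosMass F (n - M)) * xi lam α n) + xi lam α n * √(cosMass F (n - M)) := by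
          gcongr
          · exact hα 0
          · exact e'.trans (by gcongr)
          · exact e 1
      _ = _ := by ring

theorem sum_le_sum_range_prod {f : ℕ × Fin 2 → ℝ} (hf : ∀ v, 0 ≤ f v) (s : Finset (ℕ × Fin 2)) :
    ∃ L, ∑ v ∈ s, f v ≤ ∑ n ∈ Finset.range L, (f (n, 0) + f (n, 1)) := by
  obtain ⟨L, hL⟩ := (s.image Prod.fst).exists_nat_subset_range
  refine ⟨L, ?_⟩
  have h1 : s ⊆ Finset.range L ×ˢ Finset.univ := fun v hv =>
    Finset.mem_product.2 ⟨hL (Finset.mem_image_of_mem _ hv), Finset.mem_univ _⟩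
  refine (Finset.sum_le_sum_of_subset_of_nonneg h1 fun v _ _ => hf v).trans (le_of_eq ?_)
  rw [Finset.sum_product]
  simp only [Fin.sum_univ_two]

/-- Late terms are bounded by `ξ_n` times the root of a Bessel term, and both sequences are square
summable, so Cauchy–Schwarz gives absolute convergence with a bound linear in `‖F‖`. For the first
`N` indices the operator norms of the column functionals suffice. -/
theorem exists_sum_norm_pair_colVec_le (hx : x ∈ Icc 0 Real.pi) {M : ℕ} {lam α : Fin 2 → ℕ → ℂ}
    (h : IsComparable M lam α) : ∃ C : ℝ, 0 ≤ C ∧ ∀ (F : IntervalL2 x) (s : Finset (ℕ × Fin 2)),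
      ∑ v ∈ s, ‖pair x F (colVec lam α x v)‖ ≤ C * ‖F‖ := by
  obtain ⟨K, hK0, hK⟩ := h.eventually_norm_pair_colVec_le hx
  obtain ⟨N, hN⟩ := eventually_atTop.1 hK
  obtain ⟨C, hC0, hC⟩ := exists_sum_cosMass_le hx
  set b : ℕ × Fin 2 → ℝ := fun v => ‖(pair x).flip (colVec lam α x v)‖ with hb
  set D : ℝ := ∑ n ∈ Finset.range N, (b (n, 0) + b (n, 1)) with hD
  have hD0 : 0 ≤ D := Finset.sum_nonneg fun n _ => add_nonneg (norm_nonneg _) (norm_nonneg _)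
  set X : ℝ := ∑' n, xi lam α n ^ 2
  refine ⟨D + 2 * K * (√X * √C), by positivity, fun F s => ?_⟩
  obtain ⟨L, hL⟩ := sum_le_sum_range_prod
    (f := fun v => ‖pair x F (colVec lam α x v)‖) (fun _ => norm_nonneg _) s
  refine hL.trans ?_
  have hle : ∀ n, ‖pair x F (colVec lam α x (n, 0))‖ + ‖pair x F (colVec lam α x (n, 1))‖ ≤
      (if n < N then b (n, 0) + b (n, 1) else 0) * ‖F‖ +
        2 * K * (xi lam α n * √(cosMass F (n - M))) := by
    intro n
    have hx0 := xi_nonneg lam α n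
    split_ifs with hn
    · have e : ∀ v, ‖pair x F (colVec lam α x v)‖ ≤ b v * ‖F‖ := fun v =>
        ((pair x).flip (colVec lam α x v)).le_opNorm F
      have e0 := e (n, 0)
      have e1 := e (n, 1)
      have : 0 ≤ 2 * K * (xi lam α n * √(cosMass F (n - M))) := by positivity
      linarith
    · have e0 := hN n (not_lt.1 hn) F 0
      have e1 := hN n (not_lt.1 hn) F 1
      linarith
  refine (Finset.sum_le_sum fun n _ => hle n).trans ?_
  rw [Finset.sum_add_distrib, ← Finset.sum_mul, ← Finset.mul_sum, add_mul]
  refine add_le_add ?_ ?_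
  · refine mul_le_mul_of_nonneg_right ?_ (norm_nonneg F)
    rw [← Finset.sum_filter, hD]
    refine Finset.sum_le_sum_of_subset_of_nonneg (fun n hn => ?_) fun n _ _ =>
      add_nonneg (norm_nonneg _) (norm_nonneg _)
    exact Finset.mem_range.2 (Finset.mem_filter.1 hn).2
  · have h1 : ∑ n ∈ Finset.range L, xi lam α n ^ 2 ≤ X :=
      h.summable.sum_le_tsum _ fun n _ => sq_nonneg _
    have h2 : ∑ n ∈ Finset.range L, √(cosMass F (n - M)) ^ 2 ≤ C * ‖F‖ ^ 2 := by
      have e : Function.Injective fun n : ℕ => (n : ℤ) - M := fun a b hab => by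
        simpa using hab
      have := hC F ((Finset.range L).map ⟨_, e⟩)
      rw [Finset.sum_map] at this
      refine (le_of_eq (Finset.sum_congr rfl fun n _ => ?_)).trans this
      exact Real.sq_sqrt (cosMass_nonneg _ _)
    have h3 := Real.sum_mul_le_sqrt_mul_sqrt (Finset.range L) (xi lam α)
      fun n : ℕ => √(cosMass F (n - M))
    have h4 : √(C * ‖F‖ ^ 2) = √C * ‖F‖ := by
      rw [Real.sqrt_mul hC0, Real.sqrt_sq (norm_nonneg F)]
    calc _ ≤ 2 * K * (√X * √(C * ‖F‖ ^ 2)) := by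
          gcongr
          exact h3.trans (by gcongr)
      _ = _ := by
          rw [h4]
          ring

/-- Pointwise counterpart of `exists_norm_cosVec_le`, used for `ψ̃`: `|Im w| ≤ 1` and `0 ≤ x < 4`
keep sine and cosine below `exp 4`. -/
theorem exists_norm_cos_le (hx : x ∈ Icc 0 Real.pi) : ∃ K : ℝ, 0 ≤ K ∧ ∀ (n : ℤ) (w w' : ℂ),
    ‖w - n‖ ≤ 1 → ‖w' - n‖ ≤ 1 → ‖Complex.cos (w * x)‖ ≤ K ∧
      ‖Complex.cos (w * x) - Complex.cos (w' * x)‖ ≤ K * ‖w - w'‖ := by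
  have hexp : ∀ (n : ℤ) (w : ℂ), ‖w - n‖ ≤ 1 → |(w * x).im| ≤ 4 := by
    intro n w hw
    have h1 : |(w - n).im| ≤ 1 := (Complex.abs_im_le_norm _).trans hw
    rw [Complex.sub_im, Complex.intCast_im, sub_zero] at h1
    rw [Complex.im_mul_ofReal, abs_mul, abs_of_nonneg hx.1]
    nlinarith [Real.pi_lt_four, hx.1, hx.2, abs_nonneg w.im]
  have hE : ∀ z : ℂ, |z.im| ≤ 4 → ‖Complex.cos z‖ ≤ Real.exp 4 ∧ ‖Complex.sin z‖ ≤ Real.exp 4 := by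
    intro z hz
    have h1 : ‖Complex.exp (z * Complex.I)‖ ≤ Real.exp 4 := by
      rw [Complex.norm_exp]
      exact Real.exp_le_exp.2 (by simpa using (neg_le_abs _).trans hz)
    have h2 : ‖Complex.exp (-z * Complex.I)‖ ≤ Real.exp 4 := by
      rw [Complex.norm_exp]
      exact Real.exp_le_exp.2 (by simpa using (le_abs_self _).trans hz)
    constructor
    · rw [Complex.cos, norm_div, RCLike.norm_ofNat]
      linarith [norm_add_le (Complex.exp (z * Complex.I)) (Complex.exp (-z * Complex.I))]
    · rw [Complex.sin, norm_div, norm_mul, Complex.norm_I, mul_one, RCLike.norm_ofNat]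
      linarith [norm_sub_le (Complex.exp (-z * Complex.I)) (Complex.exp (z * Complex.I))]
  refine ⟨4 * Real.exp 4, by positivity, fun n w w' hw hw' => ⟨?_, ?_⟩⟩
  · linarith [(hE _ (hexp n w hw)).1, Real.exp_pos 4]
  · have hd : ∀ z : ℂ, HasDerivAt (fun z : ℂ => Complex.cos (z * x))
        (-Complex.sin (z * x) * x) z := fun z =>
      (((hasDerivAt_id z).mul_const (x : ℂ)).ccos).congr_deriv (by simp)
    refine (convex_closedBall (n : ℂ) 1).norm_image_sub_le_of_norm_hasDerivWithin_le (𝕜 := ℂ)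
      (fun z _ => (hd z).hasDerivWithinAt) (fun z hz => ?_)
      (mem_closedBall_iff_norm.2 hw') (mem_closedBall_iff_norm.2 hw)
    rw [norm_mul, norm_neg, Complex.norm_real, Real.norm_of_nonneg hx.1, mul_comm]
    gcongr
    · exact (hx.2.trans Real.pi_lt_four.le)
    · exact (hE _ (hexp n z (mem_closedBall_iff_norm.1 hz))).2

theorem exists_norm_psiT_le (hx : x ∈ Icc 0 Real.pi) {M : ℕ} {lam α : Fin 2 → ℕ → ℂ}
    (h : IsComparable M lam α) : ∃ C : ℝ, ∀ u, ‖psiT lam α x u‖ ≤ C := by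
  obtain ⟨K, hK0, hK⟩ := exists_norm_cos_le hx
  have hT : ∀ n, psiT lam α x (n, 0) =
      chi lam α n * (phiTSeq lam x n 0 - phiTSeq lam x n 1) ∧
      psiT lam α x (n, 1) = phiTSeq lam x n 1 := fun n => by
    constructor <;> simp [psiT, transMatrix, Matrix.mulVec, dotProduct, Fin.sum_univ_two]
    ring
  have h0 : ∀ᶠ n in atTop, ‖psiT lam α x (n, 0)‖ + ‖psiT lam α x (n, 1)‖ ≤ K + K := by
    filter_upwards [h.simple, h.rho_le] with n hs hr
    have e := hK _ _ _ (hr 0) (hr 1)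
    have e' := hK _ _ _ (hr 1) (hr 0)
    have hφ : ∀ i, phiTSeq lam x n i = Complex.cos (rho (lam i n) * x) := fun i => by
      rw [phiTSeq, (block_of_simple (hs i)).2.1]
      simp [phiT]
    rw [(hT n).1, (hT n).2, hφ, hφ, norm_mul, Complex.norm_real,
      Real.norm_of_nonneg (chi_nonneg lam α n)]
    refine add_le_add ?_ e'.1
    calc _ ≤ chi lam α n * (K * ‖rho (lam 0 n) - rho (lam 1 n)‖) :=
          mul_le_mul_of_nonneg_left e.2 (chi_nonneg _ _ _)
      _ = K * (chi lam α n * ‖rho (lam 0 n) - rho (lam 1 n)‖) := by ring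
      _ ≤ K * 1 := mul_le_mul_of_nonneg_left (chi_mul_le _ _ _) hK0
      _ = K := mul_one K
  obtain ⟨C, hC⟩ := exists_le_of_eventually_le h0
  refine ⟨C, fun ⟨n, i⟩ => ?_⟩
  have h1 := hC n
  have h2 := norm_nonneg (psiT lam α x (n, 0))
  have h3 := norm_nonneg (psiT lam α x (n, 1))
  fin_cases i
  · exact le_trans (by simp) h1
  · exact le_trans (by simp) h1

end MainVectors


/-! ### Operators on bounded sequences that factor through a Banach space -/

section Factor

variable {V X : Type*} [NormedAddCommGroup X] [NormedSpace ℂ X]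

theorem memℓp_dual_apply {A : V → X} {C : ℝ} (hA : ∀ u, ‖A u‖ ≤ C) (η : X →L[ℂ] ℂ) :
    Memℓp (fun u => η (A u)) ∞ := by
  refine memℓp_infty ⟨‖η‖ * C, ?_⟩
  rintro _ ⟨u, rfl⟩
  exact η.le_opNorm_of_le (hA u)

/-- The operator that evaluates a functional along a bounded family of vectors. -/
def dualEval (A : V → X) {C : ℝ} (hA : ∀ u, ‖A u‖ ≤ C) :
    (X →L[ℂ] ℂ) →L[ℂ] lp (fun _ : V => ℂ) ∞ :=
  LinearMap.mkContinuous
    { toFun := fun η => ⟨fun u => η (A u), memℓp_dual_apply hA η⟩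
      map_add' := fun _ _ => rfl
      map_smul' := fun _ _ => rfl } |C| fun η => by
    refine lp.norm_le_of_forall_le (by positivity) fun u => ?_
    rw [mul_comm]
    exact η.le_opNorm_of_le ((hA u).trans (le_abs_self C))

theorem dualEval_apply {A : V → X} {C : ℝ} (hA : ∀ u, ‖A u‖ ≤ C) (η : X →L[ℂ] ℂ) (u : V) :
    dualEval A hA η u = η (A u) := rfl

theorem summable_norm_mul_dual {b : V → X →L[ℂ] ℂ} {C : ℝ}
    (hb : ∀ F (s : Finset V), ∑ v ∈ s, ‖b v F‖ ≤ C * ‖F‖) (f : lp (fun _ : V => ℂ) ∞) (F : X) :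
    Summable fun v => ‖f v * b v F‖ := by
  refine Summable.of_nonneg_of_le (fun _ => norm_nonneg _) (fun v => ?_)
    ((summable_of_sum_le (fun _ => norm_nonneg _) (hb F)).mul_left ‖f‖)
  rw [norm_mul]
  gcongr
  exact lp.norm_apply_le_norm (by simp) f v

/-- The operator that combines functionals with bounded coefficients. -/
def dualSum (b : V → X →L[ℂ] ℂ) {C : ℝ}
    (hb : ∀ F (s : Finset V), ∑ v ∈ s, ‖b v F‖ ≤ C * ‖F‖) :
    lp (fun _ : V => ℂ) ∞ →L[ℂ] (X →L[ℂ] ℂ) :=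
  LinearMap.mkContinuous₂
    (LinearMap.mk₂ ℂ (fun f F => ∑' v, f v * b v F)
      (fun f g F => by
        rw [← (summable_norm_mul_dual hb f F).of_norm.tsum_add
          (summable_norm_mul_dual hb g F).of_norm]
        exact tsum_congr fun v => add_mul _ _ _)
      (fun a f F => by
        rw [smul_eq_mul, ← tsum_mul_left]
        exact tsum_congr fun v => mul_assoc _ _ _)
      (fun f F G => by
        rw [← (summable_norm_mul_dual hb f F).of_norm.tsum_add
          (summable_norm_mul_dual hb f G).of_norm]
        exact tsum_congr fun v => by rw [map_add, mul_add])
      (fun a f F => by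
        rw [smul_eq_mul, ← tsum_mul_left]
        exact tsum_congr fun v => by rw [map_smul, smul_eq_mul, mul_left_comm])) C
    fun f F => by
      change ‖∑' v, f v * b v F‖ ≤ _
      refine (norm_tsum_le_tsum_norm (summable_norm_mul_dual hb f F)).trans ?_
      refine Real.tsum_le_of_sum_le (fun _ => norm_nonneg _) fun s => ?_
      calc ∑ v ∈ s, ‖f v * b v F‖ ≤ ∑ v ∈ s, ‖f‖ * ‖b v F‖ := by
            refine Finset.sum_le_sum fun v _ => ?_
            rw [norm_mul]
            gcongr
            exact lp.norm_apply_le_norm (by simp) f v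
        _ ≤ ‖f‖ * (C * ‖F‖) := by
            rw [← Finset.mul_sum]
            gcongr
            exact hb F s
        _ = C * ‖f‖ * ‖F‖ := by ring

theorem hasSum_dualSum {b : V → X →L[ℂ] ℂ} {C : ℝ}
    (hb : ∀ F (s : Finset V), ∑ v ∈ s, ‖b v F‖ ≤ C * ‖F‖) (f : lp (fun _ : V => ℂ) ∞) (F : X) :
    HasSum (fun v => f v * b v F) (dualSum b hb f F) :=
  (summable_norm_mul_dual hb f F).of_norm.hasSum

/-- If `1 + B A` is invertible, then `1 + A B` is invertible. -/
theorem exists_inverse_one_add_comp {Y Z : Type*} [NormedAddCommGroup Y] [NormedSpace ℂ Y]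
    [NormedAddCommGroup Z] [NormedSpace ℂ Z] (A : Y →L[ℂ] Z) (B : Z →L[ℂ] Y) (T : Y ≃L[ℂ] Y)
    (hT : ∀ y, T y = y + B (A y)) : ∃ R : Z →L[ℂ] Z,
      (ContinuousLinearMap.id ℂ Z + A.comp B).comp R = ContinuousLinearMap.id ℂ Z ∧
      R.comp (ContinuousLinearMap.id ℂ Z + A.comp B) = ContinuousLinearMap.id ℂ Z := by
  refine ⟨ContinuousLinearMap.id ℂ Z - A.comp ((T.symm : Y →L[ℂ] Y).comp B), ?_, ?_⟩
  · ext z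
    have h1 := hT (T.symm (B z))
    rw [T.apply_symm_apply] at h1
    have h2 := congrArg A h1
    rw [map_add] at h2
    simp only [ContinuousLinearMap.comp_apply, add_apply, sub_apply,
      ContinuousLinearMap.id_apply, ContinuousLinearEquiv.coe_coe, map_sub]
    rw [h2]
    abel
  · ext z
    have h1 : T.symm (B z + B (A (B z))) = B z := by rw [← hT, T.symm_apply_apply]
    simp only [ContinuousLinearMap.comp_apply, add_apply, sub_apply,
      ContinuousLinearMap.id_apply, ContinuousLinearEquiv.coe_coe, map_add]
    rw [map_add] at h1
    have h2 := congrArg A h1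
    rw [map_add] at h2
    rw [sub_eq_of_eq_add h2.symm, sub_add_cancel]

theorem existsUnique_eq_apply {Z : Type*} [NormedAddCommGroup Z] [NormedSpace ℂ Z]
    {L R : Z →L[ℂ] Z} (h : L.comp R = ContinuousLinearMap.id ℂ Z)
    (h' : R.comp L = ContinuousLinearMap.id ℂ Z) (g : Z) : ∃! f, g = L f := by
  refine ⟨R g, (DFunLike.congr_fun h g).symm, fun f hf => ?_⟩
  rw [hf]
  exact (DFunLike.congr_fun h' f).symm

/-- The operator on bounded sequences is `dualEval` after `dualSum`; `T` is the identity plus the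
composition in the other order, so `exists_inverse_one_add_comp` transfers invertibility from the
dual of `X`. -/
theorem exists_invertible_of_factor {A : V → X} {b : V → X →L[ℂ] ℂ} {C C' : ℝ}
    (hA : ∀ u, ‖A u‖ ≤ C) (hb : ∀ F (s : Finset V), ∑ v ∈ s, ‖b v F‖ ≤ C' * ‖F‖)
    (T : (X →L[ℂ] ℂ) ≃L[ℂ] (X →L[ℂ] ℂ)) (hT : ∀ η, T η = η + dualSum b hb (dualEval A hA η)) :
    ∃ H : lp (fun _ : V => ℂ) ∞ →L[ℂ] lp (fun _ : V => ℂ) ∞,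
      (∀ f u, HasSum (fun v => f v * b v (A u)) (H f u)) ∧
      ∃ R : lp (fun _ : V => ℂ) ∞ →L[ℂ] lp (fun _ : V => ℂ) ∞,
        (ContinuousLinearMap.id ℂ _ + H).comp R = ContinuousLinearMap.id ℂ _ ∧
        R.comp (ContinuousLinearMap.id ℂ _ + H) = ContinuousLinearMap.id ℂ _ :=
  ⟨(dualEval A hA).comp (dualSum b hb), fun f u => hasSum_dualSum hb f (A u),
    exists_inverse_one_add_comp (dualEval A hA) (dualSum b hb) T hT⟩

end Factor

/-! ### Summation over the blocks -/

/-- Leibniz' rule for Taylor coefficients. -/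
theorem taylor_coeff_mul {f g : ℂ → ℂ} (hf : Differentiable ℂ f) (hg : Differentiable ℂ g) (m : ℕ)
    (w : ℂ) : 1 / (m.factorial : ℂ) * iteratedDeriv m (fun z => f z * g z) w =
      ∑ i ∈ Finset.range (m + 1), (1 / (i.factorial : ℂ) * iteratedDeriv i f w) *
        (1 / ((m - i).factorial : ℂ) * iteratedDeriv (m - i) g w) := by
  have h := iteratedDeriv_mul (n := m) (x := w) hf.contDiff.contDiffAt hg.contDiff.contDiffAt
  change iteratedDeriv m (fun z => f z * g z) w = _ at h
  rw [h, Finset.mul_sum]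
  refine Finset.sum_congr rfl fun i hi => ?_
  have h1 := Nat.choose_mul_factorial_mul_factorial (Nat.lt_succ_iff.1 (Finset.mem_range.1 hi))
  have h2 : ((m.choose i : ℂ)) * i.factorial * (m - i).factorial = m.factorial := by
    exact_mod_cast h1
  rw [← h2]
  have e1 := Nat.cast_ne_zero (R := ℂ).2 i.factorial_ne_zero
  have e2 := Nat.cast_ne_zero (R := ℂ).2 (m - i).factorial_ne_zero
  have e3 : (m.choose i : ℂ) ≠ 0 := by
    exact_mod_cast (Nat.choose_pos (Nat.lt_succ_iff.1 (Finset.mem_range.1 hi))).ne'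
  field_simp

/-- Interchange the sums over `k ≤ p` within each block: for fixed `p`, Leibniz' rule makes the sum
over `k` the Taylor coefficient of `f g` of order `pos lam p`. The hypothesis `hN` ensures that no
block is cut. -/
theorem IsBlocked.sum_residues {lam α : ℕ → ℂ} (h : IsBlocked lam) {f g : ℂ → ℂ}
    (hf : Differentiable ℂ f) (hg : Differentiable ℂ g) {N : ℕ}
    (hN : ∀ k n, lam k = lam n → k < N → n < N) :
    ∑ k ∈ Finset.range N, (1 / ((pos lam k).factorial : ℂ) * iteratedDeriv (pos lam k) f (lam k)) *
        ∑ p ∈ Finset.Ico k (blockStart lam k + mult lam k),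
          α p * (1 / ((p - k).factorial : ℂ) * iteratedDeriv (p - k) g (lam k)) =
      ∑ p ∈ Finset.range N, α p * (iteratedDeriv (pos lam p) (fun z => f z * g z) (lam p) /
        (pos lam p).factorial) := by
  have h1 : ∀ p, α p * (iteratedDeriv (pos lam p) (fun z => f z * g z) (lam p) /
      (pos lam p).factorial) = ∑ k ∈ Finset.Ico (blockStart lam p) (p + 1),
        (1 / ((pos lam k).factorial : ℂ) * iteratedDeriv (pos lam k) f (lam k)) *
          (α p * (1 / ((p - k).factorial : ℂ) * iteratedDeriv (p - k) g (lam k))) := by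
    intro p
    have hb := blockStart_le lam p
    rw [div_eq_mul_one_div, mul_comm _ (1 / _), taylor_coeff_mul hf hg, Finset.mul_sum,
      Finset.sum_Ico_eq_sum_range]
    have e : p + 1 - blockStart lam p = pos lam p + 1 := by
      unfold pos
      omega
    rw [e]
    refine Finset.sum_congr rfl fun i hi => ?_
    have hi' : i < pos lam p + 1 := Finset.mem_range.1 hi
    have e1 : lam (blockStart lam p + i) = lam p := by
      have := (h.eq_iff (n := p) (k := p)).1 rfl
      refine h.eq_iff.2 ⟨by omega, ?_⟩
      unfold pos at hi'
      omega
    have e2 : pos lam (blockStart lam p + i) = i := by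
      rw [pos, (blockStart_congr e1).1]
      omega
    have e3 : p - (blockStart lam p + i) = pos lam p - i := by
      unfold pos
      omega
    rw [e1, e2, e3]
    ring
  simp only [h1, Finset.mul_sum]
  refine Finset.sum_comm' fun k p => ?_
  simp only [Finset.mem_range, Finset.mem_Ico]
  constructor
  · rintro ⟨hk, hkp, hp⟩
    have e : lam p = lam k := h.eq_iff.2 ⟨(blockStart_le lam k).trans hkp, hp⟩
    exact ⟨⟨by rw [(blockStart_congr e).1]; exact blockStart_le lam k, by omega⟩, hN _ _ e.symm hk⟩
  · rintro ⟨⟨hk, hkp⟩, hp⟩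
    have hpp := (h.eq_iff (n := p) (k := p)).1 rfl
    have e : lam k = lam p := h.eq_iff.2 ⟨hk, by omega⟩
    refine ⟨hN _ _ e.symm hp, by omega, ?_⟩
    have := (h.eq_iff (n := k) (k := p)).1 e.symm
    exact this.2


/-! ### The model data -/

/-- Truncated subtraction merges the two cases, so that equality of model eigenvalues becomes a
statement about natural numbers. -/
theorem modelLam_eq (M n : ℕ) : modelLam M n = ((n - M : ℕ) : ℂ) ^ 2 := by
  unfold modelLam
  split_ifs with h
  · simp [Nat.sub_eq_zero_of_le h]
  · rw [Nat.cast_sub (by omega)]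

theorem modelLam_eq_iff {M k n : ℕ} : modelLam M k = modelLam M n ↔ k - M = n - M := by
  rw [modelLam_eq, modelLam_eq]
  refine ⟨fun h => ?_, fun h => by rw [h]⟩
  have h1 : (k - M) ^ 2 = (n - M) ^ 2 := by exact_mod_cast h
  exact Nat.pow_left_injective two_ne_zero h1

theorem isBlocked_modelLam (M : ℕ) : IsBlocked (modelLam M) where
  consecutive i j k hij hjk h := by
    rw [modelLam_eq_iff] at h ⊢
    omega
  finite n := by
    refine (finite_le_nat (n + M)).subset fun k hk => ?_
    have := modelLam_eq_iff.1 hk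
    change k ≤ n + M
    omega

theorem modelLam_simple {M n : ℕ} (hn : M < n) (k : ℕ) (hk : modelLam M k = modelLam M n) :
    k = n := by
  have := modelLam_eq_iff.1 hk
  omega

/-! ### Residue sums of the model and of the given problem. -/

section MainEquation

variable {x : ℝ}

/-- This is the series of `hasSum_cosine` with its zero frequency weighted by `1/π` instead of
`2/π`, which removes the extra term there. The other indices of the block at `0` have coefficient
zero, so derivatives at `0` do not enter. -/
theorem tendsto_sum_model (hx : x ∈ Icc 0 Real.pi) (M : ℕ) (F G : IntervalL2 x) :
    Tendsto (fun N => ∑ p ∈ Finset.range N, modelAlpha M p *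
      (iteratedDeriv (pos (modelLam M) p) (fun z => pair x F (cosVec x z) * pair x G (cosVec x z))
        (modelLam M p) / (pos (modelLam M) p).factorial)) atTop (𝓝 (pair x F G)) := by
  set h : ℂ → ℂ := fun z => pair x F (cosVec x z) * pair x G (cosVec x z) with hh
  have h1 := (tendsto_add_atTop_iff_nat 1).2 (hasSum_cosine hx F G).tendsto_sum_nat
  have h2 := h1.sub_const (1 / Real.pi * h 0)
  rw [hh] at h2
  simp only [add_sub_cancel_right] at h2
  rw [← tendsto_add_atTop_iff_nat (M + 1)]
  set T : ℕ → ℂ := fun p => modelAlpha M p * (iteratedDeriv (pos (modelLam M) p) h (modelLam M p) /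
    (pos (modelLam M) p).factorial) with hT
  have e : ∀ j : ℕ, T (M + 1 + j) = 2 / Real.pi * h (((j + 1 : ℕ) : ℂ) ^ 2) := by
    intro j
    have hj : M < M + 1 + j := by omega
    have e1 : M + 1 + j - M = j + 1 := by omega
    simp only [hT]
    rw [(block_of_simple (modelLam_simple hj)).2.1, modelAlpha, if_neg (by omega),
      if_neg (by omega), modelLam_eq, e1]
    simp
  have e0 : ∑ p ∈ Finset.range (M + 1), T p = 1 / Real.pi * h 0 := by
    rw [Finset.sum_eq_single 0]
    · have e0 : pos (modelLam M) 0 = 0 := Nat.zero_sub _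
      have e1 : modelLam M 0 = 0 := by simp [modelLam]
      simp only [hT]
      rw [e0, e1]
      simp [modelAlpha]
    · intro p hp hp0
      have := Finset.mem_range.1 hp
      simp only [hT]
      rw [modelAlpha, if_neg hp0, if_pos (by omega), zero_mul]
    · intro h0
      exact absurd (Finset.mem_range.2 (Nat.succ_pos M)) h0
  refine h2.congr fun N => ?_
  rw [Finset.sum_range_succ', add_comm N (M + 1), Finset.sum_range_add T (M + 1) N, e0]
  simp only [e, hh, Nat.cast_zero, ne_eq, OfNat.ofNat_ne_zero, not_false_eq_true, zero_pow]
  ring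

theorem IsSpectralData.isComparable {σ : ℝ → ℂ} {r₁ r₂ : ℂ[X]} {lam α : ℕ → ℂ}
    (hσ : MemLp σ 2 (volume.restrict (Ioo 0 Real.pi))) (hr : IsAdmissible r₁ r₂)
    (h : IsSpectralData σ r₁ r₂ lam α) : IsComparable r₁.natDegree
      ![lam, modelLam r₁.natDegree] ![α, modelAlpha r₁.natDegree] := by
  have hs := h.summable_xi_sq hσ hr
  refine ⟨?_, ?_, ⟨2, by norm_num, ?_⟩, hs⟩
  · filter_upwards [h.eventually_simple, eventually_gt_atTop r₁.natDegree] with n h1 h2 i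
    fin_cases i
    exacts [h1, modelLam_simple h2]
  · filter_upwards [h.asymptotics.norm.eventually (gt_mem_nhds (by simp : ‖(0 : ℂ)‖ < 1)),
      eventually_gt_atTop r₁.natDegree] with n h1 h2 i
    push_cast
    fin_cases i
    · exact h1.le
    · change ‖rho (modelLam r₁.natDegree n) - _‖ ≤ 1
      rw [rho_modelLam h2, sub_self, norm_zero]
      exact zero_le_one
  · have hm : ∀ n, ‖modelAlpha r₁.natDegree n‖ ≤ 1 := by
      intro n
      unfold modelAlpha
      have h3 := Real.pi_gt_three
      split_ifs <;> simp only [norm_div, norm_one, norm_zero, Complex.norm_real, Real.norm_eq_abs,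
        abs_of_pos Real.pi_pos, RCLike.norm_ofNat, zero_le_one]
      · exact (div_le_one (by linarith)).2 (by linarith)
      · exact (div_le_one (by linarith)).2 (by linarith)
    filter_upwards [hs.tendsto_atTop_zero.eventually (gt_mem_nhds one_pos)] with n hn i
    fin_cases i
    · change ‖α n‖ ≤ 2
      have h1 := xi_nonneg ![lam, modelLam r₁.natDegree] ![α, modelAlpha r₁.natDegree] n
      have h2 : ‖α n - modelAlpha r₁.natDegree n‖ ≤
          xi ![lam, modelLam r₁.natDegree] ![α, modelAlpha r₁.natDegree] n :=
        le_add_of_nonneg_left (norm_nonneg _)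
      have h3 : xi ![lam, modelLam r₁.natDegree] ![α, modelAlpha r₁.natDegree] n ≤ 1 :=
        (abs_le_one_iff_mul_self_le_one.2 (by nlinarith)).trans' (le_abs_self _)
      have h4 := norm_add_le (α n - modelAlpha r₁.natDegree n) (modelAlpha r₁.natDegree n)
      rw [sub_add_cancel] at h4
      linarith [hm n]
    · exact (hm n).trans one_le_two

/-- If `ξ_n ≠ 0`, the factors `χ_n` and `ξ_n` cancel and the transformation is undone. If `ξ_n = 0`,
the products with index `0` vanish and the identity requires the two Taylor vectors to coincide;
this is where equal places in the blocks are used. -/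
theorem row_mul_col {lam α : Fin 2 → ℕ → ℂ}
    (hpos : ∀ n : ℕ, lam 0 n = lam 1 n → α 0 n = α 1 n → pos (lam 0) n = pos (lam 1) n)
    (F G : IntervalL2 x) (n : ℕ) :
    ∑ i, pair x F (rowVec lam α x (n, i)) * pair x G (colVec lam α x (n, i)) =
      pair x F (taylorVec (lam 0) x n) * pair x G (coefVec (lam 0) (α 0) x n) -
        pair x F (taylorVec (lam 1) x n) * pair x G (coefVec (lam 1) (α 1) x n) := by
  simp only [Fin.sum_univ_two, rowVec, colVec, Matrix.cons_val_zero, Matrix.cons_val_one,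
    map_smul, map_sub, smul_eq_mul]
  rcases eq_or_ne (xi lam α n) 0 with h | h
  · have h1 : rho (lam 0 n) = rho (lam 1 n) := by
      refine sub_eq_zero.1 (norm_eq_zero.1 (le_antisymm ?_ (norm_nonneg _)))
      rw [← h]
      exact le_add_of_nonneg_right (norm_nonneg _)
    have h2 : α 0 n = α 1 n := by
      refine sub_eq_zero.1 (norm_eq_zero.1 (le_antisymm ?_ (norm_nonneg _)))
      rw [← h]
      exact le_add_of_nonneg_left (norm_nonneg _)
    have h3 : lam 0 n = lam 1 n := by rw [← rho_sq (lam 0 n), h1, rho_sq]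
    have h4 : taylorVec (lam 0) x n = taylorVec (lam 1) x n := by
      rw [taylorVec, taylorVec, h3, hpos n h3 h2]
    rw [h4]
    ring
  · have h1 : (chi lam α n : ℂ) * xi lam α n = 1 := by
      rw [chi, if_neg h, ← Complex.ofReal_mul, inv_mul_cancel₀ h, Complex.ofReal_one]
    linear_combination (pair x F (taylorVec (lam 0) x n) - pair x F (taylorVec (lam 1) x n)) *
      pair x G (coefVec (lam 0) (α 0) x n) * h1

theorem IsBlocked.eventually_sum_taylor_mul_coef {lam α : ℕ → ℂ} (h : IsBlocked lam)
    (hs : ∀ᶠ n in atTop, ∀ k, lam k = lam n → k = n) (F G : IntervalL2 x) : ∀ᶠ N in atTop,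
    ∑ k ∈ Finset.range N, pair x F (taylorVec lam x k) * pair x G (coefVec lam α x k) =
      ∑ p ∈ Finset.range N, α p * (iteratedDeriv (pos lam p)
        (fun z => pair x F (cosVec x z) * pair x G (cosVec x z)) (lam p) /
          (pos lam p).factorial) := by
  obtain ⟨N₀, hN₀⟩ := eventually_atTop.1 hs
  have hd : ∀ F : IntervalL2 x, Differentiable ℂ fun z => pair x F (cosVec x z) := fun F =>
    (pair x F).differentiable.comp (differentiable_cosVec x)
  filter_upwards [eventually_ge_atTop N₀] with N hN
  -- Beyond `N₀` all values are simple, so `range N` contains every block that it meets.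
  rw [← h.sum_residues (hd F) (hd G)]
  · refine Finset.sum_congr rfl fun k _ => ?_
    simp only [taylorVec, coefVec, map_sum, map_smul, smul_eq_mul,
      iteratedDeriv_clm_comp _ (differentiable_cosVec x)]
  · intro k n hkn hk
    by_contra! hn
    have := hN₀ n (hN.trans hn) k hkn
    omega

end MainEquation


/-! ### Invertibility -/

section Invertibility

variable {x : ℝ}

/-- The transpose of an operator with respect to the pairing. -/
def pairTranspose (K : IntervalL2 x ≃L[ℂ] IntervalL2 x) : IntervalL2 x ≃L[ℂ] IntervalL2 x :=
  ((pairDual x).trans (K.symm.arrowCongr (ContinuousLinearEquiv.refl ℂ ℂ))).trans (pairDual x).symm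

theorem pair_pairTranspose (K : IntervalL2 x ≃L[ℂ] IntervalL2 x) (F G : IntervalL2 x) :
    pair x (pairTranspose K F) G = pair x F (K G) := by
  rw [← pairDual_apply (pairTranspose K F), pairTranspose, ContinuousLinearEquiv.trans_apply,
    ContinuousLinearEquiv.apply_symm_apply]
  simp [pairDual_apply]

/-- The functional `F ↦ pair x F (colVec lam α x v)`. -/
def colDual (lam α : Fin 2 → ℕ → ℂ) (x : ℝ) (v : ℕ × Fin 2) : IntervalL2 x →L[ℂ] ℂ :=
  (pair x).flip (colVec lam α x v)

theorem colDual_apply (lam α : Fin 2 → ℕ → ℂ) (v : ℕ × Fin 2) (F : IntervalL2 x) :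
    colDual lam α x v F = pair x F (colVec lam α x v) := rfl

theorem exists_sum_norm_colDual_le (hx : x ∈ Icc 0 Real.pi) {M : ℕ} {lam α : Fin 2 → ℕ → ℂ}
    (h : IsComparable M lam α) : ∃ C : ℝ, ∀ (F : IntervalL2 x) (s : Finset (ℕ × Fin 2)),
      ∑ v ∈ s, ‖colDual lam α x v F‖ ≤ C * ‖F‖ := by
  obtain ⟨C, -, hC⟩ := exists_sum_norm_pair_colVec_le hx h
  exact ⟨C, hC⟩

theorem dense_span_phiVec {σ : ℝ → ℂ} (hσ : MemLp σ 2 (volume.restrict (Ioo 0 Real.pi)))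
    (hx : x ∈ Icc 0 Real.pi) {K : IntervalL2 x ≃L[ℂ] IntervalL2 x}
    (hK : ∀ lam, K (cosVec x lam) = phiVec hσ x lam) :
    Dense (Submodule.span ℂ (range (phiVec hσ x)) : Set (IntervalL2 x)) := by
  have h1 := K.surjective.denseRange.dense_image K.continuous (dense_span_cosVec hx)
  have h2 : range (phiVec hσ x) = (K : IntervalL2 x →ₗ[ℂ] IntervalL2 x) '' range (cosVec x) := by
    rw [← range_comp]
    exact congrArg range (funext fun z => (hK z).symm)
  rw [h2, ← Submodule.map_span]
  exact h1

/-- Adding `⟨F, G⟩` to `B ⟨F, ·⟩ G` cancels the model part, so the limit in `hlim` involves only the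
residues of the given Weyl function. The transposed transmutation operator moves the cosines to `φ`,
where `tendsto_sum_residues` evaluates that limit. -/
theorem exists_equiv_add_dualSum {σ : ℝ → ℂ} {r₁ r₂ : ℂ[X]} {lam₀ α₀ : ℕ → ℂ}
    (hσ : MemLp σ 2 (volume.restrict (Ioo 0 Real.pi))) (hr : IsAdmissible r₁ r₂)
    (h : IsSpectralData σ r₁ r₂ lam₀ α₀) {lam α : Fin 2 → ℕ → ℂ}
    (hlam : lam = ![lam₀, modelLam r₁.natDegree]) (hα : α = ![α₀, modelAlpha r₁.natDegree])
    (hpos : ∀ n : ℕ, lam 0 n = lam 1 n → α 0 n = α 1 n → pos (lam 0) n = pos (lam 1) n)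
    (hx : x ∈ Icc 0 Real.pi) {C C' : ℝ} (hA : ∀ u, ‖rowVec lam α x u‖ ≤ C)
    (hb : ∀ F (s : Finset (ℕ × Fin 2)), ∑ v ∈ s, ‖colDual lam α x v F‖ ≤ C' * ‖F‖) :
    ∃ T : (IntervalL2 x →L[ℂ] ℂ) ≃L[ℂ] (IntervalL2 x →L[ℂ] ℂ), ∀ η,
      T η = η + dualSum (colDual lam α x) hb (dualEval (rowVec lam α x) hA η) := by
  have hc : IsComparable r₁.natDegree lam α := by
    rw [hlam, hα]
    exact h.isComparable hσ hr
  have hlam0 : lam 0 = lam₀ := by rw [hlam]; rfl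
  have hlam1 : lam 1 = modelLam r₁.natDegree := by rw [hlam]; rfl
  have hα0 : α 0 = α₀ := by rw [hα]; rfl
  have hα1 : α 1 = modelAlpha r₁.natDegree := by rw [hα]; rfl
  set B := (dualSum (colDual lam α x) hb).comp (dualEval (rowVec lam α x) hA) with hB
  have hlim : ∀ F G : IntervalL2 x, Tendsto (fun N => ∑ p ∈ Finset.range N, α₀ p *
      (iteratedDeriv (pos lam₀ p) (fun z => pair x F (cosVec x z) * pair x G (cosVec x z))
        (lam₀ p) / (pos lam₀ p).factorial)) atTop (𝓝 (B (pair x F) G + pair x F G)) := by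
    intro F G
    have h1 := hasSum_dualSum hb (dualEval (rowVec lam α x) hA (pair x F)) G
    have h2 := h1.prod_fiberwise fun n => hasSum_fintype _
    simp only [dualEval_apply, colDual_apply, row_mul_col hpos] at h2
    refine (h2.tendsto_sum_nat.add (tendsto_sum_model hx r₁.natDegree F G)).congr' ?_
    have hb0 : IsBlocked (lam 0) := hlam0 ▸ h.isBlocked
    have hb1 : IsBlocked (lam 1) := hlam1 ▸ isBlocked_modelLam _
    filter_upwards [hb0.eventually_sum_taylor_mul_coef (α := α 0)
        (hc.simple.mono fun n hn => hn 0) F G,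
      hb1.eventually_sum_taylor_mul_coef (α := α 1) (hc.simple.mono fun n hn => hn 1) F G]
      with N h3 h4
    rw [Finset.sum_sub_distrib, h3, h4, hlam0, hlam1, hα0, hα1, sub_add_cancel]
  obtain ⟨K, hK⟩ := exists_transmutation hσ hx
  set Kt := pairTranspose K with hKt
  have hKt' : ∀ z μ, pair x (Kt (phiVec hσ x μ)) (cosVec x z) =
      pair x (phiVec hσ x z) (phiVec hσ x μ) := fun z μ => by
    rw [hKt, pair_pairTranspose, hK, pair_comm]
  have hφ : ∀ μ μ', (B (pair x (Kt (phiVec hσ x μ)))) (Kt (phiVec hσ x μ')) +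
      pair x (Kt (phiVec hσ x μ)) (Kt (phiVec hσ x μ')) =
        pair x (phiVec hσ x μ) (phiVec hσ x μ') := by
    intro μ μ'
    refine tendsto_nhds_unique (hlim _ _) ?_
    simp only [hKt']
    exact tendsto_sum_residues hσ hr h hx μ μ'
  have hd := dense_span_phiVec hσ hx hK
  -- Two continuous bilinear forms that agree on the dense span of the `φ(·, μ)`.
  have hform : ((B + ContinuousLinearMap.id ℂ _).comp
      ((pair x).comp (Kt : IntervalL2 x →L[ℂ] IntervalL2 x))).bilinearComp
        (ContinuousLinearMap.id ℂ _) (Kt : IntervalL2 x →L[ℂ] IntervalL2 x) = pair x := by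
    refine ContinuousLinearMap.ext_on hd ?_
    rintro _ ⟨μ, rfl⟩
    refine ContinuousLinearMap.ext_on hd ?_
    rintro _ ⟨μ', rfl⟩
    exact hφ μ μ'
  -- By `hform`, `1 + B` maps `Ψ F = ⟨Kt F, ·⟩` to `Φ F`, the functional `Kt G ↦ ⟨F, G⟩`. Both `Ψ`
  -- and `Φ` are isomorphisms, so `1 + B` is `Φ` after the inverse of `Ψ`.
  set Ψ := Kt.trans (pairDual x) with hΨ
  set Φ := (pairDual x).trans (Kt.arrowCongr (ContinuousLinearEquiv.refl ℂ ℂ)) with hΦ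
  refine ⟨Ψ.symm.trans Φ, fun η => ?_⟩
  obtain ⟨F, rfl⟩ := Ψ.surjective η
  ext G
  obtain ⟨G, rfl⟩ := Kt.surjective G
  have h1 := congrArg (fun L => L F G) hform
  change B (pair x (Kt F)) (Kt G) + pair x (Kt F) (Kt G) = pair x F G at h1
  rw [ContinuousLinearEquiv.trans_apply, Ψ.symm_apply_apply]
  have h2 : Φ F (Kt G) = pair x F G := by
    rw [hΦ, ContinuousLinearEquiv.trans_apply]
    simp [pairDual_apply]
  rw [h2, ← h1, add_comm]
  rfl

end Invertibility

end

end SturmLiouville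

/-! ### Solvability of the main equation. -/

theorem mainTheorem5
    (σ : ℝ → ℂ) (hσ : MemLp σ 2 (volume.restrict (Ioo 0 Real.pi)))
    (r₁ r₂ : ℂ[X]) (hr : SturmLiouville.IsAdmissible r₁ r₂)
    (lam₀ α₀ : ℕ → ℂ) (hdata : SturmLiouville.IsSpectralData σ r₁ r₂ lam₀ α₀)
    (lam α : Fin 2 → ℕ → ℂ)
    (hlam : lam = ![lam₀, SturmLiouville.modelLam r₁.natDegree])
    (hα : α = ![α₀, SturmLiouville.modelAlpha r₁.natDegree])
    (hpos : ∀ n : ℕ, lam 0 n = lam 1 n → α 0 n = α 1 n →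
      SturmLiouville.pos (lam 0) n = SturmLiouville.pos (lam 1) n)
    (x : ℝ) (hx : x ∈ Icc 0 Real.pi) :
    ∃ H : SturmLiouville.BddSeq →L[ℂ] SturmLiouville.BddSeq,
      (∀ (f : SturmLiouville.BddSeq) (u : ℕ × Fin 2),
        HasSum (fun v : ℕ × Fin 2 => SturmLiouville.HT lam α x u v * f v) (H f u)) ∧
      (∃ R : SturmLiouville.BddSeq →L[ℂ] SturmLiouville.BddSeq,
        (ContinuousLinearMap.id ℂ SturmLiouville.BddSeq + H).comp R
          = ContinuousLinearMap.id ℂ SturmLiouville.BddSeq ∧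
        R.comp (ContinuousLinearMap.id ℂ SturmLiouville.BddSeq + H)
          = ContinuousLinearMap.id ℂ SturmLiouville.BddSeq) ∧
      ∃ g : SturmLiouville.BddSeq,
        (∀ u : ℕ × Fin 2, g u = SturmLiouville.psiT lam α x u) ∧
        ∃! f : SturmLiouville.BddSeq,
          g = (ContinuousLinearMap.id ℂ SturmLiouville.BddSeq + H) f := by
  have hc : SturmLiouville.IsComparable r₁.natDegree lam α := by
    rw [hlam, hα]
    exact hdata.isComparable hσ hr
  obtain ⟨C, hA⟩ := SturmLiouville.exists_norm_rowVec_le hx hc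
  obtain ⟨C', hb⟩ := SturmLiouville.exists_sum_norm_colDual_le hx hc
  obtain ⟨T, hT⟩ := SturmLiouville.exists_equiv_add_dualSum hσ hr hdata hlam hα hpos hx hA hb
  obtain ⟨H, hH, R, hR, hR'⟩ := SturmLiouville.exists_invertible_of_factor hA hb T hT
  obtain ⟨K, hK⟩ := SturmLiouville.exists_norm_psiT_le hx hc
  have hg : Memℓp (SturmLiouville.psiT lam α x) ∞ :=
    memℓp_infty ⟨K, by rintro _ ⟨u, rfl⟩; exact hK u⟩
  refine ⟨H, fun f u => (hH f u).congr_fun fun v => ?_, ⟨R, hR, hR'⟩,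
    ⟨SturmLiouville.psiT lam α x, hg⟩, fun _ => rfl, SturmLiouville.existsUnique_eq_apply hR hR' _⟩
  rw [SturmLiouville.HT_eq_pair hx, SturmLiouville.colDual_apply, mul_comm]
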